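/- Let $X$ be a locally compact Polish space. A configuration is a collection $\gamma$ of points of $X$, multiple points being allowed, with finitely many points in each compact set. $\Gamma$ is the set of all configurations with the vague topology (the weakest one making $\gamma\mapsto\sum_{x\in\gamma}g(x)$ continuous for each continuous compactly supported $g$) and its Borel $\sigma$-field. Sums and products over $x\in\gamma$ respect multiplicities; $\gamma\cup\xi$ adds multiplicities and $\gamma\setminus x$ removes one point at $x$. Let $|\xi|$ denote the number of points of $\xi$. Let $\psi:X\to(0,\infty)$ be continuous and vanish at infinity. Let $\Gamma^\psi=\{\gamma\in\Gamma:\sum_{x\in\gamma}\psi(x)<\infty\}$ be equipped with the weakest topology making $\gamma\mapsto\sum_{x\in\gamma}g(x)\psi(x)$ continuous for each bounded continuous $g:X\to\mathbb{R}$, and with its Borel $\sigma$-field. $\mathcal{P}(\Gamma^\psi)$ is the set of probability measures on $\Gamma^\psi$ with the weak topology, and $\mu(F)=\int F\,d\mu$. Let $b$ be a probability kernel from $X$ to $\Gamma$ such that each $b_x$ is concentrated on finite configurations. Put $\delta(x)=b_x(\{\varnothing\})$, $n(x)=\int|\xi|\,b_x(d\xi)$, $n_*=\sup_x n(x)$ and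 $(\Phi\phi)(x)=\int\prod_{y\in\xi}\phi(y)\,b_x(d\xi)$. Assume: (i) $\Phi(e^{-g\psi})$ is continuous on $X$ for each bounded continuous $g\ge 0$; (ii) $n_*<\infty$; (iii) there is $\delta_*>0$ with $\delta(x)\ge 1-\psi(x)\ge\delta_*$ for all $x$; (iv) there is $m>0$ with $\int\sum_{y\in\xi}\psi(y)\,b_x(d\xi)\le n(x)\,m\,\psi(x)$ for all $x$. Let $C_\psi(X)$ be the set of all bounded continuous $\phi:X\to\mathbb{R}$ for which there is $c_\phi>0$ with $c_\phi\psi(x)\le 1-\phi(x)\le 1-\delta(x)$ for all $x$, and assume that $C_\psi(X)$ is non-empty. For $\phi\in C_\psi(X)$ put $F^\phi(\gamma)=\prod_{x\in\gamma}\phi(x)$, $\gamma\in\Gamma^\psi$, and let $E^0$ be the linear span of these functions. For $F\in E^0$ put $$(LF)(\gamma)=\sum_{x\in\gamma}\int_\Gamma\bigl[F(\gamma\setminus x\cup\xi)-F(\gamma)\bigr]\,b_x(d\xi),\qquad \gamma\in\Gamma^\psi .$$ Theorem. $E^0$ and $L(E^0)$ consist of bounded continuous functions on $\Gamma^\psi$,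 and $L:E^0\to C_{\rm b}(\Gamma^\psi)$ is closable in $C_{\rm b}(\Gamma^\psi)$ with the supremum norm. Let $(L,\mathcal{D}(L))$ denote its closure, so that $\mathcal{D}(L)$ is the closure of $E^0$ in the graph norm $\|F\|+\|LF\|$. Then for each $\mu_0\in\mathcal{P}(\Gamma^\psi)$ there is exactly one map $[0,\infty)\ni t\mapsto\mu_t\in\mathcal{P}(\Gamma^\psi)$ with initial value $\mu_0$ such that $t\mapsto\mu_t(F)$ is measurable for each bounded measurable $F:\Gamma^\psi\to\mathbb{R}$ and $$\mu_t(F)=\mu_0(F)+\int_0^t\mu_s(LF)\,ds\qquad\text{for all } t\ge 0,\ F\in\mathcal{D}(L).$$ This map is weakly continuous in $t$. If $n_*<1$, then $\mu_t$ converges weakly, as $t\to+\infty$, to the Dirac measure at the empty configuration. -/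

import Mathlib

open MeasureTheory ProbabilityTheory Filter Topology
open scoped ENNReal NNReal BoundedContinuousFunction

noncomputable section

namespace Branching

/-- A configuration: a collection of particles located in `X`, multiple locations being allowed,
with only finitely many particles in every compact set. `mult x` is the number of particles
located at `x`. Sums over `x ∈ γ` are sums over `x : X` weighted with `mult x`. -/
@[ext]
structure Configuration (X : Type*) [TopologicalSpace X] where
  mult : X → ℕ
  finite_inter : ∀ K : Set X, IsCompact K → {x | x ∈ K ∧ mult x ≠ 0}.Finite

namespace Configuration

variable {X : Type*} [TopologicalSpace X]

/-- The empty configuration. -/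
instance : Zero (Configuration X) where
  zero := ⟨fun _ => 0, fun _ _ => by simp⟩

/-- The union `γ ∪ ξ`, multiplicities being added. -/
instance : Add (Configuration X) where
  add γ ξ := ⟨fun x => γ.mult x + ξ.mult x, fun K hK =>
    ((γ.finite_inter K hK).union (ξ.finite_inter K hK)).subset (by
      rintro x ⟨hx, h⟩
      by_cases h0 : γ.mult x = 0
      · exact Or.inr ⟨hx, fun h1 => h (by simp [h0, h1])⟩
      · exact Or.inl ⟨hx, h0⟩)⟩

open Classical in
/-- `γ \ x`: one particle located at `x` is removed. -/
def erase (γ : Configuration X) (x : X) : Configuration X where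
  mult y := if y = x then γ.mult y - 1 else γ.mult y
  finite_inter K hK := (γ.finite_inter K hK).subset (by
    rintro y ⟨hy, h⟩
    refine ⟨hy, fun h0 => h ?_⟩
    simp [h0])

/-- The configuration consists of finitely many particles. -/
def IsFinite (γ : Configuration X) : Prop := {x | γ.mult x ≠ 0}.Finite

/-- The number of particles `|γ|`. -/
def card (γ : Configuration X) : ℝ≥0∞ := ∑' x, (γ.mult x : ℝ≥0∞)

/-- The product `∏_{x ∈ γ} φ(x)`; it is equal to `1` for the empty configuration. -/
def prodOver (φ : X → ℝ) (γ : Configuration X) : ℝ := ∏' x, φ x ^ γ.mult x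

/-- `γ` is tempered: `∑_{x ∈ γ} ψ(x) < ∞`. -/
def IsTempered (ψ : X → ℝ) (γ : Configuration X) : Prop :=
  Summable fun x => (γ.mult x : ℝ) * ψ x

/-- The vague topology: the weakest one that makes continuous all the maps
`γ ↦ ∑_{x ∈ γ} g(x)` with `g` continuous and compactly supported. -/
instance : TopologicalSpace (Configuration X) :=
  ⨅ g : CompactlySupportedContinuousMap X ℝ,
    TopologicalSpace.induced (fun γ : Configuration X => ∑' x, (γ.mult x : ℝ) * g x) inferInstance

instance : MeasurableSpace (Configuration X) := borel _

instance : BorelSpace (Configuration X) := ⟨rfl⟩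

end Configuration

/-- The set `Γ^ψ` of tempered configurations. -/
@[ext]
structure Tempered {X : Type*} [TopologicalSpace X] (ψ : X → ℝ) where
  toConfiguration : Configuration X
  isTempered : toConfiguration.IsTempered ψ

section

variable {X : Type*} [TopologicalSpace X]

namespace Tempered

variable {ψ : X → ℝ}

/-- The topology of `Γ^ψ`: the weakest one that makes continuous all the maps
`γ ↦ ∑_{x ∈ γ} g(x) ψ(x)` with `g` continuous and bounded. -/
instance : TopologicalSpace (Tempered ψ) :=
  ⨅ g : X →ᵇ ℝ, TopologicalSpace.induced
    (fun γ : Tempered ψ => ∑' x, (γ.toConfiguration.mult x : ℝ) * (g x * ψ x)) inferInstance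

instance : MeasurableSpace (Tempered ψ) := borel _

instance : BorelSpace (Tempered ψ) := ⟨rfl⟩

/-- The empty configuration. -/
instance : Zero (Tempered ψ) where
  zero := ⟨0, by
    have h : ∀ x : X, (0 : Configuration X).mult x = 0 := fun _ => rfl
    simp [Configuration.IsTempered, h]⟩

open Classical in
/-- Evaluation of a function on `Γ^ψ` at a configuration, with value `0` off `Γ^ψ`. -/
def extend (F : Tempered ψ → ℝ) (γ : Configuration X) : ℝ :=
  if h : γ.IsTempered ψ then F ⟨γ, h⟩ else 0

end Tempered

variable [MeasurableSpace X] [BorelSpace X]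

/-- The death probability `δ(x)`: no offspring is produced. -/
def deathProb (b : Kernel X (Configuration X)) (x : X) : ℝ := (b x).real {0}

/-- The expected number `n(x)` of offspring. -/
def meanOffspring (b : Kernel X (Configuration X)) (x : X) : ℝ≥0∞ := ∫⁻ ξ, ξ.card ∂(b x)

/-- `n_* = sup_x n(x)`. -/
def supMeanOffspring (b : Kernel X (Configuration X)) : ℝ≥0∞ := ⨆ x, meanOffspring b x

/-- The integral of `h ≥ 0` against the first correlation (intensity) measure of `b_x`, that is,
`∫ (∑_{y ∈ ξ} h(y)) b_x(dξ)`. -/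
def correlationIntegral (b : Kernel X (Configuration X)) (x : X) (h : X → ℝ) : ℝ≥0∞ :=
  ∫⁻ ξ, ∑' y, (ξ.mult y : ℝ≥0∞) * ENNReal.ofReal (h y) ∂(b x)

/-- `(Φ φ)(x) = ∫ ∏_{y ∈ ξ} φ(y) b_x(dξ)`. -/
def Phi (b : Kernel X (Configuration X)) (φ : X → ℝ) (x : X) : ℝ :=
  ∫ ξ, ξ.prodOver φ ∂(b x)

/-- The conditions imposed on the branching kernel `b` and on the weight `ψ`. -/
structure Admissible (b : Kernel X (Configuration X)) (ψ : X → ℝ) : Prop where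
  /-- almost surely, the cloud of offspring is finite -/
  finite_cloud : ∀ x, ∀ᵐ ξ ∂(b x), ξ.IsFinite
  /-- `Φ` maps the functions `e^{-gψ}` to continuous ones (they take values in `[0,1]`) -/
  continuous_Phi : ∀ g : X →ᵇ ℝ, (∀ x, 0 ≤ g x) →
    Continuous (Phi b fun x => Real.exp (-(g x * ψ x)))
  supMeanOffspring_lt_top : supMeanOffspring b < ⊤
  deathProb_ge : ∃ δs : ℝ, 0 < δs ∧ ∀ x, 1 - ψ x ≤ deathProb b x ∧ δs ≤ 1 - ψ x
  dispersal : ∃ m : ℝ≥0, 0 < m ∧ ∀ x,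
    correlationIntegral b x ψ ≤ meanOffspring b x * m * ENNReal.ofReal (ψ x)

/-- The class `C_ψ(X)` of continuous bounded `φ` with `c_φ ψ ≤ 1 - φ ≤ 1 - δ` for some
`c_φ > 0` depending on `φ`. -/
def Cpsi (b : Kernel X (Configuration X)) (ψ : X → ℝ) : Set (X →ᵇ ℝ) :=
  {φ | ∃ c : ℝ, 0 < c ∧ ∀ x, c * ψ x ≤ 1 - φ x ∧ 1 - φ x ≤ 1 - deathProb b x}

variable {ψ : X → ℝ}

/-- The function `F^φ(γ) = ∏_{x ∈ γ} φ(x)` on `Γ^ψ`. -/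
def Fphi (ψ : X → ℝ) (φ : X → ℝ) (γ : Tempered ψ) : ℝ := γ.toConfiguration.prodOver φ

/-- The Kolmogorov operator
`(LF)(γ) = ∑_{x ∈ γ} ∫ [F(γ \ x ∪ ξ) - F(γ)] b_x(dξ)`. Note that `γ \ x ∪ ξ` is in `Γ^ψ`
for all finite `ξ`. -/
def kolmogorov (b : Kernel X (Configuration X)) (F : Tempered ψ → ℝ) (γ : Tempered ψ) : ℝ :=
  ∑' x, (γ.toConfiguration.mult x : ℝ) *
    ∫ ξ, (Tempered.extend F (γ.toConfiguration.erase x + ξ) - F γ) ∂(b x)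

/-- `E⁰(Γ^ψ)`: the linear span of the functions `F^φ`, `φ ∈ C_ψ(X)`, in `C_b(Γ^ψ)`. -/
def E0 (b : Kernel X (Configuration X)) (ψ : X → ℝ) : Submodule ℝ (Tempered ψ →ᵇ ℝ) :=
  Submodule.span ℝ {F | ∃ φ ∈ Cpsi b ψ, ∀ γ, F γ = Fphi ψ φ γ}

/-- The graph of `L` on `E⁰(Γ^ψ)`, in `C_b(Γ^ψ) × C_b(Γ^ψ)`. -/
def preGraph (b : Kernel X (Configuration X)) (ψ : X → ℝ) :
    Set ((Tempered ψ →ᵇ ℝ) × (Tempered ψ →ᵇ ℝ)) :=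
  {p | p.1 ∈ E0 b ψ ∧ ∀ γ, p.2 γ = kolmogorov b p.1 γ}

/-- The graph of the closed operator `(L, D(L))`: `D(L)` is the closure of `E⁰(Γ^ψ)` in the graph
norm `‖F‖ + ‖LF‖`. Thus `(F, G)` is in this set if and only if `F ∈ D(L)` and `LF = G`. -/
def graphL (b : Kernel X (Configuration X)) (ψ : X → ℝ) :
    Set ((Tempered ψ →ᵇ ℝ) × (Tempered ψ →ᵇ ℝ)) :=
  closure (preGraph b ψ)

/-- `t ↦ μ_t` is a solution of the Fokker-Planck equation with initial state `μ₀`. -/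
structure IsFPSolution (b : Kernel X (Configuration X)) (ψ : X → ℝ)
    (μ₀ : ProbabilityMeasure (Tempered ψ)) (μ : ℝ≥0 → ProbabilityMeasure (Tempered ψ)) : Prop where
  initial : μ 0 = μ₀
  measurable : ∀ F : Tempered ψ → ℝ, Measurable F → (∃ C, ∀ γ, |F γ| ≤ C) →
    Measurable fun t : ℝ≥0 => ∫ γ, F γ ∂(μ t : Measure (Tempered ψ))
  equation : ∀ F LF : Tempered ψ →ᵇ ℝ, (F, LF) ∈ graphL b ψ → ∀ t : ℝ≥0,
    ∫ γ, F γ ∂(μ t : Measure (Tempered ψ)) = ∫ γ, F γ ∂(μ₀ : Measure (Tempered ψ)) +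
      ∫ s in (0 : ℝ)..t, ∫ γ, LF γ ∂(μ s.toNNReal : Measure (Tempered ψ))

end

end Branching

end

/-!
The proof rests on the duality between the branching process and the evolution equation
`∂_t q_t = Φ(q_t) - q_t` of a single particle: if the law of the process at time `t` is `μ_t`, then
`μ_t(F^φ) = μ_0(F^{q_t})`, where `q_0 = φ`.

*The evolution equation* is used in its mild form (`IsMild`). The operator `Φ` is Lipschitz with
constant `n_* < ∞`, so that solutions are unique by Grönwall's inequality. Since `Φ(q) ≥ δ ≥ 1 - ψ`,
bounds `1 - q ≤ Mψ` propagate in time, and `C_ψ(X)` is preserved (`CpsiWith.evolve`). For `n_* < 1`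
one has `1 - q_t ≤ e^{-(1 - n_*)t}`.

*Measures on `Γ^ψ`* are handled through their Laplace functionals `g ↦ ∫ ∏_{x ∈ γ} e^{-g(x)ψ(x)}`.
The topology of `Γ^ψ` is induced by countably many functionals `γ ↦ ∑_{x ∈ γ} g(x)ψ(x)`, which
embeds `Γ^ψ` into a cube. By the Stone-Weierstrass theorem on this compact space, Laplace functionals
identify finite measures (`eq_of_lap_eq`), detect the measurability of families of them
(`measurable_of_measurable_lap`) and detect weak convergence (`tendsto_of_tendsto_lap`).

*Existence.* The functionals represented by finite measures are stable under sums, mixtures,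
products (superposition of independent configurations) and increasing limits. The Picard iterates
from `0` of the evolution equation with initial value `e^{-gψ}` are obtained by these operations, as
functions of `g`, and they increase to a solution; hence this solution represents a law on `Γ^ψ`
(`isLap_flow`), of total mass `1` because `1` is the only solution started from `1`. The
superposition of independent families started from the particles of a random configuration gives
`μ_t` (`exists_transition`, `evol`). Weak continuity and extinction follow by dominated convergence.

*The operator.* One has `LF^φ = (∑_{x ∈ γ} (Φφ - φ)(x) / φ(x)) F^φ` (`genFphi`), and
`F^{q_h} = F^φ + h LF^φ + O(h²)` uniformly on `Γ^ψ` (`exists_abs_Fphi_sub_le`), because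
`F^φ ≤ e^{-c ∑ ψ}` for `φ ∈ C_ψ(X)` absorbs the powers of `∑ ψ` in the remainder. With the duality,
this yields the Fokker-Planck equation (`isFPSolution_evol`). Differentiating the equation at
`t = 0` for the process started at a fixed configuration `γ` gives `LF(γ)` in terms of `F`, whence the
closability (`eq_of_mem_graphL`).

*Uniqueness.* For an arbitrary solution, nothing but measurability in time is known. Still, the
expansion of `F^{q_h}` shows that `s ↦ μ_s(LF^φ)` is Hölder continuous with exponent `1/2`, so that
`s ↦ μ_s(F^{q_{t-s}})` is Hölder continuous with exponent `3/2`, hence constant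
(`IsFPSolution.integral_Fphi_eq`). This determines `μ_t(F^φ)` for `φ ∈ C_ψ(X)`. If `g` is bounded
below by a positive number, then `e^{-sgψ} ∈ C_ψ(X)` for small `s > 0`, and since Laplace transforms
are analytic, `μ_t` is determined (`eq_of_integral_Fphi_eq`).
-/

set_option linter.unusedSectionVars false

noncomputable section

namespace Branching

/-! ### Exponentials and products in `[0, ∞]` -/

/-- The function `u ↦ e^{-u}` on `[0, ∞]`, with `e^{-∞} = 0`. -/
def expNeg (u : ℝ≥0∞) : ℝ≥0∞ := EReal.exp (-(u : EReal))

/-- The function `p ↦ -log p`, with `-log 0 = ∞`; it is truncated to `0` for `p ≥ 1`. -/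
def negLog (p : ℝ≥0∞) : ℝ≥0∞ := (-(ENNReal.log p)).toENNReal

@[simp] lemma expNeg_zero : expNeg 0 = 1 := by simp [expNeg]

lemma continuous_expNeg : Continuous expNeg :=
  ENNReal.continuous_exp.comp (continuous_neg.comp continuous_coe_ennreal_ereal)

lemma antitone_expNeg : Antitone expNeg := fun _ _ h =>
  EReal.exp_monotone (EReal.neg_le_neg_iff.2 (EReal.coe_ennreal_le_coe_ennreal_iff.2 h))

lemma expNeg_le_one (u : ℝ≥0∞) : expNeg u ≤ 1 := by
  simpa using antitone_expNeg (zero_le (a := u))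

lemma expNeg_add (a b : ℝ≥0∞) : expNeg (a + b) = expNeg a * expNeg b := by
  unfold expNeg
  rw [← EReal.exp_add, EReal.coe_ennreal_add, EReal.neg_add, sub_eq_add_neg]
  · left; simp
  · right; simp

lemma expNeg_sum {ι : Type*} (s : Finset ι) (u : ι → ℝ≥0∞) :
    expNeg (∑ i ∈ s, u i) = ∏ i ∈ s, expNeg (u i) := by
  classical
  induction s using Finset.induction_on with
  | empty => simp
  | insert a s ha ih => rw [Finset.sum_insert ha, Finset.prod_insert ha, expNeg_add, ih]

lemma expNeg_natCast_mul (n : ℕ) (u : ℝ≥0∞) : expNeg (n * u) = expNeg u ^ n := by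
  have := expNeg_sum (Finset.range n) (fun _ => u)
  simpa using this

lemma expNeg_ofReal {r : ℝ} (hr : 0 ≤ r) :
    expNeg (ENNReal.ofReal r) = ENNReal.ofReal (Real.exp (-r)) := by
  unfold expNeg
  rw [EReal.coe_ennreal_ofReal, max_eq_left hr, ← EReal.coe_neg, EReal.exp_coe]

lemma measurable_negLog : Measurable negLog :=
  (ENNReal.measurable_log.neg).ereal_toENNReal

lemma expNeg_negLog {p : ℝ≥0∞} (hp : p ≤ 1) : expNeg (negLog p) = p := by
  unfold expNeg negLog
  rw [EReal.coe_toENNReal, neg_neg, ENNReal.exp_log]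
  simpa using hp

lemma antitone_negLog : Antitone negLog := fun _ _ h =>
  EReal.toENNReal_le_toENNReal (EReal.neg_le_neg_iff.2 (ENNReal.log_monotone h))

lemma negLog_ofReal {r : ℝ} (h0 : 0 < r) :
    negLog (ENNReal.ofReal r) = ENNReal.ofReal (-Real.log r) := by
  unfold negLog
  rw [ENNReal.log_ofReal_of_pos h0, ← EReal.coe_neg, EReal.toENNReal_of_ne_top (by simp)]
  simp

@[simp] lemma negLog_one : negLog 1 = 0 := by simp [negLog]

section Pair

variable {X : Type*} [TopologicalSpace X]

/-- The sum `∑_{x ∈ γ} f(x)` of a function with values in `[0, ∞]`. -/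
def pair (f : X → ℝ≥0∞) (γ : Configuration X) : ℝ≥0∞ := ∑' x, (γ.mult x : ℝ≥0∞) * f x

/-- The product `∏_{x ∈ γ} p(x)` of a function with values in `[0, 1]`, for an arbitrary
configuration: it is `0` if the product diverges. -/
def prodE (p : X → ℝ≥0∞) (γ : Configuration X) : ℝ≥0∞ := expNeg (pair (fun x => negLog (p x)) γ)

@[simp] lemma zero_mult (x : X) : (0 : Configuration X).mult x = 0 := rfl

@[simp] lemma add_mult (γ ξ : Configuration X) (x : X) :
    (γ + ξ).mult x = γ.mult x + ξ.mult x := rfl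

@[simp] lemma pair_zero (f : X → ℝ≥0∞) : pair f 0 = 0 := by simp [pair]

lemma pair_mono {f g : X → ℝ≥0∞} (h : ∀ x, f x ≤ g x) (γ : Configuration X) :
    pair f γ ≤ pair g γ := ENNReal.tsum_le_tsum fun x => by gcongr; exact h x

lemma pair_mul_left (c : ℝ≥0∞) (f : X → ℝ≥0∞) (γ : Configuration X) :
    pair (fun x => c * f x) γ = c * pair f γ := by
  simp only [pair, ← ENNReal.tsum_mul_left]
  exact tsum_congr fun x => by ring

lemma prodE_mono {p q : X → ℝ≥0∞} (h : ∀ x, p x ≤ q x) (γ : Configuration X) :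
    prodE p γ ≤ prodE q γ := antitone_expNeg (pair_mono (fun x => antitone_negLog (h x)) γ)

lemma prodE_le_one (p : X → ℝ≥0∞) (γ : Configuration X) : prodE p γ ≤ 1 := expNeg_le_one _

@[simp] lemma prodE_zero_config (p : X → ℝ≥0∞) : prodE p (0 : Configuration X) = 1 := by
  simp [prodE]

lemma prodE_of_isFinite {p : X → ℝ≥0∞} (hp : ∀ x, p x ≤ 1) {γ : Configuration X}
    (h : γ.IsFinite) : prodE p γ = ∏ x ∈ Set.Finite.toFinset h, p x ^ γ.mult x := by
  unfold prodE pair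
  rw [tsum_eq_sum (s := Set.Finite.toFinset h), expNeg_sum]
  · refine Finset.prod_congr rfl fun x _ => ?_
    rw [expNeg_natCast_mul, expNeg_negLog (hp x)]
  · intro x hx
    have : γ.mult x = 0 := by
      by_contra h0
      exact hx ((Set.Finite.mem_toFinset h).2 h0)
    simp [this]

lemma pair_iSup {f : ℕ → X → ℝ≥0∞} (hf : ∀ x, Monotone fun n => f n x)
    (γ : Configuration X) : pair (fun x => ⨆ n, f n x) γ = ⨆ n, pair (f n) γ := by
  unfold pair
  let _ : MeasurableSpace X := ⊤
  simp_rw [← lintegral_count]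
  rw [← lintegral_iSup (fun n => measurable_from_top)]
  · simp_rw [ENNReal.mul_iSup]
  · intro n m h x
    exact mul_le_mul_right (hf x h) _

end Pair

section Measurability

variable {X : Type*} [TopologicalSpace X] [PolishSpace X] [LocallyCompactSpace X]

/-- Continuous compactly supported functions increasing to `1`, each of them being eventually
equal to `1` at every point. -/
lemma exists_cutoff (X : Type*) [TopologicalSpace X] [PolishSpace X] [LocallyCompactSpace X] :
    ∃ χ : ℕ → CompactlySupportedContinuousMap X ℝ,
      (∀ n x, 0 ≤ χ n x ∧ χ n x ≤ 1) ∧ (∀ x, Monotone fun n => χ n x) ∧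
      ∀ x, ∃ N, ∀ n, N ≤ n → χ n x = 1 := by
  let K : CompactExhaustion X := default
  have h : ∀ n, ∃ f : C(X, ℝ), Set.EqOn f 1 (K n) ∧ Set.EqOn f 0 (interior (K (n + 1)))ᶜ ∧
      HasCompactSupport f ∧ ∀ x, f x ∈ Set.Icc (0 : ℝ) 1 := fun n =>
    exists_continuous_one_zero_of_isCompact (K.isCompact n) isOpen_interior.isClosed_compl
      (Set.disjoint_compl_right_iff_subset.2 (K.subset_interior_succ n))
  choose f h1 h0 hc hI using h
  refine ⟨fun n => ⟨f n, hc n⟩, fun n x => hI n x, fun x => ?_, fun x => ?_⟩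
  · refine monotone_nat_of_le_succ fun n => ?_
    change f n x ≤ f (n + 1) x
    by_cases hx : x ∈ K (n + 1)
    · rw [h1 (n + 1) hx]; exact (hI n x).2
    · rw [h0 n (fun hx' => hx (interior_subset hx'))]; exact (hI _ x).1
  · obtain ⟨N, hN⟩ := K.exists_mem x
    exact ⟨N, fun n hn => h1 n (K.subset hn hN)⟩

lemma iSup_ofReal_cutoff_mul {X : Type*} {χ : ℕ → X → ℝ}
    (h1 : ∀ n x, χ n x ≤ 1) (h : ∀ x, ∃ N, ∀ n, N ≤ n → χ n x = 1) (x : X) (a : ℝ≥0∞) :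
    ⨆ n, ENNReal.ofReal (χ n x) * a = a := by
  refine le_antisymm (iSup_le fun n => ?_) ?_
  · calc ENNReal.ofReal (χ n x) * a ≤ 1 * a := by
          gcongr; simpa using h1 n x
      _ = a := one_mul a
  · obtain ⟨N, hN⟩ := h x
    refine le_iSup_of_le N ?_
    simp [hN N le_rfl]

omit [PolishSpace X] [LocallyCompactSpace X] in
lemma measurable_pair_compactSupport (h : CompactlySupportedContinuousMap X ℝ)
    (h0 : ∀ x, 0 ≤ h x) :
    Measurable fun ξ : Configuration X => pair (fun x => ENNReal.ofReal (h x)) ξ := by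
  have hc : Continuous fun ξ : Configuration X => ∑' x, (ξ.mult x : ℝ) * h x :=
    continuous_iInf_dom (i := h) continuous_induced_dom
  have he : (fun ξ : Configuration X => pair (fun x => ENNReal.ofReal (h x)) ξ) =
      fun ξ => ENNReal.ofReal (∑' x, (ξ.mult x : ℝ) * h x) := by
    funext ξ
    rw [ENNReal.ofReal_tsum_of_nonneg]
    · refine tsum_congr fun x => ?_
      rw [ENNReal.ofReal_mul (by positivity), ENNReal.ofReal_natCast]
    · intro x; exact mul_nonneg (by positivity) (h0 x)
    · refine summable_of_hasFiniteSupport ?_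
      refine (ξ.finite_inter _ h.hasCompactSupport).subset fun x hx => ?_
      simp only [Function.mem_support, ne_eq, mul_eq_zero, not_or, Nat.cast_eq_zero] at hx
      exact ⟨subset_tsupport _ hx.2, hx.1⟩
  rw [he]
  exact hc.measurable.ennreal_ofReal

variable [MeasurableSpace X] [BorelSpace X]

/-- A measurable family of finite measures integrates jointly measurable functions to measurable
ones: after normalization, it is a kernel with bounded mass. -/
lemma measurable_lintegral_of_measurable_isFiniteMeasure {S A Y : Type*} [MeasurableSpace S]
    [MeasurableSpace A] [MeasurableSpace Y] {κ : A → Measure Y} (hκ : Measurable κ)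
    [∀ a, IsFiniteMeasure (κ a)] {f : S → Y → ℝ≥0∞} (hf : Measurable (Function.uncurry f)) :
    Measurable fun z : S × A => ∫⁻ y, f z.1 y ∂(κ z.2) := by
  have hu : Measurable fun a => κ a Set.univ := (Measure.measurable_coe .univ).comp hκ
  let K : Kernel A Y := ⟨fun a => (κ a Set.univ)⁻¹ • κ a, by
    refine Measure.measurable_of_measurable_coe _ fun s hs => ?_
    simp only [Measure.smul_apply, smul_eq_mul]
    exact hu.inv.mul ((Measure.measurable_coe hs).comp hκ)⟩
  have hK : IsFiniteKernel K := ⟨⟨1, ENNReal.one_lt_top, fun a => by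
    change (κ a Set.univ)⁻¹ * κ a Set.univ ≤ 1
    exact ENNReal.inv_mul_le_one _⟩⟩
  let K' : Kernel (S × A) Y := K.comap Prod.snd measurable_snd
  -- the zero measure is normalized to `0⁻¹ • 0 = 0`, which does no harm
  have he : (fun z : S × A => ∫⁻ y, f z.1 y ∂(κ z.2)) =
      fun z : S × A => κ z.2 Set.univ * ∫⁻ y, f z.1 y ∂(K' z) := by
    funext z
    change _ = _ * ∫⁻ y, f z.1 y ∂((κ z.2 Set.univ)⁻¹ • κ z.2)
    rw [lintegral_smul_measure, smul_eq_mul, ← mul_assoc]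
    by_cases h : κ z.2 = 0
    · simp [h]
    · rw [ENNReal.mul_inv_cancel (by simpa using h) (measure_ne_top _ _), one_mul]
  rw [he]
  refine (hu.comp measurable_snd).mul (Measurable.lintegral_kernel_prod_right ?_)
  exact hf.comp ((measurable_fst.comp measurable_fst).prodMk measurable_snd)

/-- The measure `∑_{x ∈ ξ} δ_x`. -/
def Configuration.toMeasure (ξ : Configuration X) : Measure X :=
  Measure.sum fun x => (ξ.mult x : ℝ≥0∞) • Measure.dirac x

omit [PolishSpace X] [LocallyCompactSpace X] [BorelSpace X] in
lemma lintegral_toMeasure (ξ : Configuration X) {f : X → ℝ≥0∞} (hf : Measurable f) :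
    ∫⁻ x, f x ∂ξ.toMeasure = pair f ξ := by
  simp [Configuration.toMeasure, lintegral_sum_measure, pair, lintegral_dirac' _ hf]

lemma lintegral_withDensity_toMeasure (ξ : Configuration X) {c f : X → ℝ≥0∞}
    (hc : Measurable c) (hf : Measurable f) :
    ∫⁻ x, f x ∂(ξ.toMeasure.withDensity c) = pair (fun x => c x * f x) ξ := by
  rw [lintegral_withDensity_eq_lintegral_mul _ hc hf]
  exact lintegral_toMeasure ξ (hc.mul hf)

/-- Weighted with a compactly supported function, a configuration is a finite measure, which depends
measurably on the configuration. -/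
lemma measurable_withDensity_toMeasure (χ : CompactlySupportedContinuousMap X ℝ)
    (h0 : ∀ x, 0 ≤ χ x) :
    (∀ ξ : Configuration X,
      IsFiniteMeasure (ξ.toMeasure.withDensity fun x => ENNReal.ofReal (χ x))) ∧
    Measurable fun ξ : Configuration X =>
      ξ.toMeasure.withDensity fun x => ENNReal.ofReal (χ x) := by
  have hχ : Measurable fun x => ENNReal.ofReal (χ x) :=
    χ.continuous.measurable.ennreal_ofReal
  have hfin : ∀ ξ : Configuration X,
      IsFiniteMeasure (ξ.toMeasure.withDensity fun x => ENNReal.ofReal (χ x)) := by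
    intro ξ
    refine isFiniteMeasure_withDensity ?_
    rw [lintegral_toMeasure ξ hχ, pair, tsum_eq_sum
      (s := (ξ.finite_inter _ χ.hasCompactSupport).toFinset)]
    · exact ENNReal.sum_ne_top.2 fun x _ => ENNReal.mul_ne_top (by simp) (by simp)
    · intro x hx
      simp only [Set.Finite.mem_toFinset, Set.mem_ofPred_eq, not_and, not_not] at hx
      by_cases h : χ x = 0
      · simp [h]
      · simp [hx (subset_tsupport _ h)]
  -- the masses of closed sets are limits of integrals of continuous functions, which are
  -- vaguely continuous after multiplication by `χ`
  refine ⟨hfin, Measurable.measure_of_isPiSystem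
    ((BorelSpace.measurable_eq).trans borel_eq_generateFrom_isClosed) isPiSystem_isClosed ?_ ?_⟩
  · intro F hF
    have hF : IsClosed F := hF
    refine ENNReal.measurable_of_tendsto (f := fun n (ξ : Configuration X) =>
      ∫⁻ x, hF.apprSeq n x ∂(ξ.toMeasure.withDensity fun x => ENNReal.ofReal (χ x))) ?_ ?_
    · intro n
      let k : CompactlySupportedContinuousMap X ℝ :=
        ⟨⟨fun x => χ x * (hF.apprSeq n x : ℝ), by
          exact χ.continuous.mul (NNReal.continuous_coe.comp (hF.apprSeq n).continuous)⟩,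
          χ.hasCompactSupport.mul_right⟩
      have := measurable_pair_compactSupport k
        (fun x => mul_nonneg (h0 x) (NNReal.coe_nonneg _))
      convert this using 2 with ξ
      rw [lintegral_withDensity_toMeasure ξ hχ
        (by exact (hF.apprSeq n).continuous.measurable.coe_nnreal_ennreal)]
      congr 1
      funext x
      change _ = ENNReal.ofReal (χ x * (hF.apprSeq n x : ℝ))
      rw [ENNReal.ofReal_mul (h0 x), ENNReal.ofReal_coe_nnreal]
    · rw [tendsto_pi_nhds]
      intro ξ
      have := hfin ξ
      exact HasOuterApproxClosed.tendsto_lintegral_apprSeq hF _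
  · have := measurable_pair_compactSupport χ h0
    convert this using 2 with ξ
    rw [← lintegral_one, lintegral_withDensity_toMeasure ξ hχ measurable_const]
    simp

/-- Sums `∑_{y ∈ ξ} f(s, y)` are jointly measurable in the parameter and in the configuration. -/
lemma measurable_pair {S : Type*} [MeasurableSpace S] {f : S → X → ℝ≥0∞}
    (hf : Measurable (Function.uncurry f)) :
    Measurable fun z : S × Configuration X => pair (f z.1) z.2 := by
  obtain ⟨χ, h01, hmono, h1⟩ := exists_cutoff X
  have he : (fun z : S × Configuration X => pair (f z.1) z.2) = fun z => ⨆ n,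
      ∫⁻ x, f z.1 x ∂(z.2.toMeasure.withDensity fun x => ENNReal.ofReal (χ n x)) := by
    funext z
    have hz : Measurable (f z.1) := hf.comp measurable_prodMk_left
    have hχ : ∀ n, Measurable fun x => ENNReal.ofReal (χ n x) := fun n =>
      (χ n).continuous.measurable.ennreal_ofReal
    have : ∀ n, ∫⁻ x, f z.1 x ∂(z.2.toMeasure.withDensity fun x => ENNReal.ofReal (χ n x)) =
        pair (fun x => ENNReal.ofReal (χ n x) * f z.1 x) z.2 := by
      intro n
      exact lintegral_withDensity_toMeasure z.2 (hχ n) hz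
    simp_rw [this]
    rw [← pair_iSup]
    · congr 1
      funext x
      rw [iSup_ofReal_cutoff_mul (χ := fun n x => χ n x) (fun n x => (h01 n x).2) h1]
    · intro x n m hnm
      exact mul_le_mul_left (ENNReal.ofReal_le_ofReal (hmono x hnm)) _
  rw [he]
  refine Measurable.iSup fun n => ?_
  have := measurable_withDensity_toMeasure (χ n) (fun x => (h01 n x).1)
  have h := this.1
  exact measurable_lintegral_of_measurable_isFiniteMeasure this.2 hf

lemma measurable_prodE {S : Type*} [MeasurableSpace S] {p : S → X → ℝ≥0∞}
    (hp : Measurable (Function.uncurry p)) :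
    Measurable fun z : S × Configuration X => prodE (p z.1) z.2 :=
  continuous_expNeg.measurable.comp
    (measurable_pair (f := fun s x => negLog (p s x)) (measurable_negLog.comp hp))

end Measurability

/-! ### Linear functionals on tempered configurations -/

section Wsum

variable {X : Type*} [TopologicalSpace X] {ψ : X → ℝ}

/-- Nonnegative bounded continuous functions on `X`. -/
abbrev Test (X : Type*) [TopologicalSpace X] := {g : X →ᵇ ℝ // 0 ≤ g}

/-- The functional `γ ↦ ∑_{x ∈ γ} g(x) ψ(x)`. -/
def wsum (g : X →ᵇ ℝ) (γ : Tempered ψ) : ℝ :=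
  ∑' x, (γ.toConfiguration.mult x : ℝ) * (g x * ψ x)

lemma continuous_wsum (g : X →ᵇ ℝ) : Continuous (wsum (ψ := ψ) g) :=
  continuous_iInf_dom (i := g) continuous_induced_dom

lemma Test.nonneg (g : Test X) (x : X) : 0 ≤ g.1 x := g.2 x

/-- Sums of functions dominated by a multiple of `ψ` converge on tempered configurations. -/
lemma Tempered.summable (γ : Tempered ψ) {u : X → ℝ} {c : ℝ}
    (hu : ∀ x, |u x| ≤ c * ψ x) : Summable fun x => (γ.toConfiguration.mult x : ℝ) * u x := by
  refine Summable.of_norm_bounded (γ.isTempered.mul_left c) fun x => ?_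
  rw [Real.norm_eq_abs, abs_mul, Nat.abs_cast]
  calc (γ.toConfiguration.mult x : ℝ) * |u x| ≤ γ.toConfiguration.mult x * (c * ψ x) := by
        gcongr; exact hu x
    _ = _ := by ring

lemma Tempered.summable_wsum (hψ : ∀ x, 0 < ψ x) (γ : Tempered ψ) (g : X →ᵇ ℝ) :
    Summable fun x => (γ.toConfiguration.mult x : ℝ) * (g x * ψ x) :=
  γ.summable (c := ‖g‖) fun x => by
    rw [abs_mul, abs_of_pos (hψ x)]
    exact mul_le_mul_of_nonneg_right (g.norm_coe_le_norm x) (hψ x).le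

@[simp] lemma wsum_zero (γ : Tempered ψ) : wsum 0 γ = 0 := by simp [wsum]

lemma wsum_add (hψ : ∀ x, 0 < ψ x) (g h : X →ᵇ ℝ) (γ : Tempered ψ) :
    wsum (g + h) γ = wsum g γ + wsum h γ := by
  rw [wsum, wsum, wsum, ← (γ.summable_wsum hψ g).tsum_add (γ.summable_wsum hψ h)]
  exact tsum_congr fun x => by simp; ring

lemma wsum_sub (hψ : ∀ x, 0 < ψ x) (g h : X →ᵇ ℝ) (γ : Tempered ψ) :
    wsum (g - h) γ = wsum g γ - wsum h γ := by
  rw [wsum, wsum, wsum, ← (γ.summable_wsum hψ g).tsum_sub (γ.summable_wsum hψ h)]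
  exact tsum_congr fun x => by simp; ring

lemma wsum_smul (c : ℝ) (g : X →ᵇ ℝ) (γ : Tempered ψ) :
    wsum (c • g) γ = c * wsum g γ := by
  rw [wsum, wsum, ← tsum_mul_left]
  exact tsum_congr fun x => by simp; ring

lemma wsum_nonneg (hψ : ∀ x, 0 < ψ x) {g : X →ᵇ ℝ} (hg : ∀ x, 0 ≤ g x) (γ : Tempered ψ) :
    0 ≤ wsum g γ :=
  tsum_nonneg fun x => mul_nonneg (by positivity) (mul_nonneg (hg x) (hψ x).le)

lemma wsum_mono (hψ : ∀ x, 0 < ψ x) {g h : X →ᵇ ℝ} (hgh : ∀ x, g x ≤ h x) (γ : Tempered ψ) :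
    wsum g γ ≤ wsum h γ :=
  (γ.summable_wsum hψ g).tsum_le_tsum (fun x => by
    have := hψ x; have := hgh x; gcongr) (γ.summable_wsum hψ h)

lemma abs_wsum_le (hψ : ∀ x, 0 < ψ x) {g h : X →ᵇ ℝ} (hgh : ∀ x, |g x| ≤ h x) (γ : Tempered ψ) :
    |wsum g γ| ≤ wsum h γ := by
  rw [abs_le]
  constructor
  · have := wsum_mono hψ (g := (-1 : ℝ) • h) (h := g)
      (fun x => by simpa using (abs_le.1 (hgh x)).1) γ
    rw [wsum_smul] at this
    linarith
  · exact wsum_mono hψ (fun x => (abs_le.1 (hgh x)).2) γ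

lemma ofReal_wsum (hψ : ∀ x, 0 < ψ x) {g : X →ᵇ ℝ} (hg : ∀ x, 0 ≤ g x) (γ : Tempered ψ) :
    ENNReal.ofReal (wsum g γ) =
      pair (fun x => ENNReal.ofReal (g x * ψ x)) γ.toConfiguration := by
  rw [wsum, ENNReal.ofReal_tsum_of_nonneg _ (γ.summable_wsum hψ g)]
  · exact tsum_congr fun x => by
      rw [ENNReal.ofReal_mul (by positivity), ENNReal.ofReal_natCast]
  · exact fun x => mul_nonneg (by positivity) (mul_nonneg (hg x) (hψ x).le)

/-- The function `γ ↦ ∏_{x ∈ γ} e^{-g(x)ψ(x)}` with values in `[0, ∞]`. -/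
def expW (g : Test X) (γ : Tempered ψ) : ℝ≥0∞ := ENNReal.ofReal (Real.exp (-wsum g.1 γ))

lemma expW_eq_expNeg (hψ : ∀ x, 0 < ψ x) (g : Test X) (γ : Tempered ψ) :
    expW g γ = expNeg (pair (fun x => ENNReal.ofReal (g.1 x * ψ x)) γ.toConfiguration) := by
  rw [← ofReal_wsum hψ g.nonneg, expNeg_ofReal (wsum_nonneg hψ g.nonneg γ), expW]

lemma expW_le_one (hψ : ∀ x, 0 < ψ x) (g : Test X) (γ : Tempered ψ) : expW g γ ≤ 1 := by
  rw [expW_eq_expNeg hψ]; exact expNeg_le_one _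

lemma measurable_expW (g : Test X) : Measurable (expW (ψ := ψ) g) :=
  ((continuous_wsum g.1).neg.rexp).measurable.ennreal_ofReal

@[simp] lemma expW_zero (γ : Tempered ψ) : expW 0 γ = 1 := by
  change ENNReal.ofReal (Real.exp (-wsum 0 γ)) = 1
  simp

/-- The Laplace functional `g ↦ ∫ ∏_{x ∈ γ} e^{-g(x)ψ(x)} ν(dγ)`. -/
def lap (ν : Measure (Tempered ψ)) (g : Test X) : ℝ≥0∞ := ∫⁻ γ, expW g γ ∂ν

@[simp] lemma lap_zero (ν : Measure (Tempered ψ)) : lap ν 0 = ν Set.univ := by simp [lap]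

lemma integral_exp_wsum (ν : Measure (Tempered ψ)) (g : Test X) :
    ∫ γ, Real.exp (-wsum g.1 γ) ∂ν = (lap ν g).toReal := by
  have hc : Continuous fun γ : Tempered ψ => Real.exp (-wsum g.1 γ) :=
    (continuous_wsum g.1).neg.rexp
  rw [integral_eq_lintegral_of_nonneg_ae (ae_of_all _ fun γ => (Real.exp_pos _).le)
    hc.measurable.aestronglyMeasurable]
  rfl

end Wsum

/-! ### The topology of tempered configurations is determined by countably many functionals -/

section Inducing

variable {X : Type*} [TopologicalSpace X] [PolishSpace X] [LocallyCompactSpace X] {ψ : X → ℝ}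

/-- A continuous function with compact support as a bounded continuous function. -/
def bcfOfCompactSupport (f : X → ℝ) (hf : Continuous f) (hc : HasCompactSupport f) : X →ᵇ ℝ :=
  BoundedContinuousFunction.ofNormedAddCommGroup f hf _
    (hc.exists_bound_of_continuous hf).choose_spec

/-- A countable family of functionals determines the topology: far out, all of them are controlled
by the total weight `∑ ψ`, and on compact sets, continuous functions form a separable space. -/
lemma exists_countable_continuous_wsum (hψ : ∀ x, 0 < ψ x) :
    ∃ S : Set (Test X), S.Countable ∧ ∀ t : TopologicalSpace (Tempered ψ),
      (∀ g ∈ S, Continuous[t, _] (wsum (ψ := ψ) g.1)) →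
        ∀ g : X →ᵇ ℝ, Continuous[t, _] (wsum (ψ := ψ) g) := by
  obtain ⟨χ, h01, hmono, h1⟩ := exists_cutoff X
  let d : ℕ → C(X, ℝ) := TopologicalSpace.denseSeq C(X, ℝ)
  have hd : DenseRange d := TopologicalSpace.denseRange_denseSeq _
  let P : ℕ → ℕ → X →ᵇ ℝ := fun k n => bcfOfCompactSupport (fun x => max (d k x) 0 * χ n x)
    (((d k).continuous.max continuous_const).mul (χ n).continuous)
    ((χ n).hasCompactSupport.mul_left)
  let N : ℕ → ℕ → X →ᵇ ℝ := fun k n => bcfOfCompactSupport (fun x => max (-d k x) 0 * χ n x)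
    (((d k).continuous.neg.max continuous_const).mul (χ n).continuous)
    ((χ n).hasCompactSupport.mul_left)
  let C : ℕ → X →ᵇ ℝ := fun n => bcfOfCompactSupport (fun x => χ n x)
    (χ n).continuous (χ n).hasCompactSupport
  let one : Test X := ⟨1, fun x => zero_le_one⟩
  let P' : ℕ × ℕ → Test X := fun k => ⟨P k.1 k.2, fun x =>
    mul_nonneg (le_max_right _ _) (h01 _ _).1⟩
  let N' : ℕ × ℕ → Test X := fun k => ⟨N k.1 k.2, fun x =>
    mul_nonneg (le_max_right _ _) (h01 _ _).1⟩
  let C' : ℕ → Test X := fun n => ⟨C n, fun x => (h01 _ _).1⟩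
  refine ⟨{one} ∪ Set.range C' ∪ Set.range P' ∪ Set.range N',
    (((Set.countable_singleton _).union (Set.countable_range _)).union
      (Set.countable_range _)).union (Set.countable_range _), fun t ht g => ?_⟩
  have hone : Continuous[t, _] (wsum (ψ := ψ) (1 : X →ᵇ ℝ)) := ht one (by simp)
  have hC : ∀ n, Continuous[t, _] (wsum (ψ := ψ) (C n)) := fun n => ht (C' n) (by simp)
  have hP : ∀ k n, Continuous[t, _] (wsum (ψ := ψ) (P k n)) := fun k n => ht (P' (k, n)) (by simp)
  have hN : ∀ k n, Continuous[t, _] (wsum (ψ := ψ) (N k n)) := fun k n => ht (N' (k, n)) (by simp)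
  rw [continuous_iff_continuousAt]
  intro γ
  refine continuousAt_of_locally_uniform_approx_of_continuousAt fun u hu => ?_
  obtain ⟨ε, hε, hεu⟩ := Metric.mem_uniformity_dist.1 hu
  -- the total weight is bounded by `B` near `γ`
  obtain ⟨B, hB0, hB⟩ : ∃ B : ℝ, 0 < B ∧ wsum 1 γ < B := by
    exact ⟨|wsum 1 γ| + 1, by positivity, by linarith [le_abs_self (wsum 1 γ)]⟩
  -- the weight outside of the support of some cutoff `χ n` is small near `γ`
  have hlim : Tendsto (fun n => wsum (C n) γ) atTop (𝓝 (wsum 1 γ)) := by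
    refine tendsto_tsum_of_dominated_convergence γ.isTempered (fun x => ?_)
      (Eventually.of_forall fun n x => ?_)
    · obtain ⟨M, hM⟩ := h1 x
      refine tendsto_const_nhds.congr' ?_
      filter_upwards [eventually_ge_atTop M] with n hn
      change _ = _ * (χ n x * ψ x)
      rw [hM n hn]; simp
    · change ‖_ * (χ n x * ψ x)‖ ≤ _
      rw [Real.norm_of_nonneg (mul_nonneg (by positivity)
        (mul_nonneg (h01 n x).1 (hψ x).le))]
      have := (h01 n x).2
      have := (hψ x).le
      gcongr
      nlinarith
  have hε' : 0 < ε / (2 * (‖g‖ + 1)) := by positivity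
  obtain ⟨n, hn⟩ := ((hlim.const_sub (wsum 1 γ)).eventually
    (gt_mem_nhds (show wsum 1 γ - wsum 1 γ < ε / (2 * (‖g‖ + 1)) by simpa using hε'))).exists
  have hnear : ∀ᶠ γ' in @nhds _ t γ,
      wsum 1 γ' < B ∧ wsum 1 γ' - wsum (C n) γ' < ε / (2 * (‖g‖ + 1)) := by
    refine ((hone.continuousAt (x := γ)).eventually (gt_mem_nhds hB)).and ?_
    exact ((hone.sub (hC n)).continuousAt (x := γ)).eventually (gt_mem_nhds hn)
  -- inside, `g` is replaced by an element of the dense sequence, split into its positive and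
  -- negative parts so as to remain in `Test X`
  obtain ⟨k, hk⟩ : ∃ k, ∀ x ∈ tsupport (χ n), |d k x - g x| < ε / (2 * B) := by
    have hopen : IsOpen {f : C(X, ℝ) | Set.MapsTo (fun x => f x - g x) (tsupport (χ n))
        (Metric.ball 0 (ε / (2 * B)))} := by
      have hc : Continuous fun f : C(X, ℝ) => f - g.toContinuousMap := by fun_prop
      exact (ContinuousMap.isOpen_setOfPred_mapsTo (χ n).hasCompactSupport
        Metric.isOpen_ball).preimage hc
    obtain ⟨k, hk⟩ := hd.exists_mem_open hopen ⟨g.toContinuousMap, fun x _ => by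
      simp only [BoundedContinuousFunction.coe_toContinuousMap, sub_self]
      exact Metric.mem_ball_self (by positivity)⟩
    exact ⟨k, fun x hx => by simpa using hk hx⟩
  refine ⟨_, hnear, fun γ' => wsum (P k n) γ' - wsum (N k n) γ',
    ((hP k n).sub (hN k n)).continuousAt, fun γ' hγ' => hεu ?_⟩
  change dist (wsum g γ') (wsum (P k n) γ' - wsum (N k n) γ') < ε
  rw [← wsum_sub hψ, Real.dist_eq, ← wsum_sub hψ]
  have hg0 : 0 ≤ ‖g‖ := norm_nonneg g
  have hb : ∀ x, |(g - (P k n - N k n)) x| ≤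
      (‖g‖ • ((1 : X →ᵇ ℝ) - C n) + (ε / (2 * B)) • (1 : X →ᵇ ℝ)) x := by
    intro x
    change |g x - (max (d k x) 0 * χ n x - max (-d k x) 0 * χ n x)| ≤
      ‖g‖ * (1 - χ n x) + ε / (2 * B) * 1
    have hm : max (d k x) 0 - max (-d k x) 0 = d k x := by
      rcases le_total (d k x) 0 with h | h
      · rw [max_eq_right h, max_eq_left (by linarith)]; ring
      · rw [max_eq_left h, max_eq_right (by linarith)]; ring
    rw [← sub_mul, hm]
    have h2 : |(g x - d k x) * χ n x| ≤ ε / (2 * B) := by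
      by_cases hx : x ∈ tsupport (χ n)
      · rw [abs_mul, abs_of_nonneg (h01 n x).1, abs_sub_comm]
        calc |d k x - g x| * χ n x ≤ ε / (2 * B) * 1 :=
              mul_le_mul (hk x hx).le (h01 n x).2 (h01 n x).1 (by positivity)
          _ = _ := mul_one _
      · rw [image_eq_zero_of_notMem_tsupport hx]; simp; positivity
    have h3 : |g x * (1 - χ n x)| ≤ ‖g‖ * (1 - χ n x) := by
      have := (h01 n x).2
      rw [abs_mul, abs_of_nonneg (a := 1 - χ n x) (by linarith)]
      exact mul_le_mul_of_nonneg_right (g.norm_coe_le_norm x) (by linarith)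
    calc |g x - d k x * χ n x| = |g x * (1 - χ n x) + (g x - d k x) * χ n x| := by
          congr 1; ring
      _ ≤ _ := (abs_add_le _ _).trans (by linarith)
  refine (abs_wsum_le hψ hb γ').trans_lt ?_
  rw [wsum_add hψ, wsum_smul, wsum_smul, wsum_sub hψ]
  have e1 : ‖g‖ * (wsum 1 γ' - wsum (C n) γ') ≤ ε / 2 := by
    calc ‖g‖ * (wsum 1 γ' - wsum (C n) γ') ≤ ‖g‖ * (ε / (2 * (‖g‖ + 1))) := by
          gcongr; exact hγ'.2.le
      _ = ε / 2 * (‖g‖ / (‖g‖ + 1)) := by field_simp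
      _ ≤ ε / 2 * 1 := by
          gcongr; rw [div_le_one (by positivity)]; linarith
      _ = _ := mul_one _
  have e2 : ε / (2 * B) * wsum 1 γ' < ε / 2 := by
    calc ε / (2 * B) * wsum 1 γ' < ε / (2 * B) * B := by
          gcongr; exact hγ'.1
      _ = ε / 2 := by field_simp
  linarith

/-- The map `γ ↦ (∏_{x ∈ γ} e^{-g(x)ψ(x)})_{g ∈ S}` into a cube. -/
def cubeMap (hψ : ∀ x, 0 < ψ x) (S : Set (Test X)) (γ : Tempered ψ) : S → unitInterval :=
  fun g => ⟨Real.exp (-wsum g.1.1 γ), (Real.exp_pos _).le,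
    Real.exp_le_one_iff.2 (neg_nonpos.2 (wsum_nonneg hψ g.1.nonneg γ))⟩

lemma continuous_cubeMap (hψ : ∀ x, 0 < ψ x) (S : Set (Test X)) :
    Continuous (cubeMap hψ S) :=
  continuous_pi fun g => ((continuous_wsum g.1.1).neg.rexp).subtype_mk _

lemma exists_isInducing_cubeMap (hψ : ∀ x, 0 < ψ x) :
    ∃ S : Set (Test X), S.Countable ∧ IsInducing (cubeMap hψ S) := by
  obtain ⟨S, hS, h⟩ := exists_countable_continuous_wsum hψ
  refine ⟨S, hS, ⟨le_antisymm (continuous_iff_le_induced.1 (continuous_cubeMap hψ S)) ?_⟩⟩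
  refine le_iInf fun g => ?_
  rw [← continuous_iff_le_induced]
  refine h _ (fun g hg => ?_) g
  have hlog : ∀ {T : Type _} [TopologicalSpace T] (k : T → S → unitInterval) (i : S),
      Continuous k → (∀ z, (k z i : ℝ) ≠ 0) → Continuous fun z => -Real.log (k z i) :=
    fun k i hk h0 =>
      (Continuous.log (continuous_subtype_val.comp ((continuous_apply i).comp hk)) h0).neg
  have h2 : (wsum (ψ := ψ) g.1) = fun γ => -Real.log (cubeMap hψ S γ ⟨g, hg⟩) := by
    funext γ; simp [cubeMap]
  rw [h2]
  exact @hlog _ (TopologicalSpace.induced (cubeMap hψ S) _) _ _ continuous_induced_dom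
    fun γ => (Real.exp_pos _).ne'

lemma measurableSpace_eq_comap_cubeMap (hψ : ∀ x, 0 < ψ x) {S : Set (Test X)} (hS : S.Countable)
    (h : IsInducing (cubeMap hψ S)) :
    (Tempered.instMeasurableSpace : MeasurableSpace (Tempered ψ)) =
      MeasurableSpace.comap (cubeMap hψ S) inferInstance := by
  have := hS.to_subtype
  rw [(BorelSpace.measurable_eq : (inferInstance : MeasurableSpace (S → unitInterval)) = borel _),
    ← borel_comap, ← h.eq_induced]
  exact BorelSpace.measurable_eq

/-- A map into `Γ^ψ` is measurable as soon as its compositions with linear functionals are. -/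
lemma measurable_of_measurable_wsum (hψ : ∀ x, 0 < ψ x) {Ω : Type*} [MeasurableSpace Ω]
    {f : Ω → Tempered ψ} (hf : ∀ g : Test X, Measurable fun ω => wsum g.1 (f ω)) :
    Measurable f := by
  obtain ⟨S, hS, h⟩ := exists_isInducing_cubeMap (X := X) hψ
  rw [measurable_iff_comap_le, measurableSpace_eq_comap_cubeMap hψ hS h,
    MeasurableSpace.comap_comp, ← measurable_iff_comap_le]
  exact measurable_pi_lambda _ fun g => ((hf g.1).neg.exp).subtype_mk

/-- The functions `e^{-∑ gψ}` span a dense subspace of the continuous functions on the cube. -/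
lemma submodule_eq_top_of_expW (hψ : ∀ x, 0 < ψ x) (S : Set (Test X))
    (V : Submodule ℝ C(S → unitInterval, ℝ)) (hV : IsClosed (V : Set C(S → unitInterval, ℝ)))
    (h : ∀ (f : C(S → unitInterval, ℝ)) (g : Test X),
      (∀ γ : Tempered ψ, f (cubeMap hψ S γ) = Real.exp (-wsum g.1 γ)) → f ∈ V) : V = ⊤ := by
  let coord : S → C(S → unitInterval, ℝ) := fun i => ⟨fun z => (z i : ℝ), by fun_prop⟩
  let A : Subalgebra ℝ C(S → unitInterval, ℝ) := Algebra.adjoin ℝ (Set.range coord)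
  have hsep : A.SeparatesPoints := by
    intro y z hyz
    obtain ⟨i, hi⟩ := Function.ne_iff.1 hyz
    exact ⟨_, ⟨coord i, Algebra.subset_adjoin ⟨i, rfl⟩, rfl⟩, fun h => hi (Subtype.ext h)⟩
  have hdense := ContinuousMap.subalgebra_topologicalClosure_eq_top_of_separatesPoints A hsep
  -- the algebra generated by the coordinates is spanned by their monomials, and each of these is
  -- a function `e^{-∑ gψ}`
  have hAV : (A : Set C(S → unitInterval, ℝ)) ⊆ V := by
    have : Subalgebra.toSubmodule A ≤ V := by
      rw [Algebra.adjoin_eq_span, Submodule.span_le]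
      intro f hf
      obtain ⟨g, hg⟩ : ∃ g : Test X, ∀ γ : Tempered ψ,
          f (cubeMap hψ S γ) = Real.exp (-wsum g.1 γ) := by
        induction hf using Submonoid.closure_induction with
        | mem f hf => obtain ⟨i, rfl⟩ := hf; exact ⟨i.1, fun γ => rfl⟩
        | one =>
          refine ⟨0, fun γ => ?_⟩
          change (1 : ℝ) = Real.exp (-wsum 0 γ)
          simp
        | mul f f' _ _ h h' =>
          obtain ⟨g, hg⟩ := h
          obtain ⟨g', hg'⟩ := h'
          refine ⟨g + g', fun γ => ?_⟩
          change f _ * f' _ = Real.exp (-wsum (g.1 + g'.1) γ)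
          rw [hg, hg', wsum_add hψ, ← Real.exp_add]
          congr 1; ring
      exact h f g hg
    exact this
  rw [eq_top_iff]
  intro f _
  have hf : f ∈ A.topologicalClosure := by rw [hdense]; trivial
  exact closure_minimal hAV hV hf

end Inducing

/-! ### Laplace functionals and measures on tempered configurations -/

section Laplace

variable {X : Type*} [TopologicalSpace X] [PolishSpace X] [LocallyCompactSpace X] {ψ : X → ℝ}

lemma integrable_cube (hψ : ∀ x, 0 < ψ x) (S : Set (Test X)) (ν : Measure (Tempered ψ))
    [IsFiniteMeasure ν] (f : C(S → unitInterval, ℝ)) :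
    Integrable (fun γ => f (cubeMap hψ S γ)) ν :=
  ((BoundedContinuousFunction.mkOfCompact f).compContinuous
    ⟨_, continuous_cubeMap hψ S⟩).integrable ν

lemma dist_integral_cube_le (hψ : ∀ x, 0 < ψ x) (S : Set (Test X)) (ν : Measure (Tempered ψ))
    [IsFiniteMeasure ν] (f f' : C(S → unitInterval, ℝ)) :
    dist (∫ γ, f (cubeMap hψ S γ) ∂ν) (∫ γ, f' (cubeMap hψ S γ) ∂ν) ≤
      dist f f' * ν.real Set.univ := by
  rw [dist_eq_norm, ← integral_sub (integrable_cube hψ S ν f) (integrable_cube hψ S ν f')]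
  refine norm_integral_le_of_norm_le_const (ae_of_all _ fun γ => ?_)
  rw [← dist_eq_norm]
  exact ContinuousMap.dist_apply_le_dist _

lemma continuous_integral_cube (hψ : ∀ x, 0 < ψ x) (S : Set (Test X)) (ν : Measure (Tempered ψ))
    [IsFiniteMeasure ν] :
    Continuous fun f : C(S → unitInterval, ℝ) => ∫ γ, f (cubeMap hψ S γ) ∂ν :=
  (LipschitzWith.of_dist_le_mul (K := ⟨ν.real Set.univ, measureReal_nonneg⟩) fun f f' => by
    rw [mul_comm]; exact dist_integral_cube_le hψ S ν f f').continuous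

/-- A finite measure on `Γ^ψ` is determined by its Laplace functional. -/
lemma eq_of_lap_eq (hψ : ∀ x, 0 < ψ x) {ν ν' : Measure (Tempered ψ)} [IsFiniteMeasure ν]
    [IsFiniteMeasure ν'] (h : ∀ g, lap ν g = lap ν' g) : ν = ν' := by
  obtain ⟨S, hS, hind⟩ := exists_isInducing_cubeMap (X := X) hψ
  have := hS.to_subtype
  have hj : Measurable (cubeMap (ψ := ψ) hψ S) := (continuous_cubeMap hψ S).measurable
  let V : Submodule ℝ C(S → unitInterval, ℝ) :=
    { carrier := {f | ∫ γ, f (cubeMap hψ S γ) ∂ν = ∫ γ, f (cubeMap hψ S γ) ∂ν'}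
      add_mem' := fun {f f'} (hf : _ = _) (hf' : _ = _) => by
        change ∫ γ, (f (cubeMap hψ S γ) + f' (cubeMap hψ S γ)) ∂ν =
          ∫ γ, (f (cubeMap hψ S γ) + f' (cubeMap hψ S γ)) ∂ν'
        rw [integral_add (integrable_cube hψ S ν f) (integrable_cube hψ S ν f'),
          integral_add (integrable_cube hψ S ν' f) (integrable_cube hψ S ν' f'), hf, hf']
      zero_mem' := by simp
      smul_mem' := fun c f (hf : _ = _) => by
        change ∫ γ, c * f (cubeMap hψ S γ) ∂ν = ∫ γ, c * f (cubeMap hψ S γ) ∂ν'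
        rw [integral_const_mul, integral_const_mul, hf] }
  have hV : V = ⊤ := by
    refine submodule_eq_top_of_expW (ψ := ψ) hψ S V
      (isClosed_eq (continuous_integral_cube hψ S ν) (continuous_integral_cube hψ S ν'))
      fun f g hg => ?_
    change ∫ γ, f (cubeMap hψ S γ) ∂ν = ∫ γ, f (cubeMap hψ S γ) ∂ν'
    simp_rw [hg]
    rw [integral_exp_wsum, integral_exp_wsum, h]
  have hmap : ν.map (cubeMap hψ S) = ν'.map (cubeMap hψ S) := by
    refine ext_of_forall_integral_eq_of_IsFiniteMeasure fun f => ?_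
    rw [integral_map hj.aemeasurable f.continuous.measurable.aestronglyMeasurable,
      integral_map hj.aemeasurable f.continuous.measurable.aestronglyMeasurable]
    have : f.toContinuousMap ∈ V := by rw [hV]; trivial
    exact this
  ext A hA
  rw [measurableSpace_eq_comap_cubeMap hψ hS hind] at hA
  obtain ⟨B, hB, rfl⟩ := hA
  rw [← Measure.map_apply hj hB, ← Measure.map_apply hj hB, hmap]

/-- A family of finite measures on `Γ^ψ` is measurable if its Laplace functionals are. -/
lemma measurable_of_measurable_lap (hψ : ∀ x, 0 < ψ x) {A : Type*} [MeasurableSpace A]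
    {κ : A → Measure (Tempered ψ)} [∀ a, IsFiniteMeasure (κ a)]
    (h : ∀ g : Test X, Measurable fun a => lap (κ a) g) : Measurable κ := by
  obtain ⟨S, hS, hind⟩ := exists_isInducing_cubeMap (X := X) hψ
  have := hS.to_subtype
  have hj : Measurable (cubeMap (ψ := ψ) hψ S) := (continuous_cubeMap hψ S).measurable
  let V : Submodule ℝ C(S → unitInterval, ℝ) :=
    { carrier := {f | Measurable fun a => ∫ γ, f (cubeMap hψ S γ) ∂(κ a)}
      add_mem' := fun {f f'} (hf : Measurable _) (hf' : Measurable _) => by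
        change Measurable fun a => ∫ γ, (f (cubeMap hψ S γ) + f' (cubeMap hψ S γ)) ∂(κ a)
        convert hf.add hf' using 2 with a
        exact integral_add (integrable_cube hψ S (κ a) f) (integrable_cube hψ S (κ a) f')
      zero_mem' := by simp
      smul_mem' := fun c f (hf : Measurable _) => by
        change Measurable fun a => ∫ γ, c * f (cubeMap hψ S γ) ∂(κ a)
        simp_rw [integral_const_mul]
        exact hf.const_mul c }
  have hV : V = ⊤ := by
    refine submodule_eq_top_of_expW (ψ := ψ) hψ S V ?_ fun f g hg => ?_
    · refine isClosed_of_closure_subset fun f hf => ?_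
      obtain ⟨u, hu, hlim⟩ := mem_closure_iff_seq_limit.1 hf
      refine measurable_of_tendsto_metrizable (f := fun n a =>
        ∫ γ, u n (cubeMap hψ S γ) ∂(κ a)) (fun n => hu n) ?_
      rw [tendsto_pi_nhds]
      exact fun a => ((continuous_integral_cube hψ S (κ a)).tendsto f).comp hlim
    · change Measurable fun a => ∫ γ, f (cubeMap hψ S γ) ∂(κ a)
      simp_rw [hg, integral_exp_wsum]
      exact (h g).ennreal_toReal
  have hmap : Measurable fun a => (κ a).map (cubeMap hψ S) := by
    refine Measurable.measure_of_isPiSystem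
      ((BorelSpace.measurable_eq).trans borel_eq_generateFrom_isClosed) isPiSystem_isClosed ?_ ?_
    · intro F hF
      have hF : IsClosed F := hF
      refine ENNReal.measurable_of_tendsto (f := fun n a =>
        ∫⁻ z, hF.apprSeq n z ∂((κ a).map (cubeMap hψ S))) (fun n => ?_) ?_
      · let f : C(S → unitInterval, ℝ) := ⟨fun z => (hF.apprSeq n z : ℝ),
          NNReal.continuous_coe.comp (hF.apprSeq n).continuous⟩
        have hf : f ∈ V := by rw [hV]; trivial
        have hf : Measurable fun a => ∫ γ, f (cubeMap hψ S γ) ∂(κ a) := hf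
        convert hf.ennreal_ofReal using 2 with a
        rw [ofReal_integral_eq_lintegral_ofReal (integrable_cube hψ S (κ a) f)
          (ae_of_all _ fun γ => NNReal.coe_nonneg _), lintegral_map
          (hF.apprSeq n).continuous.measurable.coe_nnreal_ennreal hj]
        refine lintegral_congr fun γ => ?_
        exact (ENNReal.ofReal_coe_nnreal).symm
      · rw [tendsto_pi_nhds]
        exact fun a => HasOuterApproxClosed.tendsto_lintegral_apprSeq hF _
    · simp_rw [Measure.map_apply hj .univ, Set.preimage_univ, ← lap_zero]
      exact h 0
  refine Measure.measurable_of_measurable_coe _ fun A hA => ?_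
  rw [measurableSpace_eq_comap_cubeMap hψ hS hind] at hA
  obtain ⟨B, hB, rfl⟩ := hA
  simp_rw [← Measure.map_apply hj hB]
  exact (Measure.measurable_coe hB).comp hmap

/-- Pointwise convergence of Laplace functionals to that of a probability measure on `Γ^ψ` implies
weak convergence: the image measures converge weakly on a compact cube, into which `Γ^ψ` embeds. -/
lemma tendsto_of_tendsto_lap (hψ : ∀ x, 0 < ψ x) {ι : Type*} {L : Filter ι}
    [L.IsCountablyGenerated] {ν : ι → ProbabilityMeasure (Tempered ψ)}
    {ν₀ : ProbabilityMeasure (Tempered ψ)}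
    (h : ∀ g : Test X, Tendsto (fun i => ∫ γ, Real.exp (-wsum g.1 γ) ∂(ν i : Measure (Tempered ψ)))
      L (𝓝 (∫ γ, Real.exp (-wsum g.1 γ) ∂(ν₀ : Measure (Tempered ψ))))) :
    Tendsto ν L (𝓝 ν₀) := by
  obtain ⟨S, hS, hind⟩ := exists_isInducing_cubeMap (X := X) hψ
  have := hS.to_subtype
  have hj : Measurable (cubeMap (ψ := ψ) hψ S) := (continuous_cubeMap hψ S).measurable
  let V : Submodule ℝ C(S → unitInterval, ℝ) :=
    { carrier := {f | Tendsto (fun i => ∫ γ, f (cubeMap hψ S γ) ∂(ν i : Measure (Tempered ψ)))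
        L (𝓝 (∫ γ, f (cubeMap hψ S γ) ∂(ν₀ : Measure (Tempered ψ))))}
      add_mem' := fun {f f'} (hf : Tendsto _ _ _) (hf' : Tendsto _ _ _) => by
        change Tendsto (fun i => ∫ γ, (f (cubeMap hψ S γ) + f' (cubeMap hψ S γ))
          ∂(ν i : Measure (Tempered ψ))) L (𝓝 (∫ γ, (f (cubeMap hψ S γ) + f' (cubeMap hψ S γ))
            ∂(ν₀ : Measure (Tempered ψ))))
        rw [integral_add (integrable_cube hψ S _ f) (integrable_cube hψ S _ f')]
        refine (hf.add hf').congr fun i => ?_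
        rw [integral_add (integrable_cube hψ S _ f) (integrable_cube hψ S _ f')]
      zero_mem' := by simp [tendsto_const_nhds]
      smul_mem' := fun c f (hf : Tendsto _ _ _) => by
        change Tendsto (fun i => ∫ γ, c * f (cubeMap hψ S γ) ∂(ν i : Measure (Tempered ψ))) L
          (𝓝 (∫ γ, c * f (cubeMap hψ S γ) ∂(ν₀ : Measure (Tempered ψ))))
        simp_rw [integral_const_mul]
        exact hf.const_mul c }
  have hV : V = ⊤ := by
    refine submodule_eq_top_of_expW (ψ := ψ) hψ S V ?_ fun f g hg => ?_
    · refine isClosed_of_closure_subset fun f hf => ?_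
      change Tendsto _ _ _
      rw [Metric.tendsto_nhds]
      intro ε hε
      obtain ⟨f', hf', hff'⟩ := Metric.mem_closure_iff.1 hf (ε / 3) (by positivity)
      have hf' : Tendsto _ _ _ := hf'
      filter_upwards [Metric.tendsto_nhds.1 hf' (ε / 3) (by positivity)] with i hi
      have h1 := dist_integral_cube_le hψ S (ν i : Measure (Tempered ψ)) f f'
      have h2 := dist_integral_cube_le hψ S (ν₀ : Measure (Tempered ψ)) f' f
      rw [probReal_univ, mul_one] at h1 h2
      rw [dist_comm f' f] at h2
      calc _ ≤ _ := dist_triangle4 _ _ _ _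
        _ < ε := by linarith
    · change Tendsto _ _ _
      simp_rw [hg]
      exact h g
  have hmap : Tendsto (fun i => (ν i).map hj.aemeasurable) L (𝓝 (ν₀.map hj.aemeasurable)) := by
    rw [ProbabilityMeasure.tendsto_iff_forall_integral_tendsto]
    intro f
    have hf : f.toContinuousMap ∈ V := by rw [hV]; trivial
    have hf : Tendsto _ _ _ := hf
    simp_rw [ProbabilityMeasure.toMeasure_map]
    rw [integral_map hj.aemeasurable f.continuous.measurable.aestronglyMeasurable]
    refine hf.congr fun i => ?_
    rw [integral_map hj.aemeasurable f.continuous.measurable.aestronglyMeasurable]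
    rfl
  refine tendsto_of_forall_isOpen_le_liminf' fun G hG => ?_
  obtain ⟨U, hU, rfl⟩ := hind.isOpen_iff.1 hG
  have := ProbabilityMeasure.le_liminf_measure_open_of_tendsto hmap hU
  simpa [Measure.map_apply hj hU.measurableSet] using this

end Laplace

/-! ### Superpositions of configurations -/

section Superposition

variable {X : Type*} [TopologicalSpace X] {ψ : X → ℝ}

lemma Configuration.isTempered_iff (hψ : ∀ x, 0 < ψ x) (γ : Configuration X) :
    γ.IsTempered ψ ↔ pair (fun x => ENNReal.ofReal (ψ x)) γ ≠ ∞ := by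
  have he : ∀ x, (γ.mult x : ℝ≥0∞) * ENNReal.ofReal (ψ x) =
      ENNReal.ofReal (γ.mult x * ψ x) := fun x => by
    rw [ENNReal.ofReal_mul (by positivity), ENNReal.ofReal_natCast]
  have h0 : ∀ x, 0 ≤ (γ.mult x : ℝ) * ψ x := fun x => mul_nonneg (by positivity) (hψ x).le
  unfold pair
  simp_rw [he]
  constructor
  · intro h
    rw [← ENNReal.ofReal_tsum_of_nonneg h0 h]
    exact ENNReal.ofReal_ne_top
  · intro h
    have := ENNReal.summable_toReal h
    simp only [ENNReal.toReal_ofReal (h0 _)] at this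
    exact this

/-- The superposition of a family of configurations with finite total weight. -/
lemma exists_superposition (hψc : Continuous ψ) (hψ : ∀ x, 0 < ψ x) {ι : Type*}
    (γ : ι → Tempered ψ)
    (h : ∑' i, pair (fun x => ENNReal.ofReal (ψ x)) (γ i).toConfiguration ≠ ∞) :
    ∃ γ' : Tempered ψ, ∀ f : X → ℝ≥0∞,
      pair f γ'.toConfiguration = ∑' i, pair f (γ i).toConfiguration := by
  unfold pair at h
  rw [ENNReal.tsum_comm] at h
  simp_rw [ENNReal.tsum_mul_right] at h
  have hpos : ∀ x, ENNReal.ofReal (ψ x) ≠ 0 := fun x => by simpa using hψ x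
  have hx : ∀ x, ∑' i, ((γ i).toConfiguration.mult x : ℝ≥0∞) ≠ ∞ := fun x hx => by
    refine ENNReal.ne_top_of_tsum_ne_top h x ?_
    rw [hx, ENNReal.top_mul (hpos x)]
  have hfin : ∀ x, {i | (γ i).toConfiguration.mult x ≠ 0}.Finite := fun x =>
    (ENNReal.finite_const_le_of_tsum_ne_top (hx x) one_ne_zero).subset fun i hi => by
      have : 1 ≤ (γ i).toConfiguration.mult x := Nat.one_le_iff_ne_zero.2 hi
      exact_mod_cast this
  let n : X → ℕ := fun x => ∑ i ∈ (hfin x).toFinset, (γ i).toConfiguration.mult x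
  have hn : ∀ x, (n x : ℝ≥0∞) = ∑' i, ((γ i).toConfiguration.mult x : ℝ≥0∞) := fun x => by
    rw [tsum_eq_sum (s := (hfin x).toFinset)]
    · simp [n]
    · intro i hi
      have : (γ i).toConfiguration.mult x = 0 := by simpa using hi
      simp [this]
  simp_rw [← hn] at h
  let c : Configuration X := ⟨n, fun K hK => by
    rcases K.eq_empty_or_nonempty with rfl | hne
    · simp
    obtain ⟨x₀, hx₀, hmin⟩ := hK.exists_isMinOn hne hψc.continuousOn
    refine (ENNReal.finite_const_le_of_tsum_ne_top h (hpos x₀)).subset ?_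
    rintro x ⟨hxK, hnx⟩
    have h1 : (1 : ℝ≥0∞) ≤ n x := by exact_mod_cast Nat.one_le_iff_ne_zero.2 hnx
    calc ENNReal.ofReal (ψ x₀) ≤ 1 * ENNReal.ofReal (ψ x) := by
          rw [one_mul]; exact ENNReal.ofReal_le_ofReal (hmin hxK)
      _ ≤ _ := by gcongr⟩
  refine ⟨⟨c, (c.isTempered_iff hψ).2 h⟩, fun f => ?_⟩
  change ∑' x, (n x : ℝ≥0∞) * f x = _
  unfold pair
  rw [ENNReal.tsum_comm]
  simp_rw [ENNReal.tsum_mul_right, ← hn]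

lemma pair_toConfiguration_ne_top (hψ : ∀ x, 0 < ψ x) (γ : Tempered ψ) :
    pair (fun x => ENNReal.ofReal (ψ x)) γ.toConfiguration ≠ ∞ :=
  (γ.toConfiguration.isTempered_iff hψ).1 γ.isTempered

open Classical in
/-- The superposition `∑_i γ_i` of a family of configurations; the empty configuration if the total
weight is infinite. -/
def superpose (hψc : Continuous ψ) (hψ : ∀ x, 0 < ψ x) {ι : Type*} (γ : ι → Tempered ψ) :
    Tempered ψ :=
  if h : ∑' i, pair (fun x => ENNReal.ofReal (ψ x)) (γ i).toConfiguration ≠ ∞ then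
    (exists_superposition hψc hψ γ h).choose else 0

lemma expW_superpose (hψc : Continuous ψ) (hψ : ∀ x, 0 < ψ x) {ι : Type*} {γ : ι → Tempered ψ}
    (h : ∑' i, pair (fun x => ENNReal.ofReal (ψ x)) (γ i).toConfiguration ≠ ∞) (g : Test X) :
    expW g (superpose hψc hψ γ) =
      expNeg (∑' i, pair (fun x => ENNReal.ofReal (g.1 x * ψ x)) (γ i).toConfiguration) := by
  rw [expW_eq_expNeg hψ, superpose, dif_pos h, (exists_superposition hψc hψ γ h).choose_spec]

variable [PolishSpace X] [LocallyCompactSpace X]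

lemma measurable_superpose (hψc : Continuous ψ) (hψ : ∀ x, 0 < ψ x) {ι : Type*} [Countable ι] :
    Measurable (superpose (ι := ι) hψc hψ) := by
  classical
  refine measurable_of_measurable_wsum hψ fun g => ?_
  have hm : ∀ g : Test X, Measurable fun γ : ι → Tempered ψ =>
      ∑' i, pair (fun x => ENNReal.ofReal (g.1 x * ψ x)) (γ i).toConfiguration := fun g => by
    simp_rw [← ofReal_wsum hψ g.nonneg]
    exact Measurable.tsum fun i =>
      ((continuous_wsum g.1).measurable.comp (measurable_pi_apply i)).ennreal_ofReal
  have hgood : MeasurableSet {γ : ι → Tempered ψ |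
      ∑' i, pair (fun x => ENNReal.ofReal (ψ x)) (γ i).toConfiguration ≠ ∞} := by
    have := hm ⟨1, fun _ => zero_le_one⟩
    simp only [BoundedContinuousFunction.coe_one, Pi.one_apply, one_mul] at this
    exact (measurableSet_eq_fun this measurable_const).compl
  have he : (fun γ : ι → Tempered ψ => wsum g.1 (superpose hψc hψ γ)) = fun γ =>
      (if ∑' i, pair (fun x => ENNReal.ofReal (ψ x)) (γ i).toConfiguration ≠ ∞ then
        ∑' i, pair (fun x => ENNReal.ofReal (g.1 x * ψ x)) (γ i).toConfiguration else 0).toReal := by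
    funext γ
    rw [← ENNReal.toReal_ofReal (wsum_nonneg hψ g.nonneg (superpose hψc hψ γ)),
      ofReal_wsum hψ g.nonneg]
    congr 1
    by_cases h : ∑' i, pair (fun x => ENNReal.ofReal (ψ x)) (γ i).toConfiguration ≠ ∞
    · rw [if_pos h, superpose, dif_pos h, (exists_superposition hψc hψ γ h).choose_spec]
    · rw [if_neg h, superpose, dif_neg h]
      exact pair_zero _
  rw [he]
  exact (Measurable.ite hgood (hm g) measurable_const).ennreal_toReal

end Superposition

/-! ### Functionals represented by measures -/

section Representable

variable {X : Type*} [TopologicalSpace X] {ψ : X → ℝ}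

/-- A functional is representable if it is the Laplace functional of a finite measure. -/
def IsLap (ψ : X → ℝ) (ρ : Test X → ℝ≥0∞) : Prop :=
  ∃ ν : Measure (Tempered ψ), IsFiniteMeasure ν ∧ ∀ g, lap ν g = ρ g

/-- The order on representable functionals given by the order of the representing measures. -/
def LapLE (ψ : X → ℝ) (ρ ρ' : Test X → ℝ≥0∞) : Prop :=
  IsLap ψ ρ ∧ ∃ σ, IsLap ψ σ ∧ ∀ g, ρ' g = ρ g + σ g

lemma IsLap.congr {ρ ρ' : Test X → ℝ≥0∞} (h : IsLap ψ ρ) (he : ∀ g, ρ g = ρ' g) :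
    IsLap ψ ρ' := by
  obtain ⟨ν, hν, h⟩ := h
  exact ⟨ν, hν, fun g => (h g).trans (he g)⟩

lemma IsLap.zero : IsLap ψ (fun _ => 0) := ⟨0, inferInstance, fun g => by simp [lap]⟩

lemma IsLap.expW (γ : Tempered ψ) : IsLap ψ (fun g => expW g γ) :=
  ⟨Measure.dirac γ, inferInstance, fun g => lintegral_dirac' _ (measurable_expW g)⟩

lemma IsLap.one : IsLap ψ (fun _ => 1) := by
  refine (IsLap.expW 0).congr fun g => ?_
  simp [Branching.expW, wsum, show (0 : Tempered ψ).toConfiguration = 0 from rfl]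

lemma IsLap.add {ρ ρ' : Test X → ℝ≥0∞} (h : IsLap ψ ρ) (h' : IsLap ψ ρ') :
    IsLap ψ (fun g => ρ g + ρ' g) := by
  obtain ⟨ν, hν, h⟩ := h
  obtain ⟨ν', hν', h'⟩ := h'
  exact ⟨ν + ν', inferInstance, fun g => by
    beta_reduce
    rw [lap, lintegral_add_measure, ← h, ← h', lap, lap]⟩

lemma IsLap.const_mul {ρ : Test X → ℝ≥0∞} (h : IsLap ψ ρ) {c : ℝ≥0∞} (hc : c ≠ ∞) :
    IsLap ψ (fun g => c * ρ g) := by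
  obtain ⟨ν, hν, h⟩ := h
  exact ⟨c • ν, Measure.smul_finite ν hc, fun g => by
    beta_reduce
    rw [lap, lintegral_smul_measure, ← h, lap, smul_eq_mul]⟩

lemma IsLap.le_apply_zero (hψ : ∀ x, 0 < ψ x) {ρ : Test X → ℝ≥0∞} (h : IsLap ψ ρ)
    (g : Test X) : ρ g ≤ ρ 0 := by
  obtain ⟨ν, hν, h⟩ := h
  rw [← h, ← h]
  refine lintegral_mono fun γ => ?_
  rw [expW_zero]
  exact expW_le_one hψ g γ

lemma IsLap.apply_ne_top (hψ : ∀ x, 0 < ψ x) {ρ : Test X → ℝ≥0∞} (h : IsLap ψ ρ)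
    (g : Test X) : ρ g ≠ ∞ := by
  refine ne_top_of_le_ne_top ?_ (h.le_apply_zero hψ g)
  obtain ⟨ν, hν, h⟩ := h
  rw [← h, lap_zero]
  exact measure_ne_top _ _

lemma LapLE.refl {ρ : Test X → ℝ≥0∞} (h : IsLap ψ ρ) : LapLE ψ ρ ρ :=
  ⟨h, _, IsLap.zero, fun g => by simp⟩

lemma LapLE.isLap_right {ρ ρ' : Test X → ℝ≥0∞} (h : LapLE ψ ρ ρ') : IsLap ψ ρ' := by
  obtain ⟨h, σ, hσ, he⟩ := h
  exact (h.add hσ).congr fun g => (he g).symm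

lemma LapLE.add_left {ρ ρ' τ : Test X → ℝ≥0∞} (h : LapLE ψ ρ ρ') (hτ : IsLap ψ τ) :
    LapLE ψ (fun g => τ g + ρ g) (fun g => τ g + ρ' g) := by
  obtain ⟨h, σ, hσ, he⟩ := h
  exact ⟨hτ.add h, σ, hσ, fun g => by beta_reduce; rw [he, add_assoc]⟩

lemma LapLE.const_mul {ρ ρ' : Test X → ℝ≥0∞} (h : LapLE ψ ρ ρ') {c : ℝ≥0∞} (hc : c ≠ ∞) :
    LapLE ψ (fun g => c * ρ g) (fun g => c * ρ' g) := by
  obtain ⟨h, σ, hσ, he⟩ := h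
  exact ⟨h.const_mul hc, _, hσ.const_mul hc, fun g => by beta_reduce; rw [he, mul_add]⟩

/-- The superposition of two independent configurations is represented by the product. -/
lemma IsLap.mul [PolishSpace X] [LocallyCompactSpace X] (hψc : Continuous ψ) (hψ : ∀ x, 0 < ψ x)
    {ρ ρ' : Test X → ℝ≥0∞} (h : IsLap ψ ρ) (h' : IsLap ψ ρ') :
    IsLap ψ (fun g => ρ g * ρ' g) := by
  obtain ⟨ν, hν, h⟩ := h
  obtain ⟨ν', hν', h'⟩ := h'
  let k : Tempered ψ × Tempered ψ → Bool → Tempered ψ := fun z i => if i then z.1 else z.2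
  have hk : Measurable k := measurable_pi_lambda _ fun i => by
    cases i
    · exact measurable_snd
    · exact measurable_fst
  have hm : Measurable fun z => superpose hψc hψ (k z) := (measurable_superpose hψc hψ).comp hk
  refine ⟨(ν.prod ν').map fun z => superpose hψc hψ (k z), inferInstance, fun g => ?_⟩
  beta_reduce
  rw [lap, lintegral_map (measurable_expW g) hm, ← h, ← h', lap, lap,
    ← lintegral_prod_mul (measurable_expW g).aemeasurable (measurable_expW g).aemeasurable]
  refine lintegral_congr fun z => ?_
  rw [expW_superpose, tsum_bool, expNeg_add, expW_eq_expNeg hψ, expW_eq_expNeg hψ, mul_comm]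
  · rfl
  · rw [tsum_bool]
    exact ENNReal.add_ne_top.2 ⟨pair_toConfiguration_ne_top hψ _, pair_toConfiguration_ne_top hψ _⟩

lemma LapLE.mul [PolishSpace X] [LocallyCompactSpace X] (hψc : Continuous ψ) (hψ : ∀ x, 0 < ψ x)
    {ρ₁ ρ₁' ρ₂ ρ₂' : Test X → ℝ≥0∞} (h₁ : LapLE ψ ρ₁ ρ₁') (h₂ : LapLE ψ ρ₂ ρ₂') :
    LapLE ψ (fun g => ρ₁ g * ρ₂ g) (fun g => ρ₁' g * ρ₂' g) := by
  have h₂' := h₂.isLap_right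
  obtain ⟨h₁, σ₁, hσ₁, he₁⟩ := h₁
  obtain ⟨h₂, σ₂, hσ₂, he₂⟩ := h₂
  refine ⟨h₁.mul hψc hψ h₂, _, (h₁.mul hψc hψ hσ₂).add (hσ₁.mul hψc hψ h₂'), fun g => ?_⟩
  beta_reduce
  rw [he₁, he₂]; ring

/-- Monotonicity of finite superpositions of independent configurations. -/
lemma LapLE.prodE [PolishSpace X] [LocallyCompactSpace X] (hψc : Continuous ψ)
    (hψ : ∀ x, 0 < ψ x) {p p' : X → Test X → ℝ≥0∞} (h : ∀ x, LapLE ψ (p x) (p' x))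
    (hp : ∀ x g, p x g ≤ 1) (hp' : ∀ x g, p' x g ≤ 1) {ξ : Configuration X} (hξ : ξ.IsFinite) :
    LapLE ψ (fun g => prodE (fun x => p x g) ξ) (fun g => prodE (fun x => p' x g) ξ) := by
  simp_rw [fun g => prodE_of_isFinite (fun x => hp x g) hξ,
    fun g => prodE_of_isFinite (fun x => hp' x g) hξ]
  have hpow : ∀ x (n : ℕ), LapLE ψ (fun g => p x g ^ n) (fun g => p' x g ^ n) := by
    intro x n
    induction n with
    | zero => simpa using LapLE.refl IsLap.one
    | succ n ih => simpa [pow_succ] using ih.mul hψc hψ (h x)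
  classical
  induction hξ.toFinset using Finset.induction_on with
  | empty => simpa using LapLE.refl IsLap.one
  | insert a s ha ih =>
    simp_rw [Finset.prod_insert ha]
    exact (hpow a _).mul hψc hψ ih

/-- Increasing limits of representable functionals are representable. -/
lemma IsLap.iSup {ρ : ℕ → Test X → ℝ≥0∞} (h : ∀ k, LapLE ψ (ρ k) (ρ (k + 1)))
    (hbd : ⨆ k, ρ k 0 ≠ ∞) : IsLap ψ (fun g => ⨆ k, ρ k g) := by
  choose h σ hσ he using h
  have hsum : ∀ k g, ρ k g = ρ 0 g + ∑ i ∈ Finset.range k, σ i g := by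
    intro k g
    induction k with
    | zero => simp
    | succ k ih => rw [he, ih, Finset.sum_range_succ, add_assoc]
  have hsup : ∀ g, ⨆ k, ρ k g = ρ 0 g + ∑' i, σ i g := by
    intro g
    rw [ENNReal.tsum_eq_iSup_nat, ENNReal.add_iSup]
    exact iSup_congr fun k => hsum k g
  obtain ⟨ν, hν, hl⟩ := h 0
  choose ν' hν' hl' using hσ
  have hlap : ∀ g, lap (ν + Measure.sum ν') g = ⨆ k, ρ k g := by
    intro g
    rw [hsup, lap, lintegral_add_measure, lintegral_sum_measure, ← hl, lap]
    congr 1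
    exact tsum_congr fun i => hl' i g
  refine ⟨ν + Measure.sum ν', ⟨?_⟩, hlap⟩
  rw [← lap_zero, hlap]
  exact lt_top_iff_ne_top.2 hbd

/-- Mixtures of representable functionals are representable. -/
lemma IsLap.lintegral [PolishSpace X] [LocallyCompactSpace X] (hψ : ∀ x, 0 < ψ x)
    {A : Type*} [MeasurableSpace A] {κ : Measure A} {ρ : A → Test X → ℝ≥0∞}
    (h : ∀ᵐ a ∂κ, IsLap ψ (ρ a)) (hm : ∀ g, Measurable fun a => ρ a g)
    (hbd : ∫⁻ a, ρ a 0 ∂κ ≠ ∞) : IsLap ψ (fun g => ∫⁻ a, ρ a g ∂κ) := by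
  classical
  -- off a null set, the representing measures form a measurable family
  let N : Set A := toMeasurable κ {a | ¬ IsLap ψ (ρ a)}
  have hN : κ N = 0 := by rw [measure_toMeasurable]; exact ae_iff.1 h
  have hNm : MeasurableSet N := measurableSet_toMeasurable _ _
  let ρ' : A → Test X → ℝ≥0∞ := fun a g => if a ∈ N then 0 else ρ a g
  have hρ' : ∀ a, IsLap ψ (ρ' a) := fun a => by
    by_cases ha : a ∈ N
    · exact IsLap.zero.congr fun g => by simp [ρ', ha]
    · have : IsLap ψ (ρ a) := by
        by_contra h'
        exact ha (subset_toMeasurable κ _ h')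
      exact this.congr fun g => by simp [ρ', ha]
  have hae : ∀ g, ∫⁻ a, ρ' a g ∂κ = ∫⁻ a, ρ a g ∂κ := fun g => by
    refine lintegral_congr_ae ?_
    filter_upwards [compl_mem_ae_iff.2 hN] with a ha
    exact if_neg ha
  have hm' : ∀ g, Measurable fun a => ρ' a g := fun g =>
    Measurable.ite hNm measurable_const (hm g)
  choose ν hν hl using hρ'
  have hνm : Measurable ν := measurable_of_measurable_lap hψ fun g => by simp_rw [hl]; exact hm' g
  have hlap : ∀ g, lap (κ.bind ν) g = ∫⁻ a, ρ a g ∂κ := fun g => by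
    rw [lap, Measure.lintegral_bind hνm.aemeasurable (measurable_expW g).aemeasurable, ← hae]
    exact lintegral_congr fun a => hl a g
  refine ⟨κ.bind ν, ⟨?_⟩, hlap⟩
  rw [← lap_zero, hlap]
  exact lt_top_iff_ne_top.2 hbd

lemma LapLE.lintegral [PolishSpace X] [LocallyCompactSpace X] (hψ : ∀ x, 0 < ψ x)
    {A : Type*} [MeasurableSpace A] {κ : Measure A} {ρ ρ' : A → Test X → ℝ≥0∞}
    (h : ∀ᵐ a ∂κ, LapLE ψ (ρ a) (ρ' a)) (hm : ∀ g, Measurable fun a => ρ a g)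
    (hm' : ∀ g, Measurable fun a => ρ' a g)
    (hbd : ∫⁻ a, ρ' a 0 ∂κ ≠ ∞) :
    LapLE ψ (fun g => ∫⁻ a, ρ a g ∂κ) (fun g => ∫⁻ a, ρ' a g ∂κ) := by
  have hle : ∀ g, (fun a => ρ' a g) =ᵐ[κ] fun a => ρ a g + (ρ' a g - ρ a g) := fun g => by
    filter_upwards [h] with a ha
    obtain ⟨_, σ, _, he⟩ := ha
    rw [add_tsub_cancel_of_le]
    simp [he]
  have hsum : ∀ g, ∫⁻ a, ρ' a g ∂κ =
      (∫⁻ a, ρ a g ∂κ) + ∫⁻ a, (ρ' a g - ρ a g) ∂κ := fun g => by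
    rw [lintegral_congr_ae (hle g), lintegral_add_left (hm g)]
  refine ⟨IsLap.lintegral hψ (h.mono fun a ha => ha.1) hm ?_, _,
    IsLap.lintegral hψ (ρ := fun a g => ρ' a g - ρ a g) ?_ (fun g => (hm' g).sub (hm g)) ?_, hsum⟩
  · refine ne_top_of_le_ne_top hbd ?_
    rw [hsum]; exact le_self_add
  · filter_upwards [h] with a ha
    obtain ⟨h1, σ, hσ, he⟩ := ha
    refine hσ.congr fun g => ?_
    rw [he, ENNReal.add_sub_cancel_left (h1.apply_ne_top hψ g)]
  · refine ne_top_of_le_ne_top hbd ?_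
    rw [hsum]; exact le_add_self

/-- Summability of `1 - e^{-u_i}` implies that of `u_i`. -/
lemma tsum_ne_top_of_tsum_one_sub_expNeg {ι : Type*} {u : ι → ℝ≥0∞} (hu : ∀ i, u i ≠ ∞)
    (h : ∑' i, (1 - expNeg (u i)) ≠ ∞) : ∑' i, u i ≠ ∞ := by
  classical
  have hconst : 1 - expNeg 1 ≠ 0 := by
    have : expNeg 1 < 1 := by
      have := expNeg_ofReal (zero_le_one (α := ℝ))
      rw [ENNReal.ofReal_one] at this
      rw [this, ENNReal.ofReal_lt_one]
      exact Real.exp_lt_one_iff.2 (by norm_num)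
    exact (tsub_pos_of_lt this).ne'
  have hfin := ENNReal.finite_const_le_of_tsum_ne_top h hconst
  have hle : ∀ i, u i ≤ (if i ∈ hfin.toFinset then u i else 0) + 2 * (1 - expNeg (u i)) := by
    intro i
    by_cases hi : i ∈ hfin.toFinset
    · rw [if_pos hi]; exact le_self_add
    · rw [if_neg hi, zero_add]
      have hi' : u i ≤ 1 := by
        by_contra hi'
        refine hi ((Set.Finite.mem_toFinset _).2 ?_)
        exact tsub_le_tsub_left (antitone_expNeg (not_le.1 hi').le) 1
      lift u i to ℝ≥0 using hu i with r hr
      have hr1 : (r : ℝ) ≤ 1 := by exact_mod_cast hi'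
      have h0 : (0 : ℝ) ≤ r := r.2
      rw [← ENNReal.ofReal_coe_nnreal, expNeg_ofReal h0, ← ENNReal.ofReal_one,
        ← ENNReal.ofReal_sub _ (Real.exp_pos _).le,
        show (2 : ℝ≥0∞) = ENNReal.ofReal 2 by simp, ← ENNReal.ofReal_mul (by norm_num)]
      refine ENNReal.ofReal_le_ofReal ?_
      have h1 : Real.exp (-(r : ℝ)) ≤ (1 + (r : ℝ))⁻¹ := by
        rw [Real.exp_neg]
        exact inv_anti₀ (by positivity) (by linarith [Real.add_one_le_exp (r : ℝ)])
      have h2 : (1 + (r : ℝ))⁻¹ ≤ 1 - r / 2 := by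
        rw [inv_le_iff_one_le_mul₀ (by positivity)]
        nlinarith
      linarith
  refine ne_top_of_le_ne_top ?_ (ENNReal.tsum_le_tsum hle)
  rw [ENNReal.tsum_add, ENNReal.tsum_mul_left]
  refine ENNReal.add_ne_top.2 ⟨?_, ENNReal.mul_ne_top (by simp) h⟩
  rw [tsum_eq_sum (s := hfin.toFinset) (fun i hi => if_neg hi)]
  refine ENNReal.sum_ne_top.2 fun i _ => ?_
  split_ifs
  exact hu i

lemma lap_le_one (hψ : ∀ x, 0 < ψ x) (ν : Measure (Tempered ψ)) [IsProbabilityMeasure ν]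
    (g : Test X) : lap ν g ≤ 1 := by
  calc lap ν g ≤ ∫⁻ _, 1 ∂ν := lintegral_mono fun γ => expW_le_one hψ g γ
    _ = 1 := by simp

lemma lintegral_prod_infinitePi {ι Y : Type*} [MeasurableSpace Y] (ν : ι → Measure Y)
    [∀ i, IsProbabilityMeasure (ν i)] {f : Y → ℝ≥0∞} (hf : Measurable f) (s : Finset ι) :
    ∫⁻ ω, ∏ i ∈ s, f (ω i) ∂Measure.infinitePi ν = ∏ i ∈ s, ∫⁻ y, f y ∂ν i := by
  have hind : iIndepFun (fun i (ω : ι → Y) => f (ω i)) (Measure.infinitePi ν) :=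
    iIndepFun_infinitePi (X := fun _ => f) fun _ => hf
  rw [lintegral_prod_eq_prod_lintegral_of_indepFun s _ hind
    fun i => hf.comp (measurable_pi_apply i)]
  refine Finset.prod_congr rfl fun i _ => ?_
  rw [← lintegral_map hf (measurable_pi_apply i), Measure.infinitePi_map_eval ν i]

/-- The superposition of countably many independent random configurations. It is almost surely
tempered, because `∑_i 𝔼[1 - e^{-Y_i}] < ∞` for the weights `Y_i` of these configurations. -/
lemma exists_lap_eq_prod [PolishSpace X] [LocallyCompactSpace X] (hψc : Continuous ψ)
    (hψ : ∀ x, 0 < ψ x) {ι : Type*} [Countable ι] (ν : ι → Measure (Tempered ψ))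
    [∀ i, IsProbabilityMeasure (ν i)]
    (hsum : ∑' i, (1 - lap (ν i) ⟨1, fun _ => zero_le_one⟩) ≠ ∞) :
    ∃ ν' : Measure (Tempered ψ), IsProbabilityMeasure ν' ∧
      ∀ g, lap ν' g = expNeg (∑' i, negLog (lap (ν i) g)) := by
  let P := Measure.infinitePi ν
  let one : Test X := ⟨1, fun _ => zero_le_one⟩
  have hexp : ∀ (g : Test X) i, Measurable fun ω : ι → Tempered ψ => expW g (ω i) := fun g i =>
    (measurable_expW g).comp (measurable_pi_apply i)
  have hmarg : ∀ (g : Test X) i, ∫⁻ ω, expW g (ω i) ∂P = lap (ν i) g := fun g i => by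
    rw [lap, ← Measure.infinitePi_map_eval ν i, lintegral_map (measurable_expW g)
      (measurable_pi_apply i)]
  have hgood : ∀ᵐ ω ∂P,
      ∑' i, pair (fun x => ENNReal.ofReal (ψ x)) (ω i).toConfiguration ≠ ∞ := by
    have hm1 : ∀ i, Measurable fun ω : ι → Tempered ψ => 1 - expW one (ω i) := fun i =>
      measurable_const.sub (hexp one i)
    have hint : ∫⁻ ω, ∑' i, (1 - expW one (ω i)) ∂P ≠ ∞ := by
      rw [lintegral_tsum fun i => (hm1 i).aemeasurable]
      have : ∀ i, ∫⁻ ω, (1 - expW one (ω i)) ∂P = 1 - lap (ν i) one := fun i => by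
        rw [lintegral_sub (hexp one i), hmarg]
        · simp
        · rw [hmarg]; exact ne_top_of_le_ne_top ENNReal.one_ne_top (lap_le_one hψ _ _)
        · exact ae_of_all _ fun ω => expW_le_one hψ _ _
      simp_rw [this]
      exact hsum
    filter_upwards [ae_lt_top (Measurable.tsum hm1) hint] with ω hω
    refine tsum_ne_top_of_tsum_one_sub_expNeg (fun i => pair_toConfiguration_ne_top hψ _) ?_
    have he : ∀ i, expW one (ω i) =
        expNeg (pair (fun x => ENNReal.ofReal (ψ x)) (ω i).toConfiguration) := fun i => by
      rw [expW_eq_expNeg hψ]; simp [one]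
    simp_rw [← he]
    exact hω.ne
  have hm := measurable_superpose hψc hψ (ι := ι)
  refine ⟨P.map (superpose hψc hψ), Measure.isProbabilityMeasure_map hm.aemeasurable, fun g => ?_⟩
  rw [lap, lintegral_map (measurable_expW g) hm]
  have hfin : ∀ s : Finset ι, ∫⁻ ω, ∏ i ∈ s, expW g (ω i) ∂P =
      expNeg (∑ i ∈ s, negLog (lap (ν i) g)) := fun s => by
    rw [lintegral_prod_infinitePi ν (measurable_expW g) s, expNeg_sum]
    refine Finset.prod_congr rfl fun i _ => ?_
    rw [expNeg_negLog (lap_le_one hψ _ _), lap]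
  have hlim : Tendsto (fun s : Finset ι => ∫⁻ ω, ∏ i ∈ s, expW g (ω i) ∂P) atTop
      (𝓝 (∫⁻ ω, expW g (superpose hψc hψ ω) ∂P)) := by
    refine tendsto_lintegral_filter_of_dominated_convergence (fun _ => 1)
      (Eventually.of_forall fun s => ?_) (Eventually.of_forall fun s => ae_of_all _ fun ω => ?_)
      (by simp) ?_
    · exact Finset.measurable_prod s fun i _ => hexp g i
    · simp_rw [expW_eq_expNeg hψ, ← expNeg_sum]
      exact expNeg_le_one _
    · filter_upwards [hgood] with ω hω
      rw [expW_superpose hψc hψ hω]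
      simp_rw [expW_eq_expNeg hψ, ← expNeg_sum]
      exact (continuous_expNeg.tendsto _).comp ENNReal.summable.hasSum
  -- both sides are limits of the same finite products
  refine tendsto_nhds_unique hlim ?_
  simp_rw [hfin]
  exact (continuous_expNeg.tendsto _).comp ENNReal.summable.hasSum

/-- Independent families started from the particles of a tempered configuration. -/
lemma exists_lap_eq_prodE [PolishSpace X] [LocallyCompactSpace X] (hψc : Continuous ψ)
    (hψ : ∀ x, 0 < ψ x) {p : X → Test X → ℝ≥0∞} (hp : ∀ x, IsLap ψ (p x))
    (hp0 : ∀ x, p x 0 = 1) {C : ℝ≥0∞} (hC : C ≠ ∞)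
    (hp1 : ∀ x, 1 - p x ⟨1, fun _ => zero_le_one⟩ ≤ C * ENNReal.ofReal (ψ x)) (γ : Tempered ψ) :
    ∃ ν : Measure (Tempered ψ), IsProbabilityMeasure ν ∧
      ∀ g, lap ν g = prodE (fun x => p x g) γ.toConfiguration := by
  choose ν hν hl using hp
  have hprob : ∀ x, IsProbabilityMeasure (ν x) := fun x => ⟨by rw [← lap_zero, hl, hp0]⟩
  let s : Set X := {x | γ.toConfiguration.mult x ≠ 0}
  have hs : s.Countable := (Summable.countable_support γ.isTempered).mono fun x hx => by
    exact mul_ne_zero (Nat.cast_ne_zero.2 hx) (hψ x).ne'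
  have := hs.to_subtype
  let ι := Σ x : s, Fin (γ.toConfiguration.mult x)
  have htsum : ∀ f : X → ℝ≥0∞, ∑' i : ι, f i.1 = pair f γ.toConfiguration := fun f => by
    rw [ENNReal.tsum_sigma', pair, ← tsum_subtype_eq_of_support_subset (s := s)]
    · refine tsum_congr fun x => ?_
      simp
    · intro x hx
      simp only [Function.mem_support, ne_eq, mul_eq_zero, Nat.cast_eq_zero, not_or] at hx
      exact hx.1
  obtain ⟨ν', hν', h'⟩ := exists_lap_eq_prod hψc hψ (fun i : ι => ν i.1) (by
    refine ne_top_of_le_ne_top (b := ∑' i : ι, C * ENNReal.ofReal (ψ i.1)) ?_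
      (ENNReal.tsum_le_tsum fun i : ι => ?_)
    · rw [htsum (fun x => C * ENNReal.ofReal (ψ x)), pair_mul_left]
      exact ENNReal.mul_ne_top hC (pair_toConfiguration_ne_top hψ γ)
    · rw [hl]; exact hp1 _)
  refine ⟨ν', hν', fun g => ?_⟩
  rw [h' g, htsum (fun x => negLog (lap (ν x) g)), prodE]
  simp_rw [hl]

end Representable

/-! ### The offspring operator `Φ` -/

section PhiSection

variable {X : Type*} [TopologicalSpace X]

lemma prodOver_of_isFinite (φ : X → ℝ) {ξ : Configuration X} (h : ξ.IsFinite) :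
    ξ.prodOver φ = ∏ x ∈ Set.Finite.toFinset h, φ x ^ ξ.mult x := by
  refine tprod_eq_prod fun x hx => ?_
  have : ξ.mult x = 0 := by
    by_contra h0
    exact hx ((Set.Finite.mem_toFinset h).2 h0)
  simp [this]

lemma toReal_prodE {φ : X → ℝ} (h0 : ∀ x, 0 ≤ φ x) (h1 : ∀ x, φ x ≤ 1) {ξ : Configuration X}
    (h : ξ.IsFinite) : (prodE (fun x => ENNReal.ofReal (φ x)) ξ).toReal = ξ.prodOver φ := by
  rw [prodE_of_isFinite (fun x => by simpa using h1 x) h, prodOver_of_isFinite φ h,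
    ENNReal.toReal_prod]
  refine Finset.prod_congr rfl fun x _ => ?_
  rw [ENNReal.toReal_pow, ENNReal.toReal_ofReal (h0 x)]

lemma abs_prod_pow_sub_le {ι : Type*} (s : Finset ι) (m : ι → ℕ) {a c : ι → ℝ}
    (ha0 : ∀ i, 0 ≤ a i) (ha1 : ∀ i, a i ≤ 1) (hc0 : ∀ i, 0 ≤ c i) (hc1 : ∀ i, c i ≤ 1) :
    |∏ i ∈ s, a i ^ m i - ∏ i ∈ s, c i ^ m i| ≤ ∑ i ∈ s, m i * |a i - c i| := by
  have key : ∀ x y x' y' : ℝ, 0 ≤ y → y ≤ 1 → 0 ≤ x' → x' ≤ 1 →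
      |x * y - x' * y'| ≤ |x - x'| + |y - y'| := fun x y x' y' h1 h2 h3 h4 => by
    calc |x * y - x' * y'| = |(x - x') * y + x' * (y - y')| := by congr 1; ring
      _ ≤ |x - x'| * y + x' * |y - y'| := by
          refine (abs_add_le _ _).trans ?_
          rw [abs_mul, abs_mul, abs_of_nonneg h1, abs_of_nonneg h3]
      _ ≤ |x - x'| * 1 + 1 * |y - y'| := by gcongr
      _ = _ := by ring
  have hpow : ∀ i (k : ℕ), |a i ^ k - c i ^ k| ≤ k * |a i - c i| := by
    intro i k
    induction k with
    | zero => simp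
    | succ k ih =>
      rw [pow_succ, pow_succ]
      refine (key _ _ _ _ (ha0 i) (ha1 i) (pow_nonneg (hc0 i) k)
        (pow_le_one₀ (hc0 i) (hc1 i))).trans ?_
      push_cast; linarith
  classical
  induction s using Finset.induction_on with
  | empty => simp
  | insert j s hj ih =>
    rw [Finset.prod_insert hj, Finset.prod_insert hj, Finset.sum_insert hj]
    refine (key _ _ _ _ (Finset.prod_nonneg fun i _ => pow_nonneg (ha0 i) _)
      (Finset.prod_le_one (fun i _ => pow_nonneg (ha0 i) _)
        fun i _ => pow_le_one₀ (ha0 i) (ha1 i)) (pow_nonneg (hc0 j) _)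
      (pow_le_one₀ (hc0 j) (hc1 j))).trans ?_
    exact add_le_add (hpow j _) ih

variable [PolishSpace X] [LocallyCompactSpace X] [MeasurableSpace X] [BorelSpace X]
  {ψ : X → ℝ} {b : Kernel X (Configuration X)} [IsMarkovKernel b]

/-- The operator `Φ` on functions with values in `[0, 1] ⊆ [0, ∞]`. -/
def PhiE (b : Kernel X (Configuration X)) (p : X → ℝ≥0∞) (x : X) : ℝ≥0∞ :=
  ∫⁻ ξ, prodE p ξ ∂(b x)

lemma PhiE_le_one (p : X → ℝ≥0∞) (x : X) : PhiE b p x ≤ 1 := by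
  calc PhiE b p x ≤ ∫⁻ _, 1 ∂(b x) := lintegral_mono fun ξ => prodE_le_one _ _
    _ = 1 := by simp

lemma PhiE_mono {p p' : X → ℝ≥0∞} (h : ∀ y, p y ≤ p' y) (x : X) : PhiE b p x ≤ PhiE b p' x :=
  lintegral_mono fun _ => prodE_mono h _

lemma measurable_prodE_right {p : X → ℝ≥0∞} (hp : Measurable p) :
    Measurable fun ξ : Configuration X => prodE p ξ := by
  have h0 : Measurable (Function.uncurry fun _ : Unit => p) := hp.comp measurable_snd
  have h1 : Measurable fun z : Unit × Configuration X => prodE p z.2 :=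
    measurable_prodE (p := fun _ : Unit => p) h0
  have h2 : Measurable fun ξ : Configuration X => ((), ξ) := measurable_const.prodMk measurable_id
  have h3 := h1.comp h2
  exact h3

lemma measurable_PhiE {S : Type*} [MeasurableSpace S] {p : S → X → ℝ≥0∞}
    (hp : Measurable (Function.uncurry p)) :
    Measurable fun z : S × X => PhiE b (p z.1) z.2 := by
  let b' : Kernel (S × X) (Configuration X) := b.comap Prod.snd measurable_snd
  have h1 : Measurable fun z : (S × X) × Configuration X => (z.1.1, z.2) :=
    (measurable_fst.comp measurable_fst).prodMk measurable_snd
  have h2 : Measurable fun z : (S × X) × Configuration X => prodE (p z.1.1) z.2 := by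
    have h3 := (measurable_prodE hp).comp h1
    exact h3
  exact Measurable.lintegral_kernel_prod_right (κ := b') (f := fun z ξ => prodE (p z.1) ξ) h2

lemma Phi_eq_toReal (hb : Admissible b ψ) {φ : X → ℝ} (hφ : Measurable φ) (h0 : ∀ x, 0 ≤ φ x)
    (h1 : ∀ x, φ x ≤ 1) (x : X) :
    Phi b φ x = (PhiE b (fun y => ENNReal.ofReal (φ y)) x).toReal := by
  have hm := measurable_prodE_right hφ.ennreal_ofReal
  rw [PhiE, ← integral_toReal hm.aemeasurable
    (ae_of_all _ fun ξ => (prodE_le_one _ _).trans_lt ENNReal.one_lt_top), Phi]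
  refine integral_congr_ae ?_
  filter_upwards [hb.finite_cloud x] with ξ hξ
  exact (toReal_prodE h0 h1 hξ).symm

lemma Phi_nonneg (hb : Admissible b ψ) {φ : X → ℝ} (hφ : Measurable φ) (h0 : ∀ x, 0 ≤ φ x)
    (h1 : ∀ x, φ x ≤ 1) (x : X) : 0 ≤ Phi b φ x := by
  rw [Phi_eq_toReal hb hφ h0 h1]; exact ENNReal.toReal_nonneg

lemma Phi_le_one (hb : Admissible b ψ) {φ : X → ℝ} (hφ : Measurable φ) (h0 : ∀ x, 0 ≤ φ x)
    (h1 : ∀ x, φ x ≤ 1) (x : X) : Phi b φ x ≤ 1 := by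
  rw [Phi_eq_toReal hb hφ h0 h1]
  exact ENNReal.toReal_mono ENNReal.one_ne_top (PhiE_le_one _ _)

lemma measurable_Phi (hb : Admissible b ψ) {S : Type*} [MeasurableSpace S] {q : S → X → ℝ}
    (hq : Measurable (Function.uncurry q)) (h0 : ∀ s x, 0 ≤ q s x) (h1 : ∀ s x, q s x ≤ 1) :
    Measurable fun z : S × X => Phi b (q z.1) z.2 := by
  have : (fun z : S × X => Phi b (q z.1) z.2) =
      fun z => (PhiE b (fun y => ENNReal.ofReal (q z.1 y)) z.2).toReal := by
    funext z
    exact Phi_eq_toReal hb (hq.comp measurable_prodMk_left) (h0 _) (h1 _) _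
  rw [this]
  exact (measurable_PhiE (p := fun s y => ENNReal.ofReal (q s y)) hq.ennreal_ofReal).ennreal_toReal

lemma integrable_prodOver (hb : Admissible b ψ) {φ : X → ℝ} (hφ : Measurable φ)
    (h0 : ∀ x, 0 ≤ φ x) (h1 : ∀ x, φ x ≤ 1) (x : X) :
    Integrable (fun ξ : Configuration X => ξ.prodOver φ) (b x) := by
  have hm := measurable_prodE_right hφ.ennreal_ofReal
  have : Integrable (fun ξ => (prodE (fun y => ENNReal.ofReal (φ y)) ξ).toReal) (b x) := by
    refine Integrable.of_bound hm.ennreal_toReal.aestronglyMeasurable 1 (ae_of_all _ fun ξ => ?_)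
    rw [Real.norm_of_nonneg ENNReal.toReal_nonneg]
    exact ENNReal.toReal_mono ENNReal.one_ne_top (prodE_le_one _ _)
  refine this.congr ?_
  filter_upwards [hb.finite_cloud x] with ξ hξ
  exact toReal_prodE h0 h1 hξ

lemma deathProb_le_Phi (hb : Admissible b ψ) {φ : X → ℝ} (hφ : Measurable φ)
    (h0 : ∀ x, 0 ≤ φ x) (h1 : ∀ x, φ x ≤ 1) (x : X) : deathProb b x ≤ Phi b φ x := by
  have hm := measurable_prodE_right hφ.ennreal_ofReal
  rw [Phi_eq_toReal hb hφ h0 h1]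
  refine ENNReal.toReal_mono (ne_top_of_le_ne_top ENNReal.one_ne_top (PhiE_le_one _ _)) ?_
  calc b x {0} ≤ b x {ξ | 1 ≤ prodE (fun y => ENNReal.ofReal (φ y)) ξ} := by
        refine measure_mono ?_
        rintro ξ rfl
        simp
    _ = 1 * b x {ξ | 1 ≤ prodE (fun y => ENNReal.ofReal (φ y)) ξ} := (one_mul _).symm
    _ ≤ _ := mul_meas_ge_le_lintegral hm 1

/-- The operator `Φ` is Lipschitz with respect to the intensity of the offspring. -/
lemma ofReal_abs_Phi_sub_le (hb : Admissible b ψ) {a c : X → ℝ} (ha : Measurable a)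
    (hc : Measurable c) (ha0 : ∀ x, 0 ≤ a x) (ha1 : ∀ x, a x ≤ 1) (hc0 : ∀ x, 0 ≤ c x)
    (hc1 : ∀ x, c x ≤ 1) {d : X → ℝ} (hd : ∀ x, |a x - c x| ≤ d x) (x : X) :
    ENNReal.ofReal |Phi b a x - Phi b c x| ≤ correlationIntegral b x d := by
  rw [Phi, Phi, ← integral_sub (integrable_prodOver hb ha ha0 ha1 x)
    (integrable_prodOver hb hc hc0 hc1 x), ← Real.norm_eq_abs, ofReal_norm]
  refine (enorm_integral_le_lintegral_enorm _).trans (lintegral_mono_ae ?_)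
  filter_upwards [hb.finite_cloud x] with ξ hξ
  rw [← ofReal_norm, Real.norm_eq_abs, prodOver_of_isFinite a hξ,
    prodOver_of_isFinite c hξ]
  refine (ENNReal.ofReal_le_ofReal (abs_prod_pow_sub_le _ _ ha0 ha1 hc0 hc1)).trans ?_
  rw [ENNReal.ofReal_sum_of_nonneg fun i _ => by positivity]
  refine (Finset.sum_le_sum fun y _ => ?_).trans (ENNReal.sum_le_tsum (Set.Finite.toFinset hξ))
  rw [ENNReal.ofReal_mul (by positivity), ENNReal.ofReal_natCast]
  gcongr
  exact hd y

lemma meanOffspring_le (x : X) : meanOffspring b x ≤ supMeanOffspring b :=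
  le_iSup (meanOffspring b) x

lemma abs_Phi_sub_le (hb : Admissible b ψ) {a c : X → ℝ} (ha : Measurable a)
    (hc : Measurable c) (ha0 : ∀ x, 0 ≤ a x) (ha1 : ∀ x, a x ≤ 1) (hc0 : ∀ x, 0 ≤ c x)
    (hc1 : ∀ x, c x ≤ 1) {B : ℝ} (hd : ∀ x, |a x - c x| ≤ B) (x : X) :
    |Phi b a x - Phi b c x| ≤ (supMeanOffspring b).toReal * B := by
  have hB : 0 ≤ B := (abs_nonneg _).trans (hd x)
  rw [← ENNReal.ofReal_le_ofReal_iff (by positivity), ENNReal.ofReal_mul (by positivity),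
    ENNReal.ofReal_toReal hb.supMeanOffspring_lt_top.ne]
  refine (ofReal_abs_Phi_sub_le hb ha hc ha0 ha1 hc0 hc1 hd x).trans ?_
  calc correlationIntegral b x (fun _ => B)
      = ∫⁻ ξ, ξ.card * ENNReal.ofReal B ∂(b x) := by
        refine lintegral_congr fun ξ => ?_
        rw [Configuration.card, ENNReal.tsum_mul_right]
    _ = meanOffspring b x * ENNReal.ofReal B := by
        rw [lintegral_mul_const', meanOffspring]
        exact ENNReal.ofReal_ne_top
    _ ≤ _ := by gcongr; exact meanOffspring_le x

/-- The operator `Φ` is Lipschitz in the norm with weight `ψ`. -/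
lemma exists_abs_Phi_sub_le_mul (hb : Admissible b ψ) (hψ : ∀ x, 0 < ψ x) :
    ∃ N : ℝ, 0 ≤ N ∧ ∀ a c : X → ℝ, Measurable a → Measurable c →
      (∀ x, 0 ≤ a x) → (∀ x, a x ≤ 1) → (∀ x, 0 ≤ c x) → (∀ x, c x ≤ 1) →
      ∀ K : ℝ, 0 ≤ K → (∀ x, |a x - c x| ≤ K * ψ x) →
        ∀ x, |Phi b a x - Phi b c x| ≤ N * K * ψ x := by
  obtain ⟨m, hm0, hm⟩ := hb.dispersal
  refine ⟨(supMeanOffspring b).toReal * m, by positivity,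
    fun a c ha hc ha0 ha1 hc0 hc1 K hK hd x => ?_⟩
  have hψx := (hψ x).le
  rw [← ENNReal.ofReal_le_ofReal_iff (by positivity), ENNReal.ofReal_mul (by positivity),
    ENNReal.ofReal_mul (by positivity), ENNReal.ofReal_mul (by positivity),
    ENNReal.ofReal_toReal hb.supMeanOffspring_lt_top.ne, ENNReal.ofReal_coe_nnreal]
  refine (ofReal_abs_Phi_sub_le hb ha hc ha0 ha1 hc0 hc1 hd x).trans ?_
  calc correlationIntegral b x (fun y => K * ψ y)
      = ∫⁻ ξ, ENNReal.ofReal K * ∑' y, (ξ.mult y : ℝ≥0∞) * ENNReal.ofReal (ψ y) ∂(b x) := by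
        refine lintegral_congr fun ξ => ?_
        rw [← ENNReal.tsum_mul_left]
        refine tsum_congr fun y => ?_
        rw [ENNReal.ofReal_mul hK]; ring
    _ = ENNReal.ofReal K * correlationIntegral b x ψ := by
        rw [lintegral_const_mul', correlationIntegral]
        exact ENNReal.ofReal_ne_top
    _ ≤ ENNReal.ofReal K * (meanOffspring b x * m * ENNReal.ofReal (ψ x)) := by
        gcongr; exact hm x
    _ ≤ ENNReal.ofReal K * (supMeanOffspring b * m * ENNReal.ofReal (ψ x)) := by
        gcongr; exact meanOffspring_le x
    _ = _ := by ring

/-- The bound `Φ(φ) ≥ δ ≥ 1 - ψ`; it keeps the solutions of the evolution equation above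
`1 - Mψ`. -/
lemma one_sub_le_Phi (hb : Admissible b ψ) {φ : X → ℝ} (hφ : Measurable φ)
    (h0 : ∀ x, 0 ≤ φ x) (h1 : ∀ x, φ x ≤ 1) (x : X) : 1 - ψ x ≤ Phi b φ x := by
  obtain ⟨_, _, h⟩ := hb.deathProb_ge
  exact (h x).1.trans (deathProb_le_Phi hb hφ h0 h1 x)

lemma Phi_one (hb : Admissible b ψ) (x : X) : Phi b (fun _ => 1) x = 1 := by
  rw [Phi_eq_toReal hb measurable_const (fun _ => zero_le_one) (fun _ => le_rfl)]
  simp [PhiE, prodE, pair]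

/-- Continuous functions between `1 - ψ` and `1` are of the form `e^{-gψ}` with `g` bounded, since
`1 - ψ` is bounded away from `0`. The assumption on the continuity of `Φ` applies to them. -/
lemma exists_test_eq_exp (hψc : Continuous ψ) (hψ : ∀ x, 0 < ψ x) (hb : Admissible b ψ)
    {φ : X → ℝ} (hφ : Continuous φ) (h0 : ∀ x, 1 - ψ x ≤ φ x) (h1 : ∀ x, φ x ≤ 1) :
    ∃ g : Test X, ∀ x, φ x = Real.exp (-(g.1 x * ψ x)) := by
  obtain ⟨δ, hδ, hd⟩ := hb.deathProb_ge
  have hpos : ∀ x, δ ≤ φ x := fun x => (hd x).2.trans (h0 x)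
  have hpos' : ∀ x, 0 < φ x := fun x => hδ.trans_le (hpos x)
  have hn : ∀ x, 0 ≤ -Real.log (φ x) / ψ x := fun x =>
    div_nonneg (neg_nonneg.2 (Real.log_nonpos (hpos' x).le (h1 x))) (hψ x).le
  have hc : Continuous fun x => -Real.log (φ x) / ψ x :=
    (hφ.log fun x => (hpos' x).ne').neg.div hψc fun x => (hψ x).ne'
  refine ⟨⟨BoundedContinuousFunction.ofNormedAddCommGroup _ hc δ⁻¹ fun x => ?_, hn⟩, fun x => ?_⟩
  · rw [Real.norm_of_nonneg (hn x), div_le_iff₀ (hψ x)]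
    have h2 := Real.one_sub_inv_le_log_of_pos (hpos' x)
    have h3 : (φ x)⁻¹ - 1 ≤ δ⁻¹ * ψ x := by
      have : (φ x)⁻¹ - 1 = (φ x)⁻¹ * (1 - φ x) := by
        rw [mul_sub, inv_mul_cancel₀ (hpos' x).ne', mul_one]
      rw [this]
      have := hψ x
      exact mul_le_mul (inv_anti₀ hδ (hpos x)) (by linarith [h0 x]) (by linarith [h1 x])
        (by positivity)
    linarith
  · change φ x = Real.exp (-(-Real.log (φ x) / ψ x * ψ x))
    rw [div_mul_cancel₀ _ (hψ x).ne', neg_neg, Real.exp_log (hpos' x)]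

lemma continuous_Phi (hψc : Continuous ψ) (hψ : ∀ x, 0 < ψ x) (hb : Admissible b ψ)
    {φ : X → ℝ} (hφ : Continuous φ) (h0 : ∀ x, 1 - ψ x ≤ φ x) (h1 : ∀ x, φ x ≤ 1) :
    Continuous (Phi b φ) := by
  obtain ⟨g, hg⟩ := exists_test_eq_exp hψc hψ hb hφ h0 h1
  have : φ = fun x => Real.exp (-(g.1 x * ψ x)) := funext hg
  rw [this]
  exact hb.continuous_Phi g.1 g.nonneg

end PhiSection

/-! ### Mild solutions of the evolution equation of a single particle -/

section Mild

variable {X : Type*} [TopologicalSpace X] [PolishSpace X] [LocallyCompactSpace X]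
  [MeasurableSpace X] [BorelSpace X] {ψ : X → ℝ} {b : Kernel X (Configuration X)}
  [IsMarkovKernel b]

/-- Mild solutions, with values in `[0, 1]`, of `∂_t q_t = Φ(q_t) - q_t`, `q_0 = φ`. The values for
negative times only serve to have a function on the whole line. -/
structure IsMild (b : Kernel X (Configuration X)) (φ : X → ℝ) (q : ℝ → X → ℝ) : Prop where
  measurable : Measurable (Function.uncurry q)
  nonneg : ∀ t x, 0 ≤ q t x
  le_one : ∀ t x, q t x ≤ 1
  eq : ∀ t, 0 ≤ t → ∀ x, q t x =
    Real.exp (-t) * φ x + ∫ s in (0 : ℝ)..t, Real.exp (-(t - s)) * Phi b (q s) x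

lemma integral_exp_neg_sub (t : ℝ) :
    ∫ s in (0 : ℝ)..t, Real.exp (-(t - s)) = 1 - Real.exp (-t) := by
  have hd : ∀ s ∈ Set.uIcc 0 t,
      HasDerivAt (fun s => Real.exp (-(t - s))) (Real.exp (-(t - s))) s := fun s _ => by
    have h1 : HasDerivAt (fun s : ℝ => -(t - s)) 1 s := by
      simp_rw [neg_sub]
      exact (hasDerivAt_id s).sub_const t
    simpa using h1.exp
  rw [intervalIntegral.integral_eq_sub_of_hasDerivAt hd
    (Continuous.intervalIntegrable (by fun_prop) _ _)]
  simp

lemma intervalIntegrable_exp_mul_Phi (hb : Admissible b ψ) {q : ℝ → X → ℝ}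
    (hm : Measurable (Function.uncurry q)) (h0 : ∀ t x, 0 ≤ q t x) (h1 : ∀ t x, q t x ≤ 1)
    (x : X) (t u v : ℝ) :
    IntervalIntegrable (fun s => Real.exp (-(t - s)) * Phi b (q s) x) volume u v := by
  have hΦ : Measurable fun s : ℝ => Phi b (q s) x :=
    (measurable_Phi hb hm h0 h1).comp measurable_prodMk_right
  refine IntervalIntegrable.continuousOn_mul ?_ (Continuous.continuousOn (by fun_prop))
  refine (intervalIntegrable_const (c := (1 : ℝ))).mono_fun' hΦ.aestronglyMeasurable
    (ae_of_all _ fun s => ?_)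
  have hqs : Measurable (q s) := hm.comp measurable_prodMk_left
  beta_reduce
  rw [Real.norm_of_nonneg (Phi_nonneg hb hqs (h0 s) (h1 s) x)]
  exact Phi_le_one hb hqs (h0 s) (h1 s) x

lemma measurable_integral_exp_mul_Phi (hb : Admissible b ψ) {q : ℝ → X → ℝ}
    (hm : Measurable (Function.uncurry q)) (h0 : ∀ t x, 0 ≤ q t x) (h1 : ∀ t x, q t x ≤ 1) :
    Measurable fun z : ℝ × X =>
      ∫ s in (0 : ℝ)..z.1, Real.exp (-(z.1 - s)) * Phi b (q s) z.2 := by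
  -- rescale the integral to a fixed interval
  have he : (fun z : ℝ × X => ∫ s in (0 : ℝ)..z.1, Real.exp (-(z.1 - s)) * Phi b (q s) z.2) =
      fun z => z.1 * ∫ u in Set.Ioc (0 : ℝ) 1,
        Real.exp (-(z.1 - z.1 * u)) * Phi b (q (z.1 * u)) z.2 := by
    funext z
    have := intervalIntegral.smul_integral_comp_mul_left (a := 0) (b := 1)
      (fun s => Real.exp (-(z.1 - s)) * Phi b (q s) z.2) z.1
    rw [mul_zero, mul_one] at this
    rw [← this, intervalIntegral.integral_of_le zero_le_one, smul_eq_mul]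
  rw [he]
  have e : Measurable fun z : (ℝ × X) × ℝ => (z.1.1 * z.2, z.1.2) := by fun_prop
  have e' : Measurable fun z : (ℝ × X) × ℝ => Phi b (q (z.1.1 * z.2)) z.1.2 := by
    have h3 := (measurable_Phi hb hm h0 h1).comp e
    exact h3
  have e'' : Measurable fun z : (ℝ × X) × ℝ =>
      Real.exp (-(z.1.1 - z.1.1 * z.2)) * Phi b (q (z.1.1 * z.2)) z.1.2 :=
    (by fun_prop : Measurable fun z : (ℝ × X) × ℝ => Real.exp (-(z.1.1 - z.1.1 * z.2))).mul e'
  exact measurable_fst.mul (StronglyMeasurable.integral_prod_right'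
    (ν := volume.restrict (Set.Ioc (0 : ℝ) 1)) e''.stronglyMeasurable).measurable

/-- Grönwall's inequality for a function bounded uniformly in `x`; no measurability of the supremum
over `x` is needed. -/
lemma gronwall_uniform {Z : Type*} {D : ℝ → Z → ℝ} {A C n T : ℝ} (hA : 0 ≤ A)
    (hC : ∀ t ∈ Set.Icc 0 T, ∀ x, D t x ≤ C)
    (hstep : ∀ B : ℝ → ℝ, Continuous B → (∀ s ∈ Set.Icc 0 T, ∀ y, D s y ≤ B s) →
      ∀ t ∈ Set.Icc 0 T, ∀ x, D t x ≤ A + n * ∫ s in (0 : ℝ)..t, B s) :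
    ∀ t ∈ Set.Icc 0 T, ∀ x, D t x ≤ A * Real.exp (n * t) := by
  have key : ∀ k : ℕ, ∀ t ∈ Set.Icc 0 T, ∀ x,
      D t x ≤ A * Real.exp (n * t) + C * ((n * t) ^ k / k.factorial) := by
    intro k
    induction k with
    | zero =>
      intro t ht x
      have := hC t ht x
      have : 0 ≤ A * Real.exp (n * t) := by positivity
      simp; linarith
    | succ k ih =>
      intro t ht x
      refine (hstep _ (by fun_prop) ih t ht x).trans (le_of_eq ?_)
      have hd : ∀ s ∈ Set.uIcc 0 t,
          HasDerivAt (fun s => A * Real.exp (n * s) +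
            C * ((n * s) ^ (k + 1) / (k + 1).factorial))
          (n * (A * Real.exp (n * s) + C * ((n * s) ^ k / k.factorial))) s := fun s _ => by
        have h1 : HasDerivAt (fun s : ℝ => n * s) n s := by
          simpa using (hasDerivAt_id s).const_mul n
        have h2 := (h1.exp.const_mul A).add
          (((h1.pow (k + 1)).div_const ((k + 1).factorial : ℝ)).const_mul C)
        refine h2.congr_deriv ?_
        have : (k.factorial : ℝ) ≠ 0 := by positivity
        rw [Nat.factorial_succ]
        push_cast
        field_simp
      rw [← intervalIntegral.integral_const_mul, intervalIntegral.integral_eq_sub_of_hasDerivAt hd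
        (Continuous.intervalIntegrable (by fun_prop) _ _)]
      simp
  intro t ht x
  have hlim : Tendsto (fun k : ℕ => A * Real.exp (n * t) + C * ((n * t) ^ k / k.factorial)) atTop
      (𝓝 (A * Real.exp (n * t) + C * 0)) :=
    ((FloorSemiring.tendsto_pow_div_factorial_atTop (n * t)).const_mul C).const_add _
  rw [mul_zero, add_zero] at hlim
  exact ge_of_tendsto' hlim fun k => key k t ht x

lemma abs_integral_exp_mul_le {f B : ℝ → ℝ} (hB : Continuous B) {t : ℝ} (ht : 0 ≤ t)
    (h : ∀ s ∈ Set.Icc 0 t, |f s| ≤ B s) :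
    |∫ s in (0 : ℝ)..t, Real.exp (-(t - s)) * f s| ≤ ∫ s in (0 : ℝ)..t, B s := by
  rw [← Real.norm_eq_abs]
  refine intervalIntegral.norm_integral_le_of_norm_le ht (ae_of_all _ fun s hs => ?_)
    (hB.intervalIntegrable _ _)
  rw [Real.norm_eq_abs, abs_mul, abs_of_pos (Real.exp_pos _)]
  calc Real.exp (-(t - s)) * |f s| ≤ 1 * |f s| := by
        gcongr
        exact Real.exp_le_one_iff.2 (by linarith [hs.2])
    _ ≤ B s := by rw [one_mul]; exact h s ⟨hs.1.le, hs.2⟩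

namespace IsMild

variable {φ : X → ℝ} {q : ℝ → X → ℝ}

lemma measurable_apply (h : IsMild b φ q) (t : ℝ) : Measurable (q t) :=
  h.measurable.comp measurable_prodMk_left

lemma intervalIntegrable (h : IsMild b φ q) (hb : Admissible b ψ) (x : X) (t u v : ℝ) :
    IntervalIntegrable (fun s => Real.exp (-(t - s)) * Phi b (q s) x) volume u v :=
  intervalIntegrable_exp_mul_Phi hb h.measurable h.nonneg h.le_one x t u v

lemma zero (h : IsMild b φ q) (x : X) : q 0 x = φ x := by
  have := h.eq 0 le_rfl x
  simpa using this

/-- Mild solutions are determined by their initial values. -/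
lemma unique (hb : Admissible b ψ) {q' : ℝ → X → ℝ} (h : IsMild b φ q) (h' : IsMild b φ q')
    {t : ℝ} (ht : 0 ≤ t) (x : X) : q t x = q' t x := by
  have := gronwall_uniform (D := fun t x => |q t x - q' t x|) (A := 0) (C := 1) (T := t)
    (n := (supMeanOffspring b).toReal) le_rfl ?_ ?_ t ⟨ht, le_rfl⟩ x
  · rw [zero_mul] at this
    exact sub_eq_zero.1 (abs_nonpos_iff.1 this)
  · intro s _ y
    rw [abs_le]
    constructor <;> linarith [h.nonneg s y, h'.nonneg s y, h.le_one s y, h'.le_one s y]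
  · intro B hB hD s hs y
    rw [zero_add, h.eq s hs.1, h'.eq s hs.1, add_sub_add_left_eq_sub,
      ← intervalIntegral.integral_sub (h.intervalIntegrable hb y s 0 s)
        (h'.intervalIntegrable hb y s 0 s), ← intervalIntegral.integral_const_mul]
    simp_rw [← mul_sub]
    refine abs_integral_exp_mul_le (by fun_prop) hs.1 fun r hr => ?_
    exact abs_Phi_sub_le hb (h.measurable_apply r) (h'.measurable_apply r) (h.nonneg r)
      (h.le_one r) (h'.nonneg r) (h'.le_one r) (hD r ⟨hr.1, hr.2.trans hs.2⟩) y

/-- In mild form, a lower bound for `Φ` along the solution gives a convex combination as lower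
bound for the solution. -/
lemma ge (h : IsMild b φ q) (hb : Admissible b ψ) {x : X} {c : ℝ}
    (hc : ∀ s, 0 ≤ s → c ≤ Phi b (q s) x) {t : ℝ} (ht : 0 ≤ t) :
    Real.exp (-t) * φ x + (1 - Real.exp (-t)) * c ≤ q t x := by
  rw [h.eq t ht, ← integral_exp_neg_sub, ← intervalIntegral.integral_mul_const]
  refine add_le_add_right (intervalIntegral.integral_mono_on ht
    (Continuous.intervalIntegrable (by fun_prop) _ _) (h.intervalIntegrable hb x t 0 t)
    fun s hs => ?_) _
  exact mul_le_mul_of_nonneg_left (hc s hs.1) (Real.exp_pos _).le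

lemma le (h : IsMild b φ q) (hb : Admissible b ψ) {x : X} {t : ℝ} (ht : 0 ≤ t) :
    q t x ≤ 1 - Real.exp (-t) * (1 - φ x) := by
  have : ∫ s in (0 : ℝ)..t, Real.exp (-(t - s)) * Phi b (q s) x ≤ 1 - Real.exp (-t) := by
    rw [← integral_exp_neg_sub]
    refine intervalIntegral.integral_mono_on ht (h.intervalIntegrable hb x t 0 t)
      (Continuous.intervalIntegrable (by fun_prop) _ _) fun s _ => ?_
    exact mul_le_of_le_one_right (Real.exp_pos _).le
      (Phi_le_one hb (h.measurable_apply s) (h.nonneg s) (h.le_one s) x)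
  rw [h.eq t ht]
  linarith

lemma deathProb_le (h : IsMild b φ q) (hb : Admissible b ψ) {x : X} (hφ : deathProb b x ≤ φ x)
    {t : ℝ} (ht : 0 ≤ t) : deathProb b x ≤ q t x := by
  have h1 := h.ge hb (x := x) (c := deathProb b x) (fun s _ =>
    deathProb_le_Phi hb (h.measurable_apply s) (h.nonneg s) (h.le_one s) x) ht
  have := Real.exp_pos (-t)
  nlinarith

lemma one_sub_le (h : IsMild b φ q) (hb : Admissible b ψ) (hψ : ∀ x, 0 < ψ x) {x : X} {M : ℝ}
    (hM : 1 ≤ M) (hφ : 1 - φ x ≤ M * ψ x) {t : ℝ} (ht : 0 ≤ t) : 1 - q t x ≤ M * ψ x := by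
  have h1 := h.ge hb (x := x) (c := 1 - M * ψ x) (fun s _ => by
    have := one_sub_le_Phi hb (h.measurable_apply s) (h.nonneg s) (h.le_one s) x
    nlinarith [hψ x]) ht
  have := Real.exp_pos (-t)
  nlinarith

/-- In the subcritical case the solutions tend to `1` exponentially fast. -/
lemma one_sub_le_exp (h : IsMild b φ q) (hb : Admissible b ψ) (hφ : ∀ x, 0 ≤ φ x) {t : ℝ}
    (ht : 0 ≤ t) (x : X) :
    1 - q t x ≤ Real.exp (((supMeanOffspring b).toReal - 1) * t) := by
  have key := gronwall_uniform (D := fun t x => Real.exp t * (1 - q t x)) (A := 1)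
    (C := Real.exp t) (T := t) (n := (supMeanOffspring b).toReal) zero_le_one
    ?_ ?_ t ⟨ht, le_rfl⟩ x
  · have h2 : 1 - q t x = Real.exp (-t) * (Real.exp t * (1 - q t x)) := by
      rw [← mul_assoc, ← Real.exp_add]; simp
    have h3 : Real.exp (((supMeanOffspring b).toReal - 1) * t) =
        Real.exp (-t) * (1 * Real.exp ((supMeanOffspring b).toReal * t)) := by
      rw [one_mul, ← Real.exp_add]; congr 1; ring
    rw [h2, h3]
    exact mul_le_mul_of_nonneg_left key (Real.exp_pos _).le
  · intro s hs y
    have h1 : Real.exp s ≤ Real.exp t := Real.exp_le_exp.2 hs.2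
    have := h.nonneg s y
    have := h.le_one s y
    nlinarith [Real.exp_pos s]
  · intro B hB hD s hs y
    have h1 : 1 - q s y = Real.exp (-s) * (1 - φ y) +
        ∫ r in (0 : ℝ)..s, Real.exp (-(s - r)) * (1 - Phi b (q r) y) := by
      simp_rw [mul_sub, mul_one]
      rw [intervalIntegral.integral_sub (Continuous.intervalIntegrable (by fun_prop) _ _)
        (h.intervalIntegrable hb y s 0 s), integral_exp_neg_sub, h.eq s hs.1]
      ring
    have h2 : Real.exp s * ∫ r in (0 : ℝ)..s, Real.exp (-(s - r)) * (1 - Phi b (q r) y) ≤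
        (supMeanOffspring b).toReal * ∫ r in (0 : ℝ)..s, B r := by
      rw [← intervalIntegral.integral_const_mul, ← intervalIntegral.integral_const_mul]
      refine intervalIntegral.integral_mono_on hs.1 ?_
        (Continuous.intervalIntegrable (by fun_prop) _ _) fun r hr => ?_
      · simp_rw [mul_sub, mul_one]
        exact ((Continuous.intervalIntegrable (by fun_prop) _ _).sub
          ((h.intervalIntegrable hb y s 0 s).const_mul _))
      · have h3 := abs_Phi_sub_le hb measurable_const (h.measurable_apply r)
          (fun _ => zero_le_one) (fun _ => le_rfl) (h.nonneg r) (h.le_one r)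
          (B := Real.exp (-r) * B r) (fun z => by
            have h4 := h.le_one r z
            rw [abs_of_nonneg (by linarith)]
            have h5 := hD r ⟨hr.1, hr.2.trans hs.2⟩ z
            calc 1 - q r z = Real.exp (-r) * (Real.exp r * (1 - q r z)) := by
                  rw [← mul_assoc, ← Real.exp_add]; simp
              _ ≤ _ := mul_le_mul_of_nonneg_left h5 (Real.exp_pos _).le) y
        rw [Phi_one hb] at h3
        have h6 : Real.exp s * Real.exp (-(s - r)) = Real.exp r := by
          rw [← Real.exp_add]; congr 1; ring
        rw [← mul_assoc, h6]
        calc Real.exp r * (1 - Phi b (q r) y)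
            ≤ Real.exp r * ((supMeanOffspring b).toReal * (Real.exp (-r) * B r)) :=
              mul_le_mul_of_nonneg_left ((le_abs_self _).trans h3) (Real.exp_pos _).le
          _ = (Real.exp r * Real.exp (-r)) * ((supMeanOffspring b).toReal * B r) := by ring
          _ = _ := by rw [← Real.exp_add]; simp
    rw [h1, mul_add]
    have h7 : Real.exp s * (Real.exp (-s) * (1 - φ y)) = 1 - φ y := by
      rw [← mul_assoc, ← Real.exp_add]; simp
    linarith [hφ y]

/-- Restarting a solution at a later time. -/
lemma shift (h : IsMild b φ q) (hb : Admissible b ψ) {r : ℝ} (hr : 0 ≤ r) :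
    IsMild b (q r) (fun t => q (t + r)) where
  measurable := h.measurable.comp (((measurable_fst).add_const r).prodMk measurable_snd)
  nonneg t x := h.nonneg _ x
  le_one t x := h.le_one _ x
  eq t ht x := by
    have h1 := intervalIntegral.integral_add_adjacent_intervals
      (h.intervalIntegrable hb x (t + r) 0 r) (h.intervalIntegrable hb x (t + r) r (t + r))
    have h2 : ∫ s in (0 : ℝ)..t, Real.exp (-(t - s)) * Phi b (q (s + r)) x =
        ∫ s in r..(t + r), Real.exp (-(t + r - s)) * Phi b (q s) x := by
      have := intervalIntegral.integral_comp_add_right (a := 0) (b := t)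
        (fun s => Real.exp (-(t + r - s)) * Phi b (q s) x) r
      rw [zero_add] at this
      rw [← this]
      refine intervalIntegral.integral_congr fun s _ => ?_
      congr 2; ring
    have h3 : ∫ s in (0 : ℝ)..r, Real.exp (-(t + r - s)) * Phi b (q s) x =
        Real.exp (-t) * ∫ s in (0 : ℝ)..r, Real.exp (-(r - s)) * Phi b (q s) x := by
      rw [← intervalIntegral.integral_const_mul]
      refine intervalIntegral.integral_congr fun s _ => ?_
      rw [← mul_assoc, ← Real.exp_add]
      congr 2; ring
    rw [h.eq (t + r) (by linarith), h.eq r hr, ← h1, h2, h3, neg_add, Real.exp_add]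
    ring

lemma continuousOn (h : IsMild b φ q) (hb : Admissible b ψ) (x : X) :
    ContinuousOn (fun t => q t x) (Set.Ici 0) := by
  have hc : Continuous fun t => Real.exp (-t) * φ x +
      Real.exp (-t) * ∫ s in (0 : ℝ)..t, Real.exp s * Phi b (q s) x := by
    have h1 : ∀ u v, IntervalIntegrable (fun s => Real.exp s * Phi b (q s) x) volume u v :=
      fun u v => by
        have := h.intervalIntegrable hb x 0 u v
        simpa using this
    have := intervalIntegral.continuous_primitive h1 0
    fun_prop
  refine hc.continuousOn.congr fun t ht => ?_
  beta_reduce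
  rw [h.eq t ht, ← intervalIntegral.integral_const_mul]
  congr 1
  refine intervalIntegral.integral_congr fun s _ => ?_
  rw [← mul_assoc, ← Real.exp_add]
  congr 2; ring

/-- Solutions started from a continuous function between `1 - ψ` and `1` are continuous: they are
uniform limits of the Picard iterates, to which `Φ` can be applied within the class of continuous
functions. -/
lemma continuous (h : IsMild b φ q) (hb : Admissible b ψ) (hψc : Continuous ψ)
    (hψ : ∀ x, 0 < ψ x) (hφ : Continuous φ) (h0 : ∀ x, 1 - ψ x ≤ φ x) (h1 : ∀ x, φ x ≤ 1)
    {t : ℝ} (ht : 0 ≤ t) : Continuous (q t) := by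
  obtain ⟨_, _, hδ⟩ := hb.deathProb_ge
  have hψ1 : ∀ x, 0 ≤ 1 - ψ x := fun x => by linarith [(hδ x).2]
  set n := (supMeanOffspring b).toReal with hn
  have key : ∀ k : ℕ, ∃ r : ℝ → X → ℝ, Measurable (Function.uncurry r) ∧
      (∀ t x, 1 - ψ x ≤ r t x) ∧ (∀ t x, r t x ≤ 1) ∧ (∀ t, Continuous (r t)) ∧
      ∀ t, 0 ≤ t → ∀ x, |r t x - q t x| ≤ (n * t) ^ k / k.factorial := by
    intro k
    induction k with
    | zero =>
      refine ⟨fun _ => φ, hφ.measurable.comp measurable_snd, fun _ => h0, fun _ => h1,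
        fun _ => hφ, fun t _ x => ?_⟩
      simp only [pow_zero, Nat.factorial_zero, Nat.cast_one, div_one]
      rw [abs_le]
      constructor <;> linarith [hψ1 x, h0 x, h1 x, h.nonneg t x, h.le_one t x]
    | succ k ih =>
      obtain ⟨r, hrm, hr0, hr1, hrc, hrq⟩ := ih
      have hr0' : ∀ t x, 0 ≤ r t x := fun t x => (hψ1 x).trans (hr0 t x)
      have hrm' : ∀ t, Measurable (r t) := fun t => (hrc t).measurable
      have hΦm := measurable_Phi hb hrm hr0' hr1
      let J : ℝ → X → ℝ := fun t x => Real.exp (-t) * φ x +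
        ∫ s in (0 : ℝ)..t, Real.exp (-(t - s)) * Phi b (r s) x
      have hJ0 : ∀ t, 0 ≤ t → ∀ x, 1 - ψ x ≤ J t x := fun t ht x => by
        have : (1 - Real.exp (-t)) * (1 - ψ x) ≤
            ∫ s in (0 : ℝ)..t, Real.exp (-(t - s)) * Phi b (r s) x := by
          rw [← integral_exp_neg_sub, ← intervalIntegral.integral_mul_const]
          refine intervalIntegral.integral_mono_on ht
            (Continuous.intervalIntegrable (by fun_prop) _ _)
            (intervalIntegrable_exp_mul_Phi hb hrm hr0' hr1 x t 0 t) fun s _ => ?_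
          exact mul_le_mul_of_nonneg_left (one_sub_le_Phi hb (hrm' s) (hr0' s) (hr1 s) x)
            (Real.exp_pos _).le
        have := Real.exp_pos (-t)
        simp only [J]
        nlinarith [h0 x]
      have hJ1 : ∀ t, 0 ≤ t → ∀ x, J t x ≤ 1 := fun t ht x => by
        have : ∫ s in (0 : ℝ)..t, Real.exp (-(t - s)) * Phi b (r s) x ≤ 1 - Real.exp (-t) := by
          rw [← integral_exp_neg_sub]
          refine intervalIntegral.integral_mono_on ht
            (intervalIntegrable_exp_mul_Phi hb hrm hr0' hr1 x t 0 t)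
            (Continuous.intervalIntegrable (by fun_prop) _ _) fun s _ => ?_
          exact mul_le_of_le_one_right (Real.exp_pos _).le
            (Phi_le_one hb (hrm' s) (hr0' s) (hr1 s) x)
        have := Real.exp_pos (-t)
        simp only [J]
        nlinarith [h1 x]
      have hJc : ∀ t, Continuous (J t) := fun t => by
        refine (continuous_const.mul hφ).add
          (intervalIntegral.continuous_of_dominated_interval
            (bound := fun s => Real.exp (-(t - s))) (fun x => ?_) (fun x => ?_)
            (Continuous.intervalIntegrable (by fun_prop) _ _) (ae_of_all _ fun s _ => ?_))
        · have : Measurable fun s : ℝ => Phi b (r s) x := hΦm.comp measurable_prodMk_right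
          exact ((by fun_prop : Measurable fun s : ℝ => Real.exp (-(t - s))).mul
            this).aestronglyMeasurable
        · refine ae_of_all _ fun s _ => ?_
          rw [Real.norm_of_nonneg (mul_nonneg (Real.exp_pos _).le
            (Phi_nonneg hb (hrm' s) (hr0' s) (hr1 s) x))]
          exact mul_le_of_le_one_right (Real.exp_pos _).le
            (Phi_le_one hb (hrm' s) (hr0' s) (hr1 s) x)
        · exact continuous_const.mul (continuous_Phi hψc hψ hb (hrc s) (hr0 s) (hr1 s))
      have hJm : Measurable fun z : ℝ × X => J z.1 z.2 := by
        exact ((by fun_prop : Measurable fun z : ℝ × X => Real.exp (-z.1)).mul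
          (hφ.measurable.comp measurable_snd)).add
            (measurable_integral_exp_mul_Phi hb hrm hr0' hr1)
      refine ⟨fun t => J |t|, ?_, fun t => hJ0 _ (abs_nonneg t), fun t => hJ1 _ (abs_nonneg t),
        fun t => hJc _, fun t ht x => ?_⟩
      · have e : Measurable fun z : ℝ × X => (|z.1|, z.2) := by fun_prop
        have h3 := hJm.comp e
        exact h3
      · beta_reduce
        rw [abs_of_nonneg ht, h.eq t ht]
        simp only [J]
        rw [add_sub_add_left_eq_sub, ← intervalIntegral.integral_sub
          (intervalIntegrable_exp_mul_Phi hb hrm hr0' hr1 x t 0 t)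
          (h.intervalIntegrable hb x t 0 t)]
        simp_rw [← mul_sub]
        refine (abs_integral_exp_mul_le (B := fun s => n * ((n * s) ^ k / k.factorial))
          (by fun_prop) ht fun s hs => ?_).trans (le_of_eq ?_)
        · exact abs_Phi_sub_le hb (hrm' s) (h.measurable_apply s) (hr0' s) (hr1 s) (h.nonneg s)
            (h.le_one s) (hrq s hs.1) x
        · have hd : ∀ s ∈ Set.uIcc 0 t,
              HasDerivAt (fun s => (n * s) ^ (k + 1) / ((k + 1).factorial : ℝ))
              (n * ((n * s) ^ k / k.factorial)) s := fun s _ => by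
            have h1 : HasDerivAt (fun s : ℝ => n * s) n s := by
              simpa using (hasDerivAt_id s).const_mul n
            refine ((h1.pow (k + 1)).div_const ((k + 1).factorial : ℝ)).congr_deriv ?_
            have : (k.factorial : ℝ) ≠ 0 := by positivity
            rw [Nat.factorial_succ]
            push_cast
            field_simp
          rw [intervalIntegral.integral_eq_sub_of_hasDerivAt hd
            (Continuous.intervalIntegrable (by fun_prop) _ _)]
          simp
  refine continuous_of_uniform_approx_of_continuous fun u hu => ?_
  obtain ⟨ε, hε, hεu⟩ := Metric.mem_uniformity_dist.1 hu
  obtain ⟨k, hk⟩ := ((FloorSemiring.tendsto_pow_div_factorial_atTop (n * t)).eventually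
    (gt_mem_nhds hε)).exists
  obtain ⟨r, -, -, -, hrc, hrq⟩ := key k
  refine ⟨r t, hrc t, fun y => hεu ?_⟩
  rw [dist_comm, Real.dist_eq]
  exact (hrq t ht y).trans_lt hk

end IsMild

end Mild

/-! ### Construction of the law of a branching family -/

section Construction

variable {X : Type*} [TopologicalSpace X] [PolishSpace X] [LocallyCompactSpace X]
  [MeasurableSpace X] [BorelSpace X] {ψ : X → ℝ} {b : Kernel X (Configuration X)}
  [IsMarkovKernel b]

/-- One Picard step for the mild evolution equation, with values in `[0, ∞]`. -/
def picard (b : Kernel X (Configuration X)) (φ : X → ℝ≥0∞) (r : ℝ → X → ℝ≥0∞) (t : ℝ) (x : X) :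
    ℝ≥0∞ :=
  ENNReal.ofReal (Real.exp (-t)) * φ x +
    ∫⁻ s in Set.Ioc 0 t, ENNReal.ofReal (Real.exp (-(t - s))) * PhiE b (r s) x

/-- The Picard iterates started from `0`: the `k`-th one is the contribution of those families in
which at most `k` generations, that of the ancestor included, are born up to time `t`. -/
def picardIter (b : Kernel X (Configuration X)) (φ : X → ℝ≥0∞) : ℕ → ℝ → X → ℝ≥0∞
  | 0 => fun _ _ => 0
  | k + 1 => picard b φ (picardIter b φ k)

/-- The minimal solution of the evolution equation. -/
def minimalSol (b : Kernel X (Configuration X)) (φ : X → ℝ≥0∞) (t : ℝ) (x : X) : ℝ≥0∞ :=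
  ⨆ k, picardIter b φ k t x

lemma measurable_picard {φ : X → ℝ≥0∞} (hφ : Measurable φ) {r : ℝ → X → ℝ≥0∞}
    (hr : Measurable (Function.uncurry r)) : Measurable (Function.uncurry (picard b φ r)) := by
  have hP : Measurable fun z : ℝ × X => PhiE b (r z.1) z.2 := measurable_PhiE hr
  have e : Measurable fun z : (ℝ × X) × ℝ => (z.2, z.1.2) := by fun_prop
  have hP' : Measurable fun z : (ℝ × X) × ℝ => PhiE b (r z.2) z.1.2 := by
    have h3 := hP.comp e
    exact h3
  have hf : Measurable fun z : (ℝ × X) × ℝ =>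
      ENNReal.ofReal (Real.exp (-(z.1.1 - z.2))) * PhiE b (r z.2) z.1.2 :=
    (by fun_prop : Measurable fun z : (ℝ × X) × ℝ =>
      ENNReal.ofReal (Real.exp (-(z.1.1 - z.2)))).mul hP'
  have hs : MeasurableSet {z : (ℝ × X) × ℝ | 0 < z.2 ∧ z.2 ≤ z.1.1} :=
    (measurableSet_lt measurable_const measurable_snd).inter
      (measurableSet_le measurable_snd (measurable_fst.comp measurable_fst))
  have hint := (hf.indicator hs).lintegral_prod_right' (ν := volume)
  refine ((by fun_prop : Measurable fun z : ℝ × X => ENNReal.ofReal (Real.exp (-z.1))).mul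
    (hφ.comp measurable_snd)).add ?_
  convert hint using 2 with z
  rw [← lintegral_indicator measurableSet_Ioc]
  rfl

lemma measurable_picardIter {φ : X → ℝ≥0∞} (hφ : Measurable φ) (k : ℕ) :
    Measurable (Function.uncurry (picardIter b φ k)) := by
  induction k with
  | zero => exact measurable_const
  | succ k ih => exact measurable_picard hφ ih

lemma lintegral_exp_neg_sub {t : ℝ} (ht : 0 ≤ t) :
    ∫⁻ s in Set.Ioc 0 t, ENNReal.ofReal (Real.exp (-(t - s))) =
      ENNReal.ofReal (1 - Real.exp (-t)) := by
  rw [← integral_exp_neg_sub, intervalIntegral.integral_of_le ht,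
    ofReal_integral_eq_lintegral_ofReal _ (ae_of_all _ fun s => (Real.exp_pos _).le)]
  exact (Continuous.integrableOn_Ioc (by fun_prop))

lemma lintegral_exp_mul_PhiE_le {r : ℝ → X → ℝ≥0∞} {t : ℝ} (ht : 0 ≤ t) (x : X) :
    ∫⁻ s in Set.Ioc 0 t, ENNReal.ofReal (Real.exp (-(t - s))) * PhiE b (r s) x ≤
      ENNReal.ofReal (1 - Real.exp (-t)) := by
  rw [← lintegral_exp_neg_sub ht]
  exact lintegral_mono fun s => mul_le_of_le_one_right' (PhiE_le_one _ _)

lemma picard_le_one {φ : X → ℝ≥0∞} (hφ : ∀ x, φ x ≤ 1) {r : ℝ → X → ℝ≥0∞} {t : ℝ} (ht : 0 ≤ t)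
    (x : X) : picard b φ r t x ≤ 1 := by
  have h1 : Real.exp (-t) ≤ 1 := Real.exp_le_one_iff.2 (by linarith)
  calc picard b φ r t x
      ≤ ENNReal.ofReal (Real.exp (-t)) * 1 + ENNReal.ofReal (1 - Real.exp (-t)) :=
        add_le_add (by gcongr; exact hφ x) (lintegral_exp_mul_PhiE_le ht x)
    _ = 1 := by
        rw [mul_one, ← ENNReal.ofReal_add (Real.exp_pos _).le (by linarith)]
        simp

lemma picardIter_le_one {φ : X → ℝ≥0∞} (hφ : ∀ x, φ x ≤ 1) (k : ℕ) {t : ℝ} (ht : 0 ≤ t) (x : X) :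
    picardIter b φ k t x ≤ 1 := by
  cases k with
  | zero => exact zero_le_one
  | succ k => exact picard_le_one hφ ht x

lemma picard_mono {φ : X → ℝ≥0∞} {r r' : ℝ → X → ℝ≥0∞} (h : ∀ t x, r t x ≤ r' t x) (t : ℝ)
    (x : X) : picard b φ r t x ≤ picard b φ r' t x := by
  unfold picard
  gcongr with s
  exact PhiE_mono (h s) x

lemma picardIter_mono {φ : X → ℝ≥0∞} (t : ℝ) (x : X) :
    Monotone fun k => picardIter b φ k t x := by
  refine monotone_nat_of_le_succ fun k => ?_
  induction k generalizing t x with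
  | zero => exact zero_le
  | succ k ih => exact picard_mono ih t x

lemma minimalSol_le_one {φ : X → ℝ≥0∞} (hφ : ∀ x, φ x ≤ 1) {t : ℝ} (ht : 0 ≤ t) (x : X) :
    minimalSol b φ t x ≤ 1 := iSup_le fun k => picardIter_le_one hφ k ht x

lemma measurable_minimalSol {φ : X → ℝ≥0∞} (hφ : Measurable φ) :
    Measurable (Function.uncurry (minimalSol b φ)) :=
  Measurable.iSup fun k => measurable_picardIter hφ k

lemma prodE_iSup {r : ℕ → X → ℝ≥0∞} (hmono : ∀ x, Monotone fun k => r k x)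
    (h1 : ∀ k x, r k x ≤ 1) {ξ : Configuration X} (hξ : ξ.IsFinite) :
    prodE (fun x => ⨆ k, r k x) ξ = ⨆ k, prodE (r k) ξ := by
  have hle : ∀ x, ⨆ k, r k x ≤ 1 := fun x => iSup_le fun k => h1 k x
  have hlim : Tendsto (fun k => prodE (r k) ξ) atTop (𝓝 (prodE (fun x => ⨆ k, r k x) ξ)) := by
    simp_rw [prodE_of_isFinite hle hξ, fun k => prodE_of_isFinite (h1 k) hξ]
    refine ENNReal.tendsto_finsetProd_of_ne_top _ (fun x _ => ?_) fun x _ => ?_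
    · exact ENNReal.Tendsto.pow (tendsto_atTop_iSup (hmono x))
    · exact ENNReal.pow_ne_top (ne_top_of_le_ne_top ENNReal.one_ne_top (hle x))
  have hm : Monotone fun k => prodE (r k) ξ := fun k l hkl => prodE_mono (fun x => hmono x hkl) ξ
  exact tendsto_nhds_unique hlim (tendsto_atTop_iSup hm)

lemma PhiE_iSup (hb : Admissible b ψ) {r : ℕ → X → ℝ≥0∞} (hr : ∀ k, Measurable (r k))
    (hmono : ∀ x, Monotone fun k => r k x) (h1 : ∀ k x, r k x ≤ 1) (x : X) :
    PhiE b (fun x => ⨆ k, r k x) x = ⨆ k, PhiE b (r k) x := by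
  unfold PhiE
  rw [← lintegral_iSup (fun k => measurable_prodE_right (hr k))
    (fun k l hkl ξ => prodE_mono (fun x => hmono x hkl) ξ)]
  refine lintegral_congr_ae ?_
  filter_upwards [hb.finite_cloud x] with ξ hξ
  exact prodE_iSup hmono h1 hξ

/-- The minimal solution solves the evolution equation. -/
lemma minimalSol_eq_picard (hb : Admissible b ψ) {φ : X → ℝ≥0∞} (hφm : Measurable φ)
    (hφ : ∀ x, φ x ≤ 1) {t : ℝ} (x : X) :
    minimalSol b φ t x = picard b φ (minimalSol b φ) t x := by
  have hm : ∀ k (s : ℝ), Measurable (picardIter b φ k s) := fun k s =>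
    (measurable_picardIter hφm k).comp measurable_prodMk_left
  have h1 : minimalSol b φ t x = ⨆ k, picardIter b φ (k + 1) t x :=
    ((picardIter_mono t x).iSup_nat_add 1).symm
  rw [h1]
  change ⨆ k, picard b φ (picardIter b φ k) t x = _
  unfold picard
  rw [← ENNReal.add_iSup]
  congr 1
  rw [← lintegral_iSup]
  · refine setLIntegral_congr_fun measurableSet_Ioc fun s hs => ?_
    rw [← ENNReal.mul_iSup, ← PhiE_iSup hb (fun k => hm k s) (fun y => picardIter_mono s y)
      (fun k y => picardIter_le_one hφ k hs.1.le y)]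
    rfl
  · intro k
    have hP : Measurable fun s : ℝ => PhiE b (picardIter b φ k s) x :=
      (measurable_PhiE (measurable_picardIter hφm k)).comp measurable_prodMk_right
    exact (by fun_prop : Measurable fun s : ℝ => ENNReal.ofReal (Real.exp (-(t - s)))).mul hP
  · intro k l hkl s
    exact mul_le_mul_right (PhiE_mono (fun y => picardIter_mono s y hkl) x) _

/-- The real version of the minimal solution is a mild solution. -/
lemma isMild_minimalSol (hb : Admissible b ψ) {φ : X → ℝ} (hφm : Measurable φ)
    (h0 : ∀ x, 0 ≤ φ x) (h1 : ∀ x, φ x ≤ 1) :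
    IsMild b φ fun t x => (minimalSol b (fun x => ENNReal.ofReal (φ x)) (max t 0) x).toReal where
  measurable := by
    have e : Measurable fun z : ℝ × X => (max z.1 0, z.2) := by fun_prop
    have h3 := (measurable_minimalSol (b := b) hφm.ennreal_ofReal).comp e
    exact h3.ennreal_toReal
  nonneg _ _ := ENNReal.toReal_nonneg
  le_one t x := ENNReal.toReal_mono ENNReal.one_ne_top
    (minimalSol_le_one (fun x => by simpa using h1 x) (le_max_right _ _) x)
  eq t ht x := by
    set p := minimalSol b fun x => ENNReal.ofReal (φ x) with hp
    have hp1 : ∀ s, 0 ≤ s → ∀ y, p s y ≤ 1 := fun s hs y =>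
      minimalSol_le_one (fun x => by simpa using h1 x) hs y
    have hpm : Measurable (Function.uncurry p) := measurable_minimalSol hφm.ennreal_ofReal
    have hle := lintegral_exp_mul_PhiE_le (b := b) (r := p) ht x
    rw [max_eq_left ht, hp, minimalSol_eq_picard hb hφm.ennreal_ofReal
      (fun x => by simpa using h1 x), ← hp, picard, ENNReal.toReal_add
      (ENNReal.mul_ne_top ENNReal.ofReal_ne_top ENNReal.ofReal_ne_top)
      (ne_top_of_le_ne_top ENNReal.ofReal_ne_top hle), ENNReal.toReal_mul,
      ENNReal.toReal_ofReal (Real.exp_pos _).le, ENNReal.toReal_ofReal (h0 x)]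
    congr 1
    have hP : Measurable fun s : ℝ => PhiE b (p s) x :=
      (measurable_PhiE hpm).comp measurable_prodMk_right
    have hPe : Measurable fun s : ℝ => ENNReal.ofReal (Real.exp (-(t - s))) * PhiE b (p s) x :=
      (by fun_prop : Measurable fun s : ℝ => ENNReal.ofReal (Real.exp (-(t - s)))).mul hP
    rw [intervalIntegral.integral_of_le ht, ← integral_toReal hPe.aemeasurable
      (ae_of_all _ fun s => (ENNReal.mul_ne_top ENNReal.ofReal_ne_top
        (ne_top_of_le_ne_top ENNReal.one_ne_top (PhiE_le_one _ _))).lt_top)]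
    refine setIntegral_congr_fun measurableSet_Ioc fun s hs => ?_
    have hps : Measurable (p s) := hpm.comp measurable_prodMk_left
    rw [ENNReal.toReal_mul, ENNReal.toReal_ofReal (Real.exp_pos _).le, max_eq_left hs.1.le,
      Phi_eq_toReal hb hps.ennreal_toReal (fun _ => ENNReal.toReal_nonneg)
        (fun y => ENNReal.toReal_mono ENNReal.one_ne_top (hp1 s hs.1.le y))]
    congr 3
    funext y
    exact (ENNReal.ofReal_toReal
      (ne_top_of_le_ne_top ENNReal.one_ne_top (hp1 s hs.1.le y))).symm

open Classical in
/-- The configuration consisting of one particle. -/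
def single (ψ : X → ℝ) (x : X) : Tempered ψ where
  toConfiguration :=
    { mult := fun y => if y = x then 1 else 0
      finite_inter := fun K _ => (Set.finite_singleton x).subset (by
        rintro y ⟨_, hy⟩
        by_contra h
        exact hy (if_neg h)) }
  isTempered := by
    refine summable_of_ne_finset_zero (s := {x}) fun y hy => ?_
    have : y ≠ x := by simpa using hy
    simp [this]

lemma wsum_single (g : X →ᵇ ℝ) (x : X) : wsum g (single ψ x) = g x * ψ x := by
  unfold wsum
  rw [tsum_eq_single x]
  · simp [single]
  · intro y hy
    simp [single, hy]

/-- The initial values `e^{-gψ}`. -/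
def expTest (ψ : X → ℝ) (g : Test X) (x : X) : ℝ := Real.exp (-(g.1 x * ψ x))

lemma expTest_pos (g : Test X) (x : X) : 0 < expTest ψ g x := Real.exp_pos _

lemma expTest_le_one (hψ : ∀ x, 0 < ψ x) (g : Test X) (x : X) : expTest ψ g x ≤ 1 :=
  Real.exp_le_one_iff.2 (neg_nonpos.2 (mul_nonneg (g.nonneg x) (hψ x).le))

lemma continuous_expTest (hψc : Continuous ψ) (g : Test X) : Continuous (expTest ψ g) :=
  (g.1.continuous.mul hψc).neg.rexp

lemma isLap_expTest (x : X) : IsLap ψ (fun g => ENNReal.ofReal (expTest ψ g x)) :=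
  (IsLap.expW (single ψ x)).congr fun g => by rw [expW, wsum_single, expTest]

/-- A Picard step respects the order of the representing measures: particles wait for an exponential
time, then branch, and the offspring evolve independently. -/
lemma LapLE.picard (hψc : Continuous ψ) (hψ : ∀ x, 0 < ψ x) (hb : Admissible b ψ)
    {r r' : Test X → ℝ → X → ℝ≥0∞} (hr : ∀ g, Measurable (Function.uncurry (r g)))
    (hr' : ∀ g, Measurable (Function.uncurry (r' g)))
    (hr1 : ∀ g t x, 0 ≤ t → r g t x ≤ 1) (hr1' : ∀ g t x, 0 ≤ t → r' g t x ≤ 1)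
    (h : ∀ t x, 0 ≤ t → LapLE ψ (fun g => r g t x) (fun g => r' g t x)) {t : ℝ} (ht : 0 ≤ t)
    (x : X) :
    LapLE ψ (fun g => picard b (fun x => ENNReal.ofReal (expTest ψ g x)) (r g) t x)
      (fun g => picard b (fun x => ENNReal.ofReal (expTest ψ g x)) (r' g) t x) := by
  have hP : ∀ s, 0 ≤ s → LapLE ψ (fun g => PhiE b (r g s) x) (fun g => PhiE b (r' g s) x) := by
    intro s hs
    refine LapLE.lintegral hψ (ρ := fun ξ g => Branching.prodE (r g s) ξ)
      (ρ' := fun ξ g => Branching.prodE (r' g s) ξ) ?_ (fun g => ?_) (fun g => ?_) ?_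
    · filter_upwards [hb.finite_cloud x] with ξ hξ
      exact LapLE.prodE hψc hψ (p := fun y g => r g s y) (p' := fun y g => r' g s y)
        (fun y => h s y hs) (fun y g => hr1 g s y hs) (fun y g => hr1' g s y hs) hξ
    · exact measurable_prodE_right ((hr g).comp measurable_prodMk_left)
    · exact measurable_prodE_right ((hr' g).comp measurable_prodMk_left)
    · exact ne_top_of_le_ne_top ENNReal.one_ne_top (PhiE_le_one (b := b) (r' 0 s) x)
  have hm : ∀ {r : Test X → ℝ → X → ℝ≥0∞}, (∀ g, Measurable (Function.uncurry (r g))) →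
      ∀ g, Measurable fun s : ℝ => ENNReal.ofReal (Real.exp (-(t - s))) * PhiE b (r g s) x := by
    intro r hr g
    have hP : Measurable fun s : ℝ => PhiE b (r g s) x :=
      (measurable_PhiE (hr g)).comp measurable_prodMk_right
    exact (by fun_prop : Measurable fun s : ℝ => ENNReal.ofReal (Real.exp (-(t - s)))).mul hP
  refine LapLE.add_left ?_ ((isLap_expTest x).const_mul ENNReal.ofReal_ne_top)
  refine LapLE.lintegral hψ
    (ρ := fun s g => ENNReal.ofReal (Real.exp (-(t - s))) * PhiE b (r g s) x)
    (ρ' := fun s g => ENNReal.ofReal (Real.exp (-(t - s))) * PhiE b (r' g s) x)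
    ?_ (hm hr) (hm hr') ?_
  · filter_upwards [ae_restrict_mem measurableSet_Ioc] with s hs
    exact (hP s hs.1.le).const_mul ENNReal.ofReal_ne_top
  · exact ne_top_of_le_ne_top ENNReal.ofReal_ne_top (lintegral_exp_mul_PhiE_le ht x)

lemma lapLE_picardIter (hψc : Continuous ψ) (hψ : ∀ x, 0 < ψ x) (hb : Admissible b ψ) (k : ℕ) :
    ∀ (t : ℝ) (x : X), 0 ≤ t →
      LapLE ψ (fun g => picardIter b (fun x => ENNReal.ofReal (expTest ψ g x)) k t x)
        (fun g => picardIter b (fun x => ENNReal.ofReal (expTest ψ g x)) (k + 1) t x) := by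
  have hm : ∀ g : Test X, Measurable fun x => ENNReal.ofReal (expTest ψ g x) := fun g =>
    (continuous_expTest hψc g).measurable.ennreal_ofReal
  have h1 : ∀ (g : Test X) x, ENNReal.ofReal (expTest ψ g x) ≤ 1 := fun g x => by
    simpa using expTest_le_one hψ g x
  induction k with
  | zero =>
    intro t x ht
    have := LapLE.picard hψc hψ hb (r := fun _ _ _ => 0) (r' := fun _ _ _ => 0)
      (fun g => measurable_const) (fun g => measurable_const) (fun _ _ _ _ => zero_le_one)
      (fun _ _ _ _ => zero_le_one) (fun _ _ _ => LapLE.refl IsLap.zero) ht x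
    exact ⟨IsLap.zero, _, this.1, fun g => (zero_add _).symm⟩
  | succ k ih =>
    intro t x ht
    exact LapLE.picard hψc hψ hb (fun g => measurable_picardIter (hm g) k)
      (fun g => measurable_picardIter (hm g) (k + 1))
      (fun g t x ht => picardIter_le_one (h1 g) k ht x)
      (fun g t x ht => picardIter_le_one (h1 g) (k + 1) ht x) ih ht x

/-- The solution with initial value `e^{-gψ}`. -/
def flow (b : Kernel X (Configuration X)) (ψ : X → ℝ) (g : Test X) (t : ℝ) (x : X) : ℝ :=
  (minimalSol b (fun x => ENNReal.ofReal (expTest ψ g x)) (max t 0) x).toReal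

lemma isMild_flow (hψc : Continuous ψ) (hψ : ∀ x, 0 < ψ x) (hb : Admissible b ψ) (g : Test X) :
    IsMild b (expTest ψ g) (flow b ψ g) :=
  isMild_minimalSol hb (continuous_expTest hψc g).measurable (fun x => (expTest_pos g x).le)
    (expTest_le_one hψ g)

lemma isLap_flow (hψc : Continuous ψ) (hψ : ∀ x, 0 < ψ x) (hb : Admissible b ψ) {t : ℝ}
    (ht : 0 ≤ t) (x : X) : IsLap ψ (fun g => ENNReal.ofReal (flow b ψ g t x)) := by
  have h1 : ∀ (g : Test X) x, ENNReal.ofReal (expTest ψ g x) ≤ 1 := fun g x => by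
    simpa using expTest_le_one hψ g x
  refine (IsLap.iSup (fun k => lapLE_picardIter hψc hψ hb k t x ht) ?_).congr fun g => ?_
  · exact ne_top_of_le_ne_top ENNReal.one_ne_top (minimalSol_le_one (b := b) (h1 0) ht x)
  · rw [flow, max_eq_left ht, ENNReal.ofReal_toReal]
    · rfl
    · exact ne_top_of_le_ne_top ENNReal.one_ne_top (minimalSol_le_one (b := b) (h1 g) ht x)

lemma expTest_zero (x : X) : expTest ψ (0 : Test X) x = 1 := by
  change Real.exp (-((0 : X →ᵇ ℝ) x * ψ x)) = 1
  simp

/-- There is no loss of mass, since `1` is a solution and solutions are unique. -/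
lemma flow_zero (hψc : Continuous ψ) (hψ : ∀ x, 0 < ψ x) (hb : Admissible b ψ) {t : ℝ}
    (ht : 0 ≤ t) (x : X) : flow b ψ 0 t x = 1 := by
  have h1 : IsMild b (expTest ψ 0) (fun _ _ => 1) :=
    { measurable := measurable_const
      nonneg := fun _ _ => zero_le_one
      le_one := fun _ _ => le_rfl
      eq := fun t _ x => by
        simp_rw [Phi_one hb, mul_one, integral_exp_neg_sub, expTest_zero]
        ring }
  exact (isMild_flow hψc hψ hb 0).unique hb h1 ht x

lemma continuous_toConfiguration (hψc : Continuous ψ) (hψ : ∀ x, 0 < ψ x) :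
    Continuous (Tempered.toConfiguration (ψ := ψ)) := by
  refine continuous_iInf_rng.2 fun h => continuous_induced_rng.2 ?_
  let k : X →ᵇ ℝ := bcfOfCompactSupport (fun x => h x / ψ x)
    (h.continuous.div hψc fun x => (hψ x).ne')
    (h.hasCompactSupport.mono fun x hx => by
      simp only [Function.mem_support, ne_eq, div_eq_zero_iff, not_or] at hx
      exact hx.1)
  refine (continuous_wsum (ψ := ψ) k).congr fun γ => ?_
  refine tsum_congr fun x => ?_
  change _ * (h x / ψ x * ψ x) = _
  rw [div_mul_cancel₀ _ (hψ x).ne']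

lemma measurable_prodE_tempered (hψc : Continuous ψ) (hψ : ∀ x, 0 < ψ x) {p : X → ℝ≥0∞}
    (hp : Measurable p) : Measurable fun γ : Tempered ψ => prodE p γ.toConfiguration := by
  have h3 := (measurable_prodE_right hp).comp (continuous_toConfiguration hψc hψ).measurable
  exact h3

lemma one_sub_expTest_le (g : Test X) (x : X) : 1 - expTest ψ g x ≤ g.1 x * ψ x := by
  have := Real.add_one_le_exp (-(g.1 x * ψ x))
  unfold expTest
  linarith

/-- The law at time `t` of the branching process with a random initial configuration. -/
lemma exists_transition (hψc : Continuous ψ) (hψ : ∀ x, 0 < ψ x) (hb : Admissible b ψ)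
    (μ₀ : Measure (Tempered ψ)) [IsProbabilityMeasure μ₀] {t : ℝ} (ht : 0 ≤ t) :
    ∃ ν : Measure (Tempered ψ), IsProbabilityMeasure ν ∧ ∀ g, lap ν g =
      ∫⁻ γ, prodE (fun x => ENNReal.ofReal (flow b ψ g t x)) γ.toConfiguration ∂μ₀ := by
  let one : Test X := ⟨1, fun _ => zero_le_one⟩
  have hγ : ∀ γ : Tempered ψ, IsLap ψ fun g =>
      prodE (fun x => ENNReal.ofReal (flow b ψ g t x)) γ.toConfiguration := fun γ => by
    obtain ⟨ν, hν, h⟩ := exists_lap_eq_prodE hψc hψ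
      (p := fun x g => ENNReal.ofReal (flow b ψ g t x)) (isLap_flow hψc hψ hb ht)
      (fun x => by rw [flow_zero hψc hψ hb ht, ENNReal.ofReal_one]) ENNReal.one_ne_top
      (fun x => by
        have h1 := (isMild_flow hψc hψ hb one).one_sub_le hb hψ (M := 1) le_rfl
          (by simpa [one] using one_sub_expTest_le (ψ := ψ) one x) ht
        rw [one_mul] at h1 ⊢
        rw [← ENNReal.ofReal_one, ← ENNReal.ofReal_sub _ ((isMild_flow hψc hψ hb _).nonneg t x)]
        exact ENNReal.ofReal_le_ofReal h1) γ
    exact ⟨ν, inferInstance, h⟩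
  have h0 : ∫⁻ γ : Tempered ψ,
      prodE (fun x => ENNReal.ofReal (flow b ψ 0 t x)) γ.toConfiguration ∂μ₀ = 1 := by
    simp_rw [flow_zero hψc hψ hb ht]
    simp [prodE, pair]
  obtain ⟨ν, hν, h⟩ := IsLap.lintegral hψ (κ := μ₀)
    (ρ := fun γ g => prodE (fun x => ENNReal.ofReal (flow b ψ g t x)) γ.toConfiguration)
    (ae_of_all _ hγ) (fun g => measurable_prodE_tempered hψc hψ
      ((isMild_flow hψc hψ hb g).measurable_apply t).ennreal_ofReal) (by rw [h0]; simp)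
  exact ⟨ν, ⟨by rw [← lap_zero, h]; exact h0⟩, h⟩

end Construction

/-! ### Elementary inequalities -/

lemma abs_exp_sub_one_sub_le (u : ℝ) : |Real.exp u - 1 - u| ≤ u ^ 2 * (1 + Real.exp u) := by
  have h1 := Real.add_one_le_exp u
  have h2 := Real.add_one_le_exp (-u)
  have h3 : Real.exp u * Real.exp (-u) = 1 := by rw [← Real.exp_add]; simp
  have hp := Real.exp_pos u
  have h4 : Real.exp u - 1 ≤ u * Real.exp u := by nlinarith
  rw [abs_of_nonneg (by linarith)]
  rcases le_total 0 u with hu | hu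
  · nlinarith
  · nlinarith [mul_nonneg (neg_nonneg.2 hu) hp.le]

lemma log_sub_log_bounds {a x δ : ℝ} (hδ : 0 < δ) (ha : δ ≤ a) (hx : δ ≤ x) :
    |Real.log x - Real.log a| ≤ |x - a| / δ ∧
      |Real.log x - Real.log a - (x - a) / a| ≤ (x - a) ^ 2 / δ ^ 2 := by
  have ha0 : 0 < a := hδ.trans_le ha
  have hx0 : 0 < x := hδ.trans_le hx
  have h1 : Real.log x - Real.log a ≤ (x - a) / a := by
    rw [← Real.log_div hx0.ne' ha0.ne']
    have := Real.log_le_sub_one_of_pos (div_pos hx0 ha0)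
    rwa [sub_div, div_self ha0.ne']
  have h2 : (x - a) / x ≤ Real.log x - Real.log a := by
    have := Real.log_le_sub_one_of_pos (div_pos ha0 hx0)
    rw [Real.log_div ha0.ne' hx0.ne'] at this
    rw [sub_div, div_self hx0.ne']
    linarith
  have h3 : ∀ y, δ ≤ y → |(x - a) / y| ≤ |x - a| / δ := fun y hy => by
    rw [abs_div, abs_of_pos (hδ.trans_le hy)]
    gcongr
  constructor
  · rw [abs_le]
    exact ⟨(neg_le_neg (h3 x hx)).trans ((neg_abs_le _).trans h2),
      h1.trans ((le_abs_self _).trans (h3 a ha))⟩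
  · have h4 : (x - a) / a - (x - a) / x ≤ (x - a) ^ 2 / δ ^ 2 := by
      have : (x - a) / a - (x - a) / x = (x - a) ^ 2 / (a * x) := by
        field_simp
      rw [this]
      have : δ ^ 2 ≤ a * x := by nlinarith
      gcongr
    rw [abs_le]
    constructor <;> linarith [div_nonneg (sq_nonneg (x - a)) (sq_nonneg δ)]

lemma mul_exp_neg_mul_le {c S : ℝ} (hc : 0 < c) : S * Real.exp (-(c * S)) ≤ 1 / c := by
  have h1 := Real.add_one_le_exp (c * S)
  have h3 : Real.exp (c * S) * Real.exp (-(c * S)) = 1 := by rw [← Real.exp_add]; simp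
  rw [le_div_iff₀ hc]
  nlinarith [Real.exp_pos (-(c * S))]

lemma sq_mul_exp_neg_mul_le {c S : ℝ} (hc : 0 < c) (hS : 0 ≤ S) :
    S ^ 2 * Real.exp (-(c * S)) ≤ 4 / c ^ 2 := by
  have h := mul_exp_neg_mul_le (c := c / 2) (S := S) (by positivity)
  have h0 : 0 ≤ S * Real.exp (-(c / 2 * S)) := mul_nonneg hS (Real.exp_pos _).le
  have e : Real.exp (-(c * S)) = Real.exp (-(c / 2 * S)) ^ 2 := by
    rw [← Real.exp_nat_mul]; congr 1; push_cast; ring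
  rw [e, ← mul_pow]
  calc (S * Real.exp (-(c / 2 * S))) ^ 2 ≤ (1 / (c / 2)) ^ 2 := by gcongr
    _ = 4 / c ^ 2 := by field_simp; norm_num

/-! ### The functions `F^φ` and the action of `L` on them -/

section SumOver

variable {X : Type*} [TopologicalSpace X] {ψ : X → ℝ}

/-- The sum `∑_{x ∈ γ} u(x)`. -/
def sumOver (u : X → ℝ) (γ : Tempered ψ) : ℝ := ∑' x, (γ.toConfiguration.mult x : ℝ) * u x

lemma sumOver_self_nonneg (hψ : ∀ x, 0 < ψ x) (γ : Tempered ψ) : 0 ≤ sumOver ψ γ :=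
  tsum_nonneg fun x => mul_nonneg (by positivity) (hψ x).le

lemma abs_sumOver_le {u : X → ℝ} {C : ℝ} (hu : ∀ x, |u x| ≤ C * ψ x) (γ : Tempered ψ) :
    |sumOver u γ| ≤ C * sumOver ψ γ := by
  rw [sumOver, sumOver, ← tsum_mul_left, ← Real.norm_eq_abs]
  refine tsum_of_norm_bounded (γ.isTempered.mul_left C).hasSum fun x => ?_
  rw [Real.norm_eq_abs, abs_mul, Nat.abs_cast]
  calc (γ.toConfiguration.mult x : ℝ) * |u x| ≤ γ.toConfiguration.mult x * (C * ψ x) := by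
        gcongr; exact hu x
    _ = _ := by ring

lemma sumOver_sub {u v : X → ℝ} {C D : ℝ} (hu : ∀ x, |u x| ≤ C * ψ x) (hv : ∀ x, |v x| ≤ D * ψ x)
    (γ : Tempered ψ) : sumOver (fun x => u x - v x) γ = sumOver u γ - sumOver v γ := by
  rw [sumOver, sumOver, sumOver, ← (γ.summable hu).tsum_sub (γ.summable hv)]
  exact tsum_congr fun x => by ring

lemma sumOver_mul_left (h : ℝ) (u : X → ℝ) (γ : Tempered ψ) :
    sumOver (fun x => h * u x) γ = h * sumOver u γ := by
  rw [sumOver, sumOver, ← tsum_mul_left]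
  exact tsum_congr fun x => by ring

lemma sumOver_mono {u v : X → ℝ} {C D : ℝ} (hu : ∀ x, |u x| ≤ C * ψ x)
    (hv : ∀ x, |v x| ≤ D * ψ x) (h : ∀ x, u x ≤ v x) (γ : Tempered ψ) :
    sumOver u γ ≤ sumOver v γ :=
  (γ.summable hu).tsum_le_tsum (fun x => by have := h x; gcongr) (γ.summable hv)

lemma continuous_sumOver (hψc : Continuous ψ) (hψ : ∀ x, 0 < ψ x) {u : X → ℝ} (hc : Continuous u)
    {C : ℝ} (hu : ∀ x, |u x| ≤ C * ψ x) : Continuous (sumOver (ψ := ψ) u) := by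
  let k : X →ᵇ ℝ := BoundedContinuousFunction.ofNormedAddCommGroup (fun x => u x / ψ x)
    (hc.div hψc fun x => (hψ x).ne') C fun x => by
      rw [Real.norm_eq_abs, abs_div, abs_of_pos (hψ x), div_le_iff₀ (hψ x)]
      exact hu x
  refine (continuous_wsum (ψ := ψ) k).congr fun γ => tsum_congr fun x => ?_
  change _ * (u x / ψ x * ψ x) = _
  rw [div_mul_cancel₀ _ (hψ x).ne']

lemma Fphi_eq_exp {φ : X → ℝ} (h0 : ∀ x, 0 < φ x) {C : ℝ} (hφ : ∀ x, |Real.log (φ x)| ≤ C * ψ x)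
    (γ : Tempered ψ) : Fphi ψ φ γ = Real.exp (sumOver (fun x => Real.log (φ x)) γ) := by
  have h := (γ.summable hφ).hasSum.rexp
  refine Eq.trans (tprod_congr fun x => ?_) h.tprod_eq
  rw [Function.comp, Real.exp_nat_mul, Real.exp_log (h0 x)]

lemma Fphi_expTest (hψ : ∀ x, 0 < ψ x) (g : Test X) (γ : Tempered ψ) :
    Fphi ψ (expTest ψ g) γ = Real.exp (-wsum g.1 γ) := by
  have h := (γ.summable_wsum hψ g.1).hasSum.neg.rexp
  refine Eq.trans (tprod_congr fun x => ?_) h.tprod_eq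
  rw [expTest, Function.comp, ← Real.exp_nat_mul]
  congr 1; ring

lemma prodE_expTest (hψ : ∀ x, 0 < ψ x) (g : Test X) (γ : Tempered ψ) :
    prodE (fun x => ENNReal.ofReal (expTest ψ g x)) γ.toConfiguration = expW g γ := by
  rw [expW_eq_expNeg hψ, prodE]
  congr 2
  funext x
  rw [expTest, negLog_ofReal (Real.exp_pos _), Real.log_exp, neg_neg]

end SumOver

section Generator

variable {X : Type*} [TopologicalSpace X] [PolishSpace X] [LocallyCompactSpace X]
  [MeasurableSpace X] [BorelSpace X] {ψ : X → ℝ} {b : Kernel X (Configuration X)}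
  [IsMarkovKernel b]

/-- The elements `φ` of `C_ψ(X)` for which `c` can be taken for the constant `c_φ`. -/
structure CpsiWith (b : Kernel X (Configuration X)) (ψ : X → ℝ) (c : ℝ) (φ : X → ℝ) : Prop where
  continuous : Continuous φ
  le : ∀ x, φ x ≤ 1 - c * ψ x
  deathProb_le : ∀ x, deathProb b x ≤ φ x

/-- A lower bound `δ_*` for the death probability, with `ψ ≤ 1 - δ_*`. -/
def deathBound (hb : Admissible b ψ) : ℝ := hb.deathProb_ge.choose

lemma deathBound_pos (hb : Admissible b ψ) : 0 < deathBound hb := hb.deathProb_ge.choose_spec.1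

lemma one_sub_le_deathProb (hb : Admissible b ψ) (x : X) : 1 - ψ x ≤ deathProb b x :=
  (hb.deathProb_ge.choose_spec.2 x).1

lemma deathBound_le (hb : Admissible b ψ) (x : X) : deathBound hb ≤ 1 - ψ x :=
  (hb.deathProb_ge.choose_spec.2 x).2

namespace CpsiWith

variable {c : ℝ} {φ : X → ℝ}

lemma one_sub_le (h : CpsiWith b ψ c φ) (hb : Admissible b ψ) (x : X) : 1 - ψ x ≤ φ x :=
  (one_sub_le_deathProb hb x).trans (h.deathProb_le x)

lemma ge (h : CpsiWith b ψ c φ) (hb : Admissible b ψ) (x : X) : deathBound hb ≤ φ x :=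
  (deathBound_le hb x).trans (h.one_sub_le hb x)

lemma pos (h : CpsiWith b ψ c φ) (hb : Admissible b ψ) (x : X) : 0 < φ x :=
  (deathBound_pos hb).trans_le (h.ge hb x)

lemma le_one (h : CpsiWith b ψ c φ) (hψ : ∀ x, 0 < ψ x) (hc : 0 < c) (x : X) : φ x ≤ 1 := by
  have := h.le x
  have := mul_pos hc (hψ x)
  linarith

lemma mono (h : CpsiWith b ψ c φ) (hψ : ∀ x, 0 < ψ x) {c' : ℝ} (hc : c' ≤ c) :
    CpsiWith b ψ c' φ where
  continuous := h.continuous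
  deathProb_le := h.deathProb_le
  le x := (h.le x).trans (by have := hψ x; gcongr)

lemma exists_test (h : CpsiWith b ψ c φ) (hψc : Continuous ψ) (hψ : ∀ x, 0 < ψ x)
    (hb : Admissible b ψ) (hc : 0 < c) : ∃ g : Test X, φ = expTest ψ g := by
  obtain ⟨g, hg⟩ := exists_test_eq_exp hψc hψ hb h.continuous (h.one_sub_le hb) (h.le_one hψ hc)
  exact ⟨g, funext hg⟩

/-- The class `C_ψ(X)` is preserved by the evolution. -/
lemma evolve (h : CpsiWith b ψ c φ) (hψc : Continuous ψ) (hψ : ∀ x, 0 < ψ x)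
    (hb : Admissible b ψ) (hc : 0 < c) {q : ℝ → X → ℝ} (hq : IsMild b φ q) {t : ℝ} (ht : 0 ≤ t) :
    CpsiWith b ψ (Real.exp (-t) * c) (q t) where
  continuous := hq.continuous hb hψc hψ h.continuous (h.one_sub_le hb) (h.le_one hψ hc) ht
  deathProb_le x := hq.deathProb_le hb (h.deathProb_le x) ht
  le x := (hq.le hb ht).trans (by nlinarith [h.le x, Real.exp_pos (-t)])

lemma abs_log_le (h : CpsiWith b ψ c φ) (hψ : ∀ x, 0 < ψ x) (hb : Admissible b ψ) (hc : 0 < c)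
    (x : X) : |Real.log (φ x)| ≤ 1 / deathBound hb * ψ x := by
  have h1 : deathBound hb ≤ 1 := by linarith [deathBound_le hb x, hψ x]
  have := (log_sub_log_bounds (deathBound_pos hb) h1 (h.ge hb x)).1
  rw [Real.log_one, sub_zero] at this
  refine this.trans ?_
  have hd := deathBound_pos hb
  rw [one_div_mul_eq_div]
  gcongr
  rw [abs_le]
  constructor <;> linarith [h.one_sub_le hb x, h.le_one hψ hc x, hψ x]

lemma log_le (h : CpsiWith b ψ c φ) (hb : Admissible b ψ) (x : X) :
    Real.log (φ x) ≤ -c * ψ x := by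
  have := Real.log_le_sub_one_of_pos (h.pos hb x)
  linarith [h.le x]

lemma Fphi_eq (h : CpsiWith b ψ c φ) (hψ : ∀ x, 0 < ψ x) (hb : Admissible b ψ) (hc : 0 < c)
    (γ : Tempered ψ) : Fphi ψ φ γ = Real.exp (sumOver (fun x => Real.log (φ x)) γ) :=
  Fphi_eq_exp (h.pos hb) (h.abs_log_le hψ hb hc) γ

lemma Fphi_le (h : CpsiWith b ψ c φ) (hψ : ∀ x, 0 < ψ x) (hb : Admissible b ψ) (hc : 0 < c)
    (γ : Tempered ψ) : Fphi ψ φ γ ≤ Real.exp (-(c * sumOver ψ γ)) := by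
  rw [h.Fphi_eq hψ hb hc, Real.exp_le_exp, ← neg_mul, ← sumOver_mul_left]
  refine sumOver_mono (h.abs_log_le hψ hb hc) (D := c) (fun x => ?_) (h.log_le hb) γ
  rw [abs_mul, abs_neg, abs_of_pos hc, abs_of_pos (hψ x)]

lemma Fphi_pos (h : CpsiWith b ψ c φ) (hψ : ∀ x, 0 < ψ x) (hb : Admissible b ψ) (hc : 0 < c)
    (γ : Tempered ψ) : 0 < Fphi ψ φ γ := by
  rw [h.Fphi_eq hψ hb hc]; exact Real.exp_pos _

lemma Fphi_le_one (h : CpsiWith b ψ c φ) (hψ : ∀ x, 0 < ψ x) (hb : Admissible b ψ) (hc : 0 < c)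
    (γ : Tempered ψ) : Fphi ψ φ γ ≤ 1 :=
  (h.Fphi_le hψ hb hc γ).trans (Real.exp_le_one_iff.2
    (neg_nonpos.2 (mul_nonneg hc.le (sumOver_self_nonneg hψ γ))))

lemma continuous_Fphi (h : CpsiWith b ψ c φ) (hψc : Continuous ψ) (hψ : ∀ x, 0 < ψ x)
    (hb : Admissible b ψ) (hc : 0 < c) : Continuous (Fphi ψ φ) :=
  ((continuous_sumOver hψc hψ (h.continuous.log fun x => (h.pos hb x).ne')
    (h.abs_log_le hψ hb hc)).rexp).congr fun γ => (h.Fphi_eq hψ hb hc γ).symm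

lemma abs_Phi_sub_le (h : CpsiWith b ψ c φ) (hψ : ∀ x, 0 < ψ x) (hb : Admissible b ψ)
    (hc : 0 < c) (x : X) : |Phi b φ x - φ x| ≤ ψ x := by
  have h0 := fun x => (h.pos hb x).le
  have h1 := h.le_one hψ hc
  have hm := h.continuous.measurable
  rw [abs_le]
  constructor <;> linarith [one_sub_le_Phi hb hm h0 h1 x, Phi_le_one hb hm h0 h1 x,
    h.one_sub_le hb x, h1 x]

lemma abs_rate_le (h : CpsiWith b ψ c φ) (hψ : ∀ x, 0 < ψ x) (hb : Admissible b ψ)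
    (hc : 0 < c) (x : X) : |(Phi b φ x - φ x) / φ x| ≤ 1 / deathBound hb * ψ x := by
  have hd := deathBound_pos hb
  rw [abs_div, abs_of_pos (h.pos hb x), one_div_mul_eq_div]
  gcongr
  · exact (hψ x).le
  · exact h.abs_Phi_sub_le hψ hb hc x
  · exact h.ge hb x

end CpsiWith

/-- The value of `LF^φ`: the rate of change of `log F^φ` along the branching mechanism, times
`F^φ`. -/
def genFphi (b : Kernel X (Configuration X)) (ψ : X → ℝ) (φ : X → ℝ) (γ : Tempered ψ) : ℝ :=
  sumOver (fun x => (Phi b φ x - φ x) / φ x) γ * Fphi ψ φ γ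

lemma CpsiWith.continuous_genFphi {c : ℝ} {φ : X → ℝ} (h : CpsiWith b ψ c φ) (hψc : Continuous ψ)
    (hψ : ∀ x, 0 < ψ x) (hb : Admissible b ψ) (hc : 0 < c) : Continuous (genFphi b ψ φ) := by
  refine (continuous_sumOver hψc hψ ?_ (h.abs_rate_le hψ hb hc)).mul (h.continuous_Fphi hψc hψ hb hc)
  exact ((continuous_Phi hψc hψ hb h.continuous (h.one_sub_le hb) (h.le_one hψ hc)).sub
    h.continuous).div h.continuous fun x => (h.pos hb x).ne'

lemma CpsiWith.abs_genFphi_le {c : ℝ} {φ : X → ℝ} (h : CpsiWith b ψ c φ)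
    (hψ : ∀ x, 0 < ψ x) (hb : Admissible b ψ) (hc : 0 < c) (γ : Tempered ψ) :
    |genFphi b ψ φ γ| ≤ 1 / deathBound hb * (1 / c) := by
  have hd := deathBound_pos hb
  have hS := sumOver_self_nonneg hψ γ
  rw [genFphi, abs_mul, abs_of_pos (h.Fphi_pos hψ hb hc γ)]
  calc _ ≤ (1 / deathBound hb * sumOver ψ γ) * Real.exp (-(c * sumOver ψ γ)) := by
        gcongr
        · exact (h.Fphi_pos hψ hb hc γ).le
        · exact abs_sumOver_le (h.abs_rate_le hψ hb hc) γ
        · exact h.Fphi_le hψ hb hc γ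
    _ = 1 / deathBound hb * (sumOver ψ γ * Real.exp (-(c * sumOver ψ γ))) := by ring
    _ ≤ _ := by gcongr; exact mul_exp_neg_mul_le hc

section ShortTime

variable {c : ℝ} {φ : X → ℝ} {q : ℝ → X → ℝ}

lemma IsMild.abs_sub_le (hq : IsMild b φ q) (h : CpsiWith b ψ c φ) (hψ : ∀ x, 0 < ψ x)
    (hb : Admissible b ψ) (hc : 0 < c) {s : ℝ} (hs : 0 ≤ s) (x : X) :
    |q s x - φ x| ≤ s * ψ x := by
  have e : q s x - φ x = ∫ r in (0 : ℝ)..s, Real.exp (-(s - r)) * (Phi b (q r) x - φ x) := by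
    simp_rw [mul_sub]
    rw [intervalIntegral.integral_sub (hq.intervalIntegrable hb x s 0 s)
      (Continuous.intervalIntegrable (by fun_prop) _ _), intervalIntegral.integral_mul_const,
      integral_exp_neg_sub, hq.eq s hs]
    ring
  rw [e]
  refine (abs_integral_exp_mul_le (B := fun _ => ψ x) continuous_const hs fun r _ => ?_).trans
    (by simp)
  have hm := hq.measurable_apply r
  rw [abs_le]
  constructor <;> linarith [one_sub_le_Phi hb hm (hq.nonneg r) (hq.le_one r) x,
    Phi_le_one hb hm (hq.nonneg r) (hq.le_one r) x, h.one_sub_le hb x, h.le_one hψ hc x]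

/-- The evolution equation is differentiable at time `0`, with a remainder of order `h² ψ`. -/
lemma exists_abs_mild_sub_le (hψ : ∀ x, 0 < ψ x) (hb : Admissible b ψ) :
    ∃ N : ℝ, 0 ≤ N ∧ ∀ (c : ℝ) (φ : X → ℝ) (q : ℝ → X → ℝ), 0 < c → CpsiWith b ψ c φ →
      IsMild b φ q → ∀ h, 0 ≤ h → h ≤ 1 → ∀ x,
        |q h x - φ x - h * (Phi b φ x - φ x)| ≤ N * h ^ 2 * ψ x := by
  obtain ⟨N, hN, H⟩ := exists_abs_Phi_sub_le_mul hb hψ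
  refine ⟨N + 1, by positivity, fun c φ q hc hφ hq h h0 h1 x => ?_⟩
  have e : q h x - φ x - h * (Phi b φ x - φ x) =
      (∫ r in (0 : ℝ)..h, Real.exp (-(h - r)) * (Phi b (q r) x - Phi b φ x)) +
        (Phi b φ x - φ x) * (1 - Real.exp (-h) - h) := by
    simp_rw [mul_sub]
    rw [intervalIntegral.integral_sub (hq.intervalIntegrable hb x h 0 h)
      (Continuous.intervalIntegrable (by fun_prop) _ _), intervalIntegral.integral_mul_const,
      integral_exp_neg_sub, hq.eq h h0]
    ring
  have h2 : |∫ r in (0 : ℝ)..h, Real.exp (-(h - r)) * (Phi b (q r) x - Phi b φ x)| ≤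
      N * h ^ 2 * ψ x := by
    refine (abs_integral_exp_mul_le (B := fun _ => N * h * ψ x) continuous_const h0
      fun r hr => ?_).trans (le_of_eq (by simp; ring))
    refine (H (q r) φ (hq.measurable_apply r) hφ.continuous.measurable (hq.nonneg r) (hq.le_one r)
      (fun x => (hφ.pos hb x).le) (hφ.le_one hψ hc) r hr.1
      (hq.abs_sub_le hφ hψ hb hc hr.1) x).trans ?_
    have := hψ x
    have := hr.2
    gcongr
  have h3 : |(Phi b φ x - φ x) * (1 - Real.exp (-h) - h)| ≤ ψ x * h ^ 2 := by
    have h5 := Real.abs_exp_sub_one_sub_id_le (x := -h) (by rwa [abs_neg, abs_of_nonneg h0])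
    rw [abs_mul]
    refine mul_le_mul (hφ.abs_Phi_sub_le hψ hb hc x) ?_ (abs_nonneg _) (hψ x).le
    rw [show 1 - Real.exp (-h) - h = -(Real.exp (-h) - 1 - -h) by ring, abs_neg]
    simpa using h5
  rw [e]
  refine (abs_add_le _ _).trans ((add_le_add h2 h3).trans (le_of_eq (by ring)))

/-- The differential form of the duality between the evolution equation and the operator `L`. The
remainder is uniform on `Γ^ψ`, because polynomials in `∑ ψ` are controlled by `F^φ`. -/
lemma exists_abs_Fphi_sub_le (hψc : Continuous ψ) (hψ : ∀ x, 0 < ψ x) (hb : Admissible b ψ)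
    {c : ℝ} (hc : 0 < c) :
    ∃ K : ℝ, 0 ≤ K ∧ ∀ (φ : X → ℝ) (q : ℝ → X → ℝ), CpsiWith b ψ c φ → IsMild b φ q →
      ∀ h, 0 ≤ h → h ≤ 1 → ∀ γ : Tempered ψ,
        |Fphi ψ (q h) γ - Fphi ψ φ γ - h * genFphi b ψ φ γ| ≤ K * h ^ 2 := by
  obtain ⟨N, hN, H⟩ := exists_abs_mild_sub_le (b := b) hψ hb
  have hd := deathBound_pos hb
  set δ := deathBound hb with hδ
  -- `c'` is a constant for all the functions `q h`, `0 ≤ h ≤ 1`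
  set c' := Real.exp (-1) * c with hc'
  have hc0 : 0 < c' := by positivity
  have hcc : c' ≤ c := mul_le_of_le_one_left hc.le (Real.exp_le_one_iff.2 (by norm_num))
  set A := 1 / δ ^ 2 + N / δ with hA
  refine ⟨2 * (1 / δ) ^ 2 * (4 / c' ^ 2) + A * (1 / c'), by positivity,
    fun φ q hφ hq h h0 h1 γ => ?_⟩
  have hφ' := hφ.mono hψ hcc
  have hqh : CpsiWith b ψ c' (q h) := (hφ.evolve hψc hψ hb hc hq h0).mono hψ (by
    rw [hc']; gcongr)
  have hψ1 : ∀ x, ψ x ≤ 1 := fun x => by linarith [deathBound_le hb x]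
  let u : X → ℝ := fun x => Real.log (q h x) - Real.log (φ x)
  let v : X → ℝ := fun x => (Phi b φ x - φ x) / φ x
  have hlog : ∀ x, |u x| ≤ (h * (1 / δ)) * ψ x ∧ |u x - h * v x| ≤ A * h ^ 2 * ψ x := fun x => by
    obtain ⟨l1, l2⟩ := log_sub_log_bounds hd (hφ.ge hb x) (hqh.ge hb x)
    have l3 := hq.abs_sub_le hφ hψ hb hc h0 x
    have hx := hψ x
    constructor
    · refine l1.trans ?_
      calc |q h x - φ x| / δ ≤ h * ψ x / δ := by gcongr
        _ = _ := by ring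
    · have e : u x - h * v x = (u x - (q h x - φ x) / φ x) +
          (q h x - φ x - h * (Phi b φ x - φ x)) / φ x := by
        simp only [v]; ring
      have l4 : |(q h x - φ x - h * (Phi b φ x - φ x)) / φ x| ≤ N * h ^ 2 * ψ x / δ := by
        rw [abs_div, abs_of_pos (hφ.pos hb x)]
        gcongr
        · exact H c φ q hc hφ hq h h0 h1 x
        · exact hφ.ge hb x
      have l5 : (q h x - φ x) ^ 2 / δ ^ 2 ≤ h ^ 2 * ψ x / δ ^ 2 := by
        gcongr
        rw [← sq_abs]
        calc |q h x - φ x| ^ 2 ≤ (h * ψ x) ^ 2 := by gcongr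
          _ = h ^ 2 * ψ x * ψ x := by ring
          _ ≤ h ^ 2 * ψ x * 1 := by gcongr; exact hψ1 x
          _ = _ := mul_one _
      rw [e]
      refine (abs_add_le _ _).trans ((add_le_add (l2.trans l5) l4).trans (le_of_eq ?_))
      rw [hA]; ring
  set S := sumOver ψ γ with hS
  have hS0 : 0 ≤ S := sumOver_self_nonneg hψ γ
  set U := sumOver u γ with hU
  set V := sumOver v γ with hV
  have hvb : ∀ x, |h * v x| ≤ (h * (1 / δ)) * ψ x := fun x => by
    rw [abs_mul, abs_of_nonneg h0, mul_assoc]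
    gcongr
    exact hφ.abs_rate_le hψ hb hc x
  have hUb : |U| ≤ h * (1 / δ) * S := abs_sumOver_le (fun x => (hlog x).1) γ
  have hUV : |U - h * V| ≤ A * h ^ 2 * S := by
    rw [hV, ← sumOver_mul_left, hU, ← sumOver_sub (fun x => (hlog x).1) hvb]
    exact abs_sumOver_le (fun x => (hlog x).2) γ
  set F := Fphi ψ φ γ with hF
  have hF0 : 0 < F := hφ.Fphi_pos hψ hb hc γ
  have hFq : Fphi ψ (q h) γ = F * Real.exp U := by
    rw [hF, hφ.Fphi_eq hψ hb hc, hqh.Fphi_eq hψ hb hc0, ← Real.exp_add, hU,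
      sumOver_sub (hqh.abs_log_le hψ hb hc0) (hφ.abs_log_le hψ hb hc)]
    congr 1; ring
  have hE1 : F ≤ Real.exp (-(c' * S)) := hφ'.Fphi_le hψ hb hc0 γ
  have hE2 : F * Real.exp U ≤ Real.exp (-(c' * S)) := hFq ▸ hqh.Fphi_le hψ hb hc0 γ
  -- here `|U| ≤ h S / δ` and `|U - h V| ≤ A h² S`, while `F` and `F e^U` are at most `e^{-c' S}`
  have e : Fphi ψ (q h) γ - F - h * genFphi b ψ φ γ =
      F * (Real.exp U - 1 - U) + F * (U - h * V) := by
    rw [hFq, genFphi]; ring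
  rw [e]
  refine (abs_add_le _ _).trans ?_
  rw [abs_mul, abs_mul, abs_of_pos hF0]
  have b1 : F * |Real.exp U - 1 - U| ≤ 2 * (1 / δ) ^ 2 * (4 / c' ^ 2) * h ^ 2 := by
    calc F * |Real.exp U - 1 - U| ≤ F * (U ^ 2 * (1 + Real.exp U)) := by
          gcongr; exact abs_exp_sub_one_sub_le U
      _ = |U| ^ 2 * (F + F * Real.exp U) := by rw [sq_abs]; ring
      _ ≤ (h * (1 / δ) * S) ^ 2 * (Real.exp (-(c' * S)) + Real.exp (-(c' * S))) := by gcongr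
      _ = 2 * (1 / δ) ^ 2 * h ^ 2 * (S ^ 2 * Real.exp (-(c' * S))) := by ring
      _ ≤ 2 * (1 / δ) ^ 2 * h ^ 2 * (4 / c' ^ 2) := by
          gcongr; exact sq_mul_exp_neg_mul_le hc0 hS0
      _ = _ := by ring
  have b2 : F * |U - h * V| ≤ A * (1 / c') * h ^ 2 := by
    have hA0 : 0 ≤ A := by positivity
    calc F * |U - h * V| ≤ Real.exp (-(c' * S)) * (A * h ^ 2 * S) := by gcongr
      _ = A * h ^ 2 * (S * Real.exp (-(c' * S))) := by ring
      _ ≤ A * h ^ 2 * (1 / c') := by gcongr; exact mul_exp_neg_mul_le hc0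
      _ = _ := by ring
  linarith

end ShortTime

end Generator

section Kolmogorov

variable {X : Type*} [TopologicalSpace X] {ψ : X → ℝ}

lemma Configuration.IsFinite.isTempered {ξ : Configuration X} (h : ξ.IsFinite) (ψ : X → ℝ) :
    ξ.IsTempered ψ :=
  summable_of_hasFiniteSupport (h.subset fun x hx h0 => hx (by simp [h0]))

lemma mult_erase_add {γ ξ : Configuration X} {x : X} (hx : γ.mult x ≠ 0) (y : X) :
    ((γ.erase x + ξ).mult y : ℝ) =
      γ.mult y + ξ.mult y - (single ψ x).toConfiguration.mult y := by
  rw [add_mult, Nat.cast_add]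
  by_cases h : y = x
  · subst h
    have h1 : (γ.erase y).mult y = γ.mult y - 1 := if_pos rfl
    have h2 : (single ψ y).toConfiguration.mult y = 1 := if_pos rfl
    rw [h1, h2, Nat.cast_sub (Nat.one_le_iff_ne_zero.2 hx)]
    push_cast; ring
  · have h1 : (γ.erase x).mult y = γ.mult y := if_neg h
    have h2 : (single ψ x).toConfiguration.mult y = 0 := if_neg h
    rw [h1, h2]
    push_cast; ring

lemma isTempered_erase_add (γ : Tempered ψ) {ξ : Configuration X} (hξ : ξ.IsFinite) {x : X}
    (hx : γ.toConfiguration.mult x ≠ 0) : (γ.toConfiguration.erase x + ξ).IsTempered ψ := by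
  refine (((γ.isTempered).add (hξ.isTempered ψ)).sub (single ψ x).isTempered).congr fun y => ?_
  rw [mult_erase_add (ψ := ψ) hx]
  ring

lemma sumOver_single (u : X → ℝ) (x : X) : sumOver u (single ψ x) = u x := by
  unfold sumOver
  rw [tsum_eq_single x]
  · simp [single]
  · intro y hy
    simp [single, hy]

lemma sumOver_erase_add (γ : Tempered ψ) {ξ : Configuration X} (hξ : ξ.IsFinite) {x : X}
    (hx : γ.toConfiguration.mult x ≠ 0) {u : X → ℝ} {C : ℝ} (hu : ∀ x, |u x| ≤ C * ψ x) :
    sumOver u ⟨_, isTempered_erase_add γ hξ hx⟩ =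
      sumOver u γ + sumOver u ⟨ξ, hξ.isTempered ψ⟩ - u x := by
  have h1 := γ.summable hu
  have h2 := (Tempered.mk (ψ := ψ) ξ (hξ.isTempered ψ)).summable hu
  have h3 := (single ψ x).summable hu
  rw [← sumOver_single (ψ := ψ) u x, sumOver, sumOver, sumOver, sumOver, ← h1.tsum_add h2,
    ← (h1.add h2).tsum_sub h3]
  refine tsum_congr fun y => ?_
  rw [mult_erase_add (ψ := ψ) hx]
  ring

end Kolmogorov

section KolmogorovSpan

variable {X : Type*} [TopologicalSpace X] [PolishSpace X] [LocallyCompactSpace X]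
  [MeasurableSpace X] [BorelSpace X] {ψ : X → ℝ} {b : Kernel X (Configuration X)}
  [IsMarkovKernel b] {c : ℝ} {φ : X → ℝ}

lemma CpsiWith.extend_Fphi (h : CpsiWith b ψ c φ) (hψ : ∀ x, 0 < ψ x) (hb : Admissible b ψ)
    (hc : 0 < c) (γ : Tempered ψ) {ξ : Configuration X} (hξ : ξ.IsFinite) {x : X}
    (hx : γ.toConfiguration.mult x ≠ 0) :
    Tempered.extend (Fphi ψ φ) (γ.toConfiguration.erase x + ξ) =
      Fphi ψ φ γ / φ x * ξ.prodOver φ := by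
  have hl := h.abs_log_le hψ hb hc
  have hξ' : ξ.prodOver φ = Fphi ψ φ ⟨ξ, hξ.isTempered ψ⟩ := rfl
  rw [Tempered.extend, dif_pos (isTempered_erase_add γ hξ hx), hξ', h.Fphi_eq hψ hb hc,
    h.Fphi_eq hψ hb hc, h.Fphi_eq hψ hb hc, sumOver_erase_add γ hξ hx hl, Real.exp_sub,
    Real.exp_add, Real.exp_log (h.pos hb x)]
  ring

lemma CpsiWith.integrable_extend (h : CpsiWith b ψ c φ) (hψ : ∀ x, 0 < ψ x) (hb : Admissible b ψ)
    (hc : 0 < c) (γ : Tempered ψ) {x : X} (hx : γ.toConfiguration.mult x ≠ 0) :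
    Integrable (fun ξ => Tempered.extend (Fphi ψ φ) (γ.toConfiguration.erase x + ξ)) (b x) := by
  refine ((integrable_prodOver hb h.continuous.measurable (fun x => (h.pos hb x).le)
    (h.le_one hψ hc) x).const_mul (Fphi ψ φ γ / φ x)).congr ?_
  filter_upwards [hb.finite_cloud x] with ξ hξ
  rw [h.extend_Fphi hψ hb hc γ hξ hx]

lemma CpsiWith.mult_mul_integral (h : CpsiWith b ψ c φ) (hψ : ∀ x, 0 < ψ x) (hb : Admissible b ψ)
    (hc : 0 < c) (γ : Tempered ψ) (x : X) :
    (γ.toConfiguration.mult x : ℝ) *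
      ∫ ξ, (Tempered.extend (Fphi ψ φ) (γ.toConfiguration.erase x + ξ) - Fphi ψ φ γ) ∂(b x) =
    (γ.toConfiguration.mult x : ℝ) * ((Phi b φ x - φ x) / φ x) * Fphi ψ φ γ := by
  by_cases hx : γ.toConfiguration.mult x = 0
  · simp [hx]
  have e : ∫ ξ, Tempered.extend (Fphi ψ φ) (γ.toConfiguration.erase x + ξ) ∂(b x) =
      Fphi ψ φ γ / φ x * Phi b φ x := by
    rw [Phi, ← integral_const_mul]
    refine integral_congr_ae ?_
    filter_upwards [hb.finite_cloud x] with ξ hξ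
    rw [h.extend_Fphi hψ hb hc γ hξ hx]
  rw [integral_sub (h.integrable_extend hψ hb hc γ hx) (integrable_const _), e]
  have := (h.pos hb x).ne'
  simp
  field_simp

/-- The pairs `(F^φ, LF^φ)`, `φ ∈ C_ψ(X)`. -/
def genPairs (b : Kernel X (Configuration X)) (ψ : X → ℝ) :
    Set ((Tempered ψ →ᵇ ℝ) × (Tempered ψ →ᵇ ℝ)) :=
  {p | ∃ (c : ℝ) (φ : X → ℝ), 0 < c ∧ CpsiWith b ψ c φ ∧ (∀ γ, p.1 γ = Fphi ψ φ γ) ∧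
    ∀ γ, p.2 γ = genFphi b ψ φ γ}

lemma exists_cpsiWith {φ : X →ᵇ ℝ} (h : φ ∈ Cpsi b ψ) : ∃ c, 0 < c ∧ CpsiWith b ψ c φ := by
  obtain ⟨c, hc, h⟩ := h
  exact ⟨c, hc, φ.continuous, fun x => by linarith [(h x).1], fun x => by linarith [(h x).2]⟩

lemma CpsiWith.exists_mem_genPairs (h : CpsiWith b ψ c φ) (hψc : Continuous ψ)
    (hψ : ∀ x, 0 < ψ x) (hb : Admissible b ψ) (hc : 0 < c) :
    ∃ F G : Tempered ψ →ᵇ ℝ, (F, G) ∈ genPairs b ψ ∧ (∀ γ, F γ = Fphi ψ φ γ) ∧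
      ∀ γ, G γ = genFphi b ψ φ γ := by
  refine ⟨BoundedContinuousFunction.ofNormedAddCommGroup _ (h.continuous_Fphi hψc hψ hb hc) 1
    fun γ => ?_, BoundedContinuousFunction.ofNormedAddCommGroup _
      (h.continuous_genFphi hψc hψ hb hc) _ (h.abs_genFphi_le hψ hb hc),
      ⟨c, φ, hc, h, fun _ => rfl, fun _ => rfl⟩, fun _ => rfl, fun _ => rfl⟩
  rw [Real.norm_of_nonneg (h.Fphi_pos hψ hb hc γ).le]
  exact h.Fphi_le_one hψ hb hc γ

lemma exists_mem_E0 (hψc : Continuous ψ) (hψ : ∀ x, 0 < ψ x) (hb : Admissible b ψ) {φ : X →ᵇ ℝ}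
    (hφ : φ ∈ Cpsi b ψ) : ∃ F ∈ E0 b ψ, ∀ γ, F γ = Fphi ψ φ γ := by
  obtain ⟨c, hc, h⟩ := exists_cpsiWith hφ
  obtain ⟨F, G, -, hF, -⟩ := h.exists_mem_genPairs hψc hψ hb hc
  exact ⟨F, Submodule.subset_span ⟨φ, hφ, hF⟩, hF⟩

/-- On `E⁰`, the operator `L` is given by convergent sums and integrals, hence it is linear. -/
lemma exists_mem_span_genPairs (hψc : Continuous ψ) (hψ : ∀ x, 0 < ψ x) (hb : Admissible b ψ)
    {F : Tempered ψ →ᵇ ℝ} (hF : F ∈ E0 b ψ) :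
    (∀ (γ : Tempered ψ) (x : X), γ.toConfiguration.mult x ≠ 0 →
      Integrable (fun ξ => Tempered.extend F (γ.toConfiguration.erase x + ξ)) (b x)) ∧
    (∀ γ : Tempered ψ, Summable fun x => (γ.toConfiguration.mult x : ℝ) *
      ∫ ξ, (Tempered.extend F (γ.toConfiguration.erase x + ξ) - F γ) ∂(b x)) ∧
    ∃ G, (F, G) ∈ Submodule.span ℝ (genPairs b ψ) ∧ ∀ γ, G γ = kolmogorov b F γ := by
  induction hF using Submodule.span_induction with
  | mem F hF =>
    obtain ⟨φ, hφ, hF⟩ := hF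
    obtain ⟨c, hc, h⟩ := exists_cpsiWith hφ
    obtain ⟨F', G, hm, hF', hG⟩ := h.exists_mem_genPairs hψc hψ hb hc
    obtain rfl : F' = F := by ext γ; rw [hF, hF']
    have e : (F' : Tempered ψ → ℝ) = Fphi ψ φ := funext hF
    rw [e]
    refine ⟨fun γ x hx => h.integrable_extend hψ hb hc γ hx, fun γ => ?_, G,
      Submodule.subset_span hm, fun γ => ?_⟩
    · simp_rw [h.mult_mul_integral hψ hb hc γ]
      exact (γ.summable (h.abs_rate_le hψ hb hc)).mul_right _
    · rw [hG, kolmogorov, genFphi, sumOver]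
      simp_rw [h.mult_mul_integral hψ hb hc γ, tsum_mul_right]
  | zero =>
    have e : ∀ ξ, Tempered.extend (0 : Tempered ψ → ℝ) ξ = 0 := fun ξ => by
      simp [Tempered.extend]
    rw [BoundedContinuousFunction.coe_zero]
    refine ⟨fun γ x _ => by simp [e], fun γ => by simp [e, summable_zero], 0,
      Submodule.zero_mem _, fun γ => by simp [kolmogorov, e]⟩
  | add F F' _ _ hF hF' =>
    obtain ⟨i1, s1, G, m1, h1⟩ := hF
    obtain ⟨i2, s2, G', m2, h2⟩ := hF'
    have e : ∀ ξ, Tempered.extend (F + F') ξ = Tempered.extend F ξ + Tempered.extend F' ξ :=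
      fun ξ => by
        unfold Tempered.extend
        split_ifs <;> simp
    have key : ∀ (γ : Tempered ψ) (x : X), (γ.toConfiguration.mult x : ℝ) *
        ∫ ξ, (Tempered.extend (F + F') (γ.toConfiguration.erase x + ξ) - (F + F') γ) ∂(b x) =
        (γ.toConfiguration.mult x : ℝ) *
          ∫ ξ, (Tempered.extend F (γ.toConfiguration.erase x + ξ) - F γ) ∂(b x) +
        (γ.toConfiguration.mult x : ℝ) *
          ∫ ξ, (Tempered.extend F' (γ.toConfiguration.erase x + ξ) - F' γ) ∂(b x) :=
      fun γ x => by
        by_cases hx : γ.toConfiguration.mult x = 0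
        · simp [hx]
        have j1 : Integrable (fun ξ =>
            Tempered.extend F (γ.toConfiguration.erase x + ξ) - F γ) (b x) :=
          (i1 γ x hx).sub (integrable_const _)
        have j2 : Integrable (fun ξ =>
            Tempered.extend F' (γ.toConfiguration.erase x + ξ) - F' γ) (b x) :=
          (i2 γ x hx).sub (integrable_const _)
        rw [← mul_add, ← integral_add j1 j2]
        congr 1
        refine integral_congr_ae (ae_of_all _ fun ξ => ?_)
        simp only [e, BoundedContinuousFunction.add_apply]
        ring
    refine ⟨fun γ x hx => ?_, fun γ => ?_, G + G', Submodule.add_mem _ m1 m2, fun γ => ?_⟩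
    · simp_rw [e]
      exact (i1 γ x hx).add (i2 γ x hx)
    · simp_rw [key]
      exact (s1 γ).add (s2 γ)
    · rw [kolmogorov]
      simp_rw [key]
      rw [(s1 γ).tsum_add (s2 γ), BoundedContinuousFunction.add_apply, h1, h2]
      rfl
  | smul a F _ hF =>
    obtain ⟨i1, s1, G, m1, h1⟩ := hF
    have e : ∀ ξ, Tempered.extend (a • F) ξ = a * Tempered.extend F ξ :=
      fun ξ => by
        unfold Tempered.extend
        split_ifs <;> simp
    have key : ∀ (γ : Tempered ψ) (x : X), (γ.toConfiguration.mult x : ℝ) *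
        ∫ ξ, (Tempered.extend (a • F) (γ.toConfiguration.erase x + ξ) - (a • F) γ) ∂(b x) =
        a * ((γ.toConfiguration.mult x : ℝ) *
          ∫ ξ, (Tempered.extend F (γ.toConfiguration.erase x + ξ) - F γ) ∂(b x)) :=
      fun γ x => by
        rw [mul_left_comm, ← integral_const_mul a]
        congr 1
        refine integral_congr_ae (ae_of_all _ fun ξ => ?_)
        simp only [e, BoundedContinuousFunction.smul_apply, smul_eq_mul]
        ring
    refine ⟨fun γ x hx => ?_, fun γ => ?_, a • G, Submodule.smul_mem _ a m1, fun γ => ?_⟩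
    · simp_rw [e]
      exact (i1 γ x hx).const_mul a
    · simp_rw [key]
      exact (s1 γ).mul_left a
    · rw [kolmogorov]
      simp_rw [key]
      rw [tsum_mul_left, BoundedContinuousFunction.smul_apply, smul_eq_mul, h1]
      rfl

lemma preGraph_subset_span (hψc : Continuous ψ) (hψ : ∀ x, 0 < ψ x) (hb : Admissible b ψ) :
    preGraph b ψ ⊆ Submodule.span ℝ (genPairs b ψ) := by
  rintro ⟨F, G⟩ ⟨hF, hG⟩
  obtain ⟨-, -, G', hm, hG'⟩ := exists_mem_span_genPairs hψc hψ hb hF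
  obtain rfl : G' = G := by ext γ; rw [hG, hG']
  exact hm

lemma genPairs_subset_preGraph (hψ : ∀ x, 0 < ψ x) (hb : Admissible b ψ) :
    genPairs b ψ ⊆ preGraph b ψ := by
  rintro ⟨F, G⟩ ⟨c, φ, hc, h, hF, hG⟩
  let f : X →ᵇ ℝ := BoundedContinuousFunction.ofNormedAddCommGroup φ h.continuous 1 fun x => by
    rw [Real.norm_of_nonneg (h.pos hb x).le]
    exact h.le_one hψ hc x
  refine ⟨Submodule.subset_span ⟨f, ⟨c, hc, fun x => ⟨?_, ?_⟩⟩, hF⟩, fun γ => ?_⟩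
  · change _ ≤ 1 - φ x
    linarith [h.le x]
  · change 1 - φ x ≤ _
    linarith [h.deathProb_le x]
  · have e : (F : Tempered ψ → ℝ) = Fphi ψ φ := funext hF
    change G γ = kolmogorov b F γ
    rw [e, hG, kolmogorov, genFphi, sumOver]
    simp_rw [h.mult_mul_integral hψ hb hc γ, tsum_mul_right]

end KolmogorovSpan

/-! ### Existence of a solution -/

section Existence

variable {X : Type*} [TopologicalSpace X] [PolishSpace X] [LocallyCompactSpace X]
  [MeasurableSpace X] [BorelSpace X] {ψ : X → ℝ} {b : Kernel X (Configuration X)}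
  [IsMarkovKernel b]

lemma abs_log_le_of_ge {η M p w : ℝ} (hη : 0 < η) (h0 : η ≤ p) (h1 : p ≤ 1)
    (h : 1 - p ≤ M * w) : |Real.log p| ≤ M / η * w := by
  have := (log_sub_log_bounds hη (h0.trans h1) h0).1
  rw [Real.log_one, sub_zero, abs_sub_comm, abs_of_nonneg (by linarith : 0 ≤ 1 - p)] at this
  calc |Real.log p| ≤ (1 - p) / η := this
    _ ≤ M * w / η := by gcongr
    _ = _ := by ring

lemma prodE_ofReal {p : X → ℝ} (h0 : ∀ x, 0 < p x) (h1 : ∀ x, p x ≤ 1) {C : ℝ}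
    (h : ∀ x, |Real.log (p x)| ≤ C * ψ x) (γ : Tempered ψ) :
    prodE (fun x => ENNReal.ofReal (p x)) γ.toConfiguration = ENNReal.ofReal (Fphi ψ p γ) := by
  have hn : ∀ x, 0 ≤ -Real.log (p x) := fun x => neg_nonneg.2 (Real.log_nonpos (h0 x).le (h1 x))
  have hn' : ∀ x, 0 ≤ (γ.toConfiguration.mult x : ℝ) * -Real.log (p x) := fun x =>
    mul_nonneg (by positivity) (hn x)
  have hs : Summable fun x => (γ.toConfiguration.mult x : ℝ) * -Real.log (p x) :=
    γ.summable (c := C) fun x => by rw [abs_neg]; exact h x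
  have e : pair (fun x => negLog (ENNReal.ofReal (p x))) γ.toConfiguration =
      ENNReal.ofReal (-sumOver (fun x => Real.log (p x)) γ) := by
    rw [sumOver, ← tsum_neg]
    simp_rw [← mul_neg]
    rw [ENNReal.ofReal_tsum_of_nonneg hn' hs]
    refine tsum_congr fun x => ?_
    beta_reduce
    rw [negLog_ofReal (h0 x), ENNReal.ofReal_mul (by positivity), ENNReal.ofReal_natCast]
  have hsum : 0 ≤ -sumOver (fun x => Real.log (p x)) γ := by
    rw [sumOver, ← tsum_neg]
    exact tsum_nonneg fun x => by rw [← mul_neg]; exact hn' x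
  rw [prodE, e, expNeg_ofReal hsum, neg_neg, Fphi_eq_exp h0 h]

/-- Dominated convergence for products over a configuration. -/
lemma tendsto_Fphi {ι : Type*} {L : Filter ι} {p : ι → X → ℝ} {p₀ : X → ℝ} {η M : ℝ} (hη : 0 < η)
    (h0 : ∀ᶠ i in L, ∀ x, η ≤ p i x) (h1 : ∀ᶠ i in L, ∀ x, p i x ≤ 1)
    (h : ∀ᶠ i in L, ∀ x, 1 - p i x ≤ M * ψ x) (h0' : ∀ x, η ≤ p₀ x) (h1' : ∀ x, p₀ x ≤ 1)
    (h' : ∀ x, 1 - p₀ x ≤ M * ψ x) (hlim : ∀ x, Tendsto (fun i => p i x) L (𝓝 (p₀ x)))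
    (γ : Tempered ψ) : Tendsto (fun i => Fphi ψ (p i) γ) L (𝓝 (Fphi ψ p₀ γ)) := by
  have hs : Tendsto (fun i => sumOver (fun x => Real.log (p i x)) γ) L
      (𝓝 (sumOver (fun x => Real.log (p₀ x)) γ)) := by
    refine tendsto_tsum_of_dominated_convergence (γ.isTempered.mul_left (M / η)) (fun x => ?_) ?_
    · exact ((hlim x).log (hη.trans_le (h0' x)).ne').const_mul _
    · filter_upwards [h0, h1, h] with i hi0 hi1 hi x
      rw [Real.norm_eq_abs, abs_mul, Nat.abs_cast]
      calc (γ.toConfiguration.mult x : ℝ) * |Real.log (p i x)| ≤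
            γ.toConfiguration.mult x * (M / η * ψ x) := by
            gcongr; exact abs_log_le_of_ge hη (hi0 x) (hi1 x) (hi x)
        _ = _ := by ring
  rw [Fphi_eq_exp (fun x => hη.trans_le (h0' x))
    fun x => abs_log_le_of_ge hη (h0' x) (h1' x) (h' x)]
  refine hs.rexp.congr' ?_
  filter_upwards [h0, h1, h] with i hi0 hi1 hi
  rw [Fphi_eq_exp (fun x => hη.trans_le (hi0 x))
    fun x => abs_log_le_of_ge hη (hi0 x) (hi1 x) (hi x)]

section Flow

variable (hψc : Continuous ψ) (hψ : ∀ x, 0 < ψ x) (hb : Admissible b ψ)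

include hψc hψ hb

lemma one_sub_flow_le (g : Test X) {t : ℝ} (ht : 0 ≤ t) (x : X) :
    1 - flow b ψ g t x ≤ max 1 ‖g.1‖ * ψ x := by
  refine (isMild_flow hψc hψ hb g).one_sub_le hb hψ (le_max_left _ _)
    ((one_sub_expTest_le g x).trans ?_) ht
  have := hψ x
  gcongr
  exact ((le_abs_self _).trans (g.1.norm_coe_le_norm x)).trans (le_max_right _ _)

lemma flow_ge (g : Test X) {t T : ℝ} (ht : 0 ≤ t) (hT : t ≤ T) (x : X) :
    Real.exp (-T) * Real.exp (-‖g.1‖) ≤ flow b ψ g t x := by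
  have hq := isMild_flow hψc hψ hb g
  have h := hq.ge hb (x := x) (c := 0) (fun s _ =>
    Phi_nonneg hb (hq.measurable_apply s) (hq.nonneg s) (hq.le_one s) x) ht
  rw [mul_zero, add_zero] at h
  refine le_trans ?_ h
  have h1 : ψ x ≤ 1 := by linarith [deathBound_le hb x, deathBound_pos hb]
  unfold expTest
  have h2 : g.1 x * ψ x ≤ ‖g.1‖ := by
    calc g.1 x * ψ x ≤ ‖g.1‖ * 1 := by
          have := (hψ x).le
          gcongr
          exact (le_abs_self _).trans (g.1.norm_coe_le_norm x)
      _ = _ := mul_one _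
  gcongr

lemma prodE_flow (g : Test X) {t : ℝ} (ht : 0 ≤ t) (γ : Tempered ψ) :
    prodE (fun x => ENNReal.ofReal (flow b ψ g t x)) γ.toConfiguration =
      ENNReal.ofReal (Fphi ψ (flow b ψ g t) γ) := by
  have h0 := flow_ge hψc hψ hb g ht le_rfl
  have h1 := (isMild_flow hψc hψ hb g).le_one t
  have hη : 0 < Real.exp (-t) * Real.exp (-‖g.1‖) := by positivity
  exact prodE_ofReal (fun x => hη.trans_le (h0 x)) h1
    (fun x => abs_log_le_of_ge hη (h0 x) (h1 x) (one_sub_flow_le hψc hψ hb g ht x)) γ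

lemma Fphi_flow_nonneg (g : Test X) {t : ℝ} (ht : 0 ≤ t) (γ : Tempered ψ) :
    0 ≤ Fphi ψ (flow b ψ g t) γ := by
  have h0 := flow_ge hψc hψ hb g ht le_rfl
  have h1 := (isMild_flow hψc hψ hb g).le_one t
  have hη : 0 < Real.exp (-t) * Real.exp (-‖g.1‖) := by positivity
  rw [Fphi_eq_exp (fun x => hη.trans_le (h0 x))
    (fun x => abs_log_le_of_ge hη (h0 x) (h1 x) (one_sub_flow_le hψc hψ hb g ht x))]
  exact (Real.exp_pos _).le

lemma Fphi_flow_eq_toReal (g : Test X) {t : ℝ} (ht : 0 ≤ t) (γ : Tempered ψ) :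
    Fphi ψ (flow b ψ g t) γ =
      (prodE (fun x => ENNReal.ofReal (flow b ψ g t x)) γ.toConfiguration).toReal := by
  rw [prodE_flow hψc hψ hb g ht, ENNReal.toReal_ofReal (Fphi_flow_nonneg hψc hψ hb g ht γ)]

lemma Fphi_flow_le_one (g : Test X) {t : ℝ} (ht : 0 ≤ t) (γ : Tempered ψ) :
    Fphi ψ (flow b ψ g t) γ ≤ 1 := by
  rw [Fphi_flow_eq_toReal hψc hψ hb g ht]
  exact ENNReal.toReal_mono ENNReal.one_ne_top (prodE_le_one _ _)

lemma measurable_Fphi_flow (g : Test X) {t : ℝ} (ht : 0 ≤ t) :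
    Measurable (Fphi ψ (flow b ψ g t)) := by
  have h := (measurable_prodE_tempered hψc hψ
    ((isMild_flow hψc hψ hb g).measurable_apply t).ennreal_ofReal).ennreal_toReal
  convert h using 1
  exact funext (Fphi_flow_eq_toReal hψc hψ hb g ht)

end Flow

/-- The law at time `t` of the branching process whose initial law is `μ₀`. -/
def evol (hψc : Continuous ψ) (hψ : ∀ x, 0 < ψ x) (hb : Admissible b ψ)
    (μ₀ : ProbabilityMeasure (Tempered ψ)) (t : ℝ≥0) : ProbabilityMeasure (Tempered ψ) :=
  ⟨(exists_transition hψc hψ hb (μ₀ : Measure (Tempered ψ)) t.coe_nonneg).choose,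
    (exists_transition hψc hψ hb (μ₀ : Measure (Tempered ψ)) t.coe_nonneg).choose_spec.1⟩

section Evol

variable (hψc : Continuous ψ) (hψ : ∀ x, 0 < ψ x) (hb : Admissible b ψ)
  (μ₀ : ProbabilityMeasure (Tempered ψ))

lemma lap_evol (t : ℝ≥0) (g : Test X) :
    lap (evol hψc hψ hb μ₀ t : Measure (Tempered ψ)) g =
      ∫⁻ γ, prodE (fun x => ENNReal.ofReal (flow b ψ g t x)) γ.toConfiguration
        ∂(μ₀ : Measure (Tempered ψ)) :=
  (exists_transition hψc hψ hb (μ₀ : Measure (Tempered ψ)) t.coe_nonneg).choose_spec.2 g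

lemma integral_exp_evol (t : ℝ≥0) (g : Test X) :
    ∫ γ, Real.exp (-wsum g.1 γ) ∂(evol hψc hψ hb μ₀ t : Measure (Tempered ψ)) =
      ∫ γ, Fphi ψ (flow b ψ g t) γ ∂(μ₀ : Measure (Tempered ψ)) := by
  rw [integral_exp_wsum, lap_evol, integral_eq_lintegral_of_nonneg_ae
    (ae_of_all _ (Fphi_flow_nonneg hψc hψ hb g t.coe_nonneg))
    (measurable_Fphi_flow hψc hψ hb g t.coe_nonneg).aestronglyMeasurable]
  simp_rw [prodE_flow hψc hψ hb g t.coe_nonneg]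

/-- Duality between the laws and the evolution equation. -/
lemma integral_Fphi_evol {c : ℝ} {φ : X → ℝ} (hc : 0 < c) (h : CpsiWith b ψ c φ)
    {q : ℝ → X → ℝ} (hq : IsMild b φ q) (t : ℝ≥0) :
    ∫ γ, Fphi ψ φ γ ∂(evol hψc hψ hb μ₀ t : Measure (Tempered ψ)) =
      ∫ γ, Fphi ψ (q t) γ ∂(μ₀ : Measure (Tempered ψ)) := by
  obtain ⟨g, rfl⟩ := h.exists_test hψc hψ hb hc
  simp_rw [Fphi_expTest hψ]
  have : q t = flow b ψ g t := funext fun x => hq.unique hb (isMild_flow hψc hψ hb g) t.coe_nonneg x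
  rw [integral_exp_evol, this]

lemma evol_zero : evol hψc hψ hb μ₀ 0 = μ₀ := by
  suffices h : (evol hψc hψ hb μ₀ 0 : Measure (Tempered ψ)) = μ₀ from Subtype.ext h
  refine eq_of_lap_eq hψ fun g => ?_
  refine (lap_evol hψc hψ hb μ₀ 0 g).trans (lintegral_congr fun γ => ?_)
  rw [← prodE_expTest hψ]
  congr 1
  funext x
  rw [NNReal.coe_zero, (isMild_flow hψc hψ hb g).zero]

lemma continuous_evol : Continuous (evol hψc hψ hb μ₀) := by
  refine continuous_iff_continuousAt.2 fun t₀ => tendsto_of_tendsto_lap hψ fun g => ?_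
  simp_rw [integral_exp_evol]
  have hq := isMild_flow hψc hψ hb g
  refine tendsto_integral_filter_of_dominated_convergence (fun _ => 1)
    (Eventually.of_forall fun t =>
      (measurable_Fphi_flow hψc hψ hb g t.coe_nonneg).aestronglyMeasurable)
    (Eventually.of_forall fun t => ae_of_all _ fun γ => ?_) (integrable_const _)
    (ae_of_all _ fun γ => ?_)
  · rw [Real.norm_of_nonneg (Fphi_flow_nonneg hψc hψ hb g t.coe_nonneg γ)]
    exact Fphi_flow_le_one hψc hψ hb g t.coe_nonneg γ
  · have hlt : ∀ᶠ t : ℝ≥0 in 𝓝 t₀, (t : ℝ) ≤ t₀ + 1 := by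
      filter_upwards [eventually_lt_nhds (lt_add_one t₀)] with t ht
      exact_mod_cast ht.le
    refine tendsto_Fphi (p := fun t : ℝ≥0 => flow b ψ g t)
      (η := Real.exp (-(t₀ + 1)) * Real.exp (-‖g.1‖)) (M := max 1 ‖g.1‖) (by positivity) ?_
      (Eventually.of_forall fun t : ℝ≥0 => hq.le_one t)
      (Eventually.of_forall fun t : ℝ≥0 => one_sub_flow_le hψc hψ hb g t.coe_nonneg)
      (flow_ge hψc hψ hb g t₀.coe_nonneg (by linarith)) (hq.le_one t₀)
      (one_sub_flow_le hψc hψ hb g t₀.coe_nonneg) (fun x => ?_) γ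
    · filter_upwards [hlt] with t ht
      exact flow_ge hψc hψ hb g t.coe_nonneg ht
    · have h1 := hq.continuousOn hb x
      have h2 : Continuous fun t : ℝ≥0 => flow b ψ g t x :=
        h1.comp_continuous NNReal.continuous_coe fun t => t.coe_nonneg
      exact h2.tendsto t₀

/-- In the subcritical case, the process dies out. -/
lemma tendsto_evol (hn : supMeanOffspring b < 1) :
    Tendsto (evol hψc hψ hb μ₀) atTop (𝓝 (diracProba (0 : Tempered ψ))) := by
  refine tendsto_of_tendsto_lap hψ fun g => ?_
  have hn' : (supMeanOffspring b).toReal < 1 := by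
    rw [← ENNReal.toReal_one]
    exact (ENNReal.toReal_lt_toReal hn.ne_top ENNReal.one_ne_top).2 hn
  have e : ∫ γ, Real.exp (-wsum g.1 γ) ∂(diracProba (0 : Tempered ψ) : Measure (Tempered ψ)) =
      ∫ _, (1 : ℝ) ∂(μ₀ : Measure (Tempered ψ)) := by
    change ∫ γ, Real.exp (-wsum g.1 γ) ∂(Measure.dirac (0 : Tempered ψ)) = _
    rw [integral_dirac' (fun γ : Tempered ψ => Real.exp (-wsum g.1 γ)) _
      (((continuous_wsum g.1).neg.rexp).stronglyMeasurable)]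
    have : ∀ x, (0 : Tempered ψ).toConfiguration.mult x = 0 := fun _ => rfl
    simp [wsum, this]
  rw [e]
  simp_rw [integral_exp_evol]
  have hq := isMild_flow hψc hψ hb g
  refine tendsto_integral_filter_of_dominated_convergence (fun _ => 1)
    (Eventually.of_forall fun t =>
      (measurable_Fphi_flow hψc hψ hb g t.coe_nonneg).aestronglyMeasurable)
    (Eventually.of_forall fun t => ae_of_all _ fun γ => ?_) (integrable_const _)
    (ae_of_all _ fun γ => ?_)
  · rw [Real.norm_of_nonneg (Fphi_flow_nonneg hψc hψ hb g t.coe_nonneg γ)]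
    exact Fphi_flow_le_one hψc hψ hb g t.coe_nonneg γ
  · have hlim : Tendsto (fun t : ℝ≥0 => Real.exp (((supMeanOffspring b).toReal - 1) * t)) atTop
        (𝓝 0) :=
      Real.tendsto_exp_atBot.comp (Tendsto.const_mul_atTop_of_neg (by linarith)
        (NNReal.tendsto_coe_atTop.2 tendsto_id))
    have hle : ∀ (t : ℝ≥0) x,
        1 - flow b ψ g t x ≤ Real.exp (((supMeanOffspring b).toReal - 1) * t) := fun t x =>
      hq.one_sub_le_exp hb (fun x => (expTest_pos g x).le) t.coe_nonneg x
    have hone : Fphi ψ (fun _ => 1) γ = 1 := by simp [Fphi, Configuration.prodOver]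
    rw [← hone]
    refine tendsto_Fphi (p := fun t : ℝ≥0 => flow b ψ g t) (η := 1 / 2) (M := max 1 ‖g.1‖)
      (by positivity) ?_ (Eventually.of_forall fun t : ℝ≥0 => hq.le_one t)
      (Eventually.of_forall fun t : ℝ≥0 => one_sub_flow_le hψc hψ hb g t.coe_nonneg) (by norm_num)
      (fun _ => le_rfl) (fun x => ?_) (fun x => ?_) γ
    · filter_upwards [hlim.eventually (eventually_lt_nhds (by norm_num : (0 : ℝ) < 1 / 2))]
        with t ht x
      linarith [hle t x]
    · rw [sub_self]
      have := hψ x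
      positivity
    · have h1 : Tendsto (fun t : ℝ≥0 => 1 - flow b ψ g t x) atTop (𝓝 0) :=
        squeeze_zero (fun t => by linarith [hq.le_one t x]) (fun t => hle t x) hlim
      have h2 := h1.const_sub 1
      simpa using h2

lemma measurable_integral_evol {F : Tempered ψ → ℝ} (hF : Measurable F) :
    Measurable fun t : ℝ≥0 => ∫ γ, F γ ∂(evol hψc hψ hb μ₀ t : Measure (Tempered ψ)) := by
  have hm : Measurable fun t : ℝ≥0 => (evol hψc hψ hb μ₀ t : Measure (Tempered ψ)) := by
    refine measurable_of_measurable_lap hψ fun g => ?_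
    have hc : Continuous fun t : ℝ≥0 =>
        ∫ γ, Real.exp (-wsum g.1 γ) ∂(evol hψc hψ hb μ₀ t : Measure (Tempered ψ)) := by
      have h0 : ∀ γ : Tempered ψ, ‖Real.exp (-wsum g.1 γ)‖ ≤ 1 := fun γ => by
        rw [Real.norm_of_nonneg (Real.exp_pos _).le]
        exact Real.exp_le_one_iff.2 (neg_nonpos.2 (wsum_nonneg hψ g.nonneg γ))
      let f : Tempered ψ →ᵇ ℝ := BoundedContinuousFunction.ofNormedAddCommGroup _
        ((continuous_wsum g.1).neg.rexp) 1 h0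
      exact (ProbabilityMeasure.continuous_integral_boundedContinuousFunction f).comp
        (continuous_evol hψc hψ hb μ₀)
    simp_rw [integral_exp_wsum] at hc
    convert hc.measurable.ennreal_ofReal using 2 with t
    refine (ENNReal.ofReal_toReal (ne_top_of_le_ne_top ENNReal.one_ne_top ?_)).symm
    calc lap _ g ≤ ∫⁻ _, 1 ∂(evol hψc hψ hb μ₀ t : Measure (Tempered ψ)) :=
          lintegral_mono fun γ => expW_le_one hψ g γ
      _ = 1 := by simp
  let κ : Kernel ℝ≥0 (Tempered ψ) := ⟨_, hm⟩
  have hκ : IsMarkovKernel κ := ⟨fun t => inferInstanceAs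
    (IsProbabilityMeasure (evol hψc hψ hb μ₀ t : Measure (Tempered ψ)))⟩
  exact (hF.stronglyMeasurable.integral_kernel (κ := κ)).measurable

end Evol

end Existence

/-! ### The Fokker-Planck equation -/

lemma hasDerivWithinAt_Ioi_of_abs_sub_le {f : ℝ → ℝ} {f' s K : ℝ}
    (h : ∀ u, 0 ≤ u → u ≤ 1 → |f (s + u) - f s - u * f'| ≤ K * u ^ 2) :
    HasDerivWithinAt f f' (Set.Ioi s) s := by
  have hK : 0 ≤ K := by
    have := (abs_nonneg _).trans (h 1 zero_le_one le_rfl)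
    linarith
  rw [hasDerivWithinAt_iff_isLittleO, Asymptotics.isLittleO_iff]
  intro ε hε
  have hpos : s < s + min 1 (ε / (K + 1)) := by
    have : 0 < min 1 (ε / (K + 1)) := by positivity
    linarith
  filter_upwards [Ioo_mem_nhdsGT hpos] with y hy
  have h0 : 0 < y - s := sub_pos.2 hy.1
  have h1 : y - s ≤ min 1 (ε / (K + 1)) := by linarith [hy.2]
  have h2 := h (y - s) h0.le (h1.trans (min_le_left _ _))
  rw [add_sub_cancel] at h2
  rw [Real.norm_eq_abs, Real.norm_eq_abs, abs_of_pos h0, smul_eq_mul]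
  refine h2.trans ?_
  have h3 : (K + 1) * (y - s) ≤ ε := by
    have := h1.trans (min_le_right _ _)
    rwa [le_div_iff₀ (by positivity), mul_comm] at this
  nlinarith

/-- A function on an interval that is Hölder continuous with an exponent above `1` is constant. -/
lemma eq_of_abs_sub_le_mul_sqrt {g : ℝ → ℝ} {t K : ℝ} (ht : 0 ≤ t)
    (h : ∀ s u, 0 ≤ s → 0 ≤ u → u ≤ 1 → s + u ≤ t → |g (s + u) - g s| ≤ K * (u * √u)) :
    g t = g 0 := by
  have key : ∀ᶠ n : ℕ in atTop, |g t - g 0| ≤ K * t * √(t / n) := by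
    filter_upwards [eventually_ge_atTop (⌈t⌉₊ + 1)] with n hn
    have hn1 : (1 : ℝ) ≤ n := by exact_mod_cast (Nat.le_add_left 1 _).trans hn
    have hn0 : (0 : ℝ) < n := by linarith
    have hnt : t ≤ n := (Nat.le_ceil t).trans (by exact_mod_cast (Nat.le_succ _).trans hn)
    have h1 := dist_le_range_sum_dist (fun i : ℕ => g (i * (t / n))) n
    have e : (n : ℝ) * (t / n) = t := by field_simp
    simp only [Nat.cast_zero, zero_mul, e] at h1
    rw [dist_comm, Real.dist_eq] at h1
    refine h1.trans ?_
    have h2 : ∀ i ∈ Finset.range n, dist (g (i * (t / n))) (g ((i + 1 : ℕ) * (t / n))) ≤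
        K * (t / n * √(t / n)) := fun i hi => by
      have hi' : ((i : ℝ) + 1) ≤ n := by exact_mod_cast Finset.mem_range.1 hi
      have e2 : ((i + 1 : ℕ) : ℝ) * (t / n) = i * (t / n) + t / n := by push_cast; ring
      rw [dist_comm, Real.dist_eq, e2]
      refine h _ _ (by positivity) (by positivity) ((div_le_one hn0).2 hnt) ?_
      calc (i : ℝ) * (t / n) + t / n = (i + 1) * (t / n) := by ring
        _ ≤ n * (t / n) := by gcongr
        _ = t := e
    refine (Finset.sum_le_card_nsmul _ _ _ h2).trans (le_of_eq ?_)
    rw [Finset.card_range, nsmul_eq_mul]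
    calc (n : ℝ) * (K * (t / n * √(t / n))) = K * (n * (t / n)) * √(t / n) := by ring
      _ = _ := by rw [e]
  have hlim : Tendsto (fun n : ℕ => K * t * √(t / n)) atTop (𝓝 (K * t * √0)) :=
    ((Real.continuous_sqrt.tendsto _).comp
      (tendsto_const_div_atTop_nhds_zero_nat t)).const_mul _
  rw [Real.sqrt_zero, mul_zero] at hlim
  exact sub_eq_zero.1 (abs_nonpos_iff.1 (ge_of_tendsto hlim key))

section FokkerPlanck

variable {X : Type*} [TopologicalSpace X] [PolishSpace X] [LocallyCompactSpace X]
  [MeasurableSpace X] [BorelSpace X] {ψ : X → ℝ} {b : Kernel X (Configuration X)}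
  [IsMarkovKernel b]

lemma abs_integral_le_of_abs_le (ν : ProbabilityMeasure (Tempered ψ)) {F : Tempered ψ → ℝ} {C : ℝ}
    (h : ∀ γ, |F γ| ≤ C) : |∫ γ, F γ ∂(ν : Measure (Tempered ψ))| ≤ C := by
  have := norm_integral_le_of_norm_le_const (μ := (ν : Measure (Tempered ψ)))
    (ae_of_all _ fun γ => (Real.norm_eq_abs _).le.trans (h γ))
  simpa using this

lemma dist_integral_le (ν : ProbabilityMeasure (Tempered ψ)) (F F' : Tempered ψ →ᵇ ℝ) :
    dist (∫ γ, F γ ∂(ν : Measure (Tempered ψ))) (∫ γ, F' γ ∂(ν : Measure (Tempered ψ))) ≤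
      dist F F' := by
  rw [Real.dist_eq, ← integral_sub (F.integrable _) (F'.integrable _)]
  exact abs_integral_le_of_abs_le ν fun γ => F.dist_coe_le_dist γ

lemma continuous_integral_toNNReal {μ : ℝ≥0 → ProbabilityMeasure (Tempered ψ)} (hμ : Continuous μ)
    (G : Tempered ψ →ᵇ ℝ) :
    Continuous fun s : ℝ => ∫ γ, G γ ∂(μ s.toNNReal : Measure (Tempered ψ)) :=
  (ProbabilityMeasure.continuous_integral_boundedContinuousFunction G).comp
    (hμ.comp continuous_real_toNNReal)

/-- It is sufficient to verify the Fokker-Planck equation on the functions `F^φ`. -/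
lemma equation_of_genPairs (hψc : Continuous ψ) (hψ : ∀ x, 0 < ψ x) (hb : Admissible b ψ)
    {μ₀ : ProbabilityMeasure (Tempered ψ)} {μ : ℝ≥0 → ProbabilityMeasure (Tempered ψ)}
    (hμ : Continuous μ)
    (h : ∀ p ∈ genPairs b ψ, ∀ t : ℝ≥0, ∫ γ, p.1 γ ∂(μ t : Measure (Tempered ψ)) =
      ∫ γ, p.1 γ ∂(μ₀ : Measure (Tempered ψ)) +
        ∫ s in (0 : ℝ)..t, ∫ γ, p.2 γ ∂(μ s.toNNReal : Measure (Tempered ψ))) :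
    ∀ p ∈ graphL b ψ, ∀ t : ℝ≥0, ∫ γ, p.1 γ ∂(μ t : Measure (Tempered ψ)) =
      ∫ γ, p.1 γ ∂(μ₀ : Measure (Tempered ψ)) +
        ∫ s in (0 : ℝ)..t, ∫ γ, p.2 γ ∂(μ s.toNNReal : Measure (Tempered ψ)) := by
  have hi : ∀ (G : Tempered ψ →ᵇ ℝ) (u v : ℝ), IntervalIntegrable
      (fun s : ℝ => ∫ γ, G γ ∂(μ s.toNNReal : Measure (Tempered ψ))) volume u v := fun G u v =>
    (continuous_integral_toNNReal hμ G).intervalIntegrable u v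
  let V : Submodule ℝ ((Tempered ψ →ᵇ ℝ) × (Tempered ψ →ᵇ ℝ)) :=
    { carrier := {p | ∀ t : ℝ≥0, ∫ γ, p.1 γ ∂(μ t : Measure (Tempered ψ)) =
        ∫ γ, p.1 γ ∂(μ₀ : Measure (Tempered ψ)) +
          ∫ s in (0 : ℝ)..t, ∫ γ, p.2 γ ∂(μ s.toNNReal : Measure (Tempered ψ))}
      add_mem' := fun {p p'} hp hp' t => by
        have h1 := hp t
        have h2 := hp' t
        simp only [Prod.fst_add, Prod.snd_add, BoundedContinuousFunction.add_apply]
        simp_rw [fun ν : ProbabilityMeasure (Tempered ψ) =>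
          integral_add (p.1.integrable (ν : Measure (Tempered ψ))) (p'.1.integrable _),
          fun ν : ProbabilityMeasure (Tempered ψ) =>
          integral_add (p.2.integrable (ν : Measure (Tempered ψ))) (p'.2.integrable _)]
        rw [intervalIntegral.integral_add (hi _ _ _) (hi _ _ _), h1, h2]
        ring
      zero_mem' := fun t => by simp
      smul_mem' := fun a p hp t => by
        have h1 := hp t
        simp only [Prod.smul_fst, Prod.smul_snd, BoundedContinuousFunction.smul_apply, smul_eq_mul]
        simp_rw [integral_const_mul]
        rw [intervalIntegral.integral_const_mul, h1]
        ring }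
  have hV : IsClosed (V : Set ((Tempered ψ →ᵇ ℝ) × (Tempered ψ →ᵇ ℝ))) := by
    have hc : ∀ ν : ProbabilityMeasure (Tempered ψ), Continuous fun F : Tempered ψ →ᵇ ℝ =>
        ∫ γ, F γ ∂(ν : Measure (Tempered ψ)) := fun ν =>
      (LipschitzWith.of_dist_le_mul (K := 1) fun F F' => by
        simpa using dist_integral_le ν F F').continuous
    have hc' : ∀ t : ℝ≥0, Continuous fun G : Tempered ψ →ᵇ ℝ =>
        ∫ s in (0 : ℝ)..t, ∫ γ, G γ ∂(μ s.toNNReal : Measure (Tempered ψ)) := fun t =>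
      (LipschitzWith.of_dist_le_mul (K := t) fun G G' => by
        rw [dist_eq_norm, ← intervalIntegral.integral_sub (hi _ _ _) (hi _ _ _)]
        refine (intervalIntegral.norm_integral_le_of_norm_le_const (C := dist G G')
          fun s _ => ?_).trans (le_of_eq ?_)
        · rw [← dist_eq_norm]
          exact dist_integral_le _ G G'
        · rw [sub_zero, abs_of_nonneg t.coe_nonneg, mul_comm]).continuous
    have e : (V : Set ((Tempered ψ →ᵇ ℝ) × (Tempered ψ →ᵇ ℝ))) = ⋂ t : ℝ≥0,
        {p | ∫ γ, p.1 γ ∂(μ t : Measure (Tempered ψ)) =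
          ∫ γ, p.1 γ ∂(μ₀ : Measure (Tempered ψ)) +
            ∫ s in (0 : ℝ)..t, ∫ γ, p.2 γ ∂(μ s.toNNReal : Measure (Tempered ψ))} := by
      ext p
      rw [Set.mem_iInter]
      rfl
    rw [e]
    exact isClosed_iInter fun t => isClosed_eq ((hc _).comp continuous_fst)
      (((hc _).comp continuous_fst).add ((hc' t).comp continuous_snd))
  have hle : Submodule.span ℝ (genPairs b ψ) ≤ V := Submodule.span_le.2 h
  exact fun p hp => closure_minimal ((preGraph_subset_span hψc hψ hb).trans hle) hV hp

section Integrable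

variable {c : ℝ} {φ : X → ℝ} (h : CpsiWith b ψ c φ) (hψc : Continuous ψ) (hψ : ∀ x, 0 < ψ x)
  (hb : Admissible b ψ) (hc : 0 < c) (ν : ProbabilityMeasure (Tempered ψ))

include h hψc hψ hb hc

lemma CpsiWith.integrable_Fphi : Integrable (Fphi ψ φ) (ν : Measure (Tempered ψ)) :=
  Integrable.of_bound (h.continuous_Fphi hψc hψ hb hc).measurable.aestronglyMeasurable 1
    (ae_of_all _ fun γ => by
      rw [Real.norm_of_nonneg (h.Fphi_pos hψ hb hc γ).le]
      exact h.Fphi_le_one hψ hb hc γ)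

lemma CpsiWith.integrable_genFphi : Integrable (genFphi b ψ φ) (ν : Measure (Tempered ψ)) :=
  Integrable.of_bound (h.continuous_genFphi hψc hψ hb hc).measurable.aestronglyMeasurable _
    (ae_of_all _ (h.abs_genFphi_le hψ hb hc))

lemma CpsiWith.abs_integral_sub_le {c' : ℝ} {χ : X → ℝ} (h' : CpsiWith b ψ c' χ) (hc' : 0 < c')
    {u C : ℝ} (hC : ∀ γ, |Fphi ψ χ γ - Fphi ψ φ γ - u * genFphi b ψ φ γ| ≤ C) :
    |∫ γ, Fphi ψ χ γ ∂(ν : Measure (Tempered ψ)) - ∫ γ, Fphi ψ φ γ ∂(ν : Measure (Tempered ψ)) -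
      u * ∫ γ, genFphi b ψ φ γ ∂(ν : Measure (Tempered ψ))| ≤ C := by
  have i1 := h'.integrable_Fphi hψc hψ hb hc' ν
  have i2 := h.integrable_Fphi hψc hψ hb hc ν
  have i3 := (h.integrable_genFphi hψc hψ hb hc ν).const_mul u
  have i4 : Integrable (fun γ => Fphi ψ χ γ - Fphi ψ φ γ) (ν : Measure (Tempered ψ)) := i1.sub i2
  rw [← integral_sub i1 i2, ← integral_const_mul, ← integral_sub i4 i3]
  exact abs_integral_le_of_abs_le ν hC

end Integrable

lemma CpsiWith.exists_isMild {c : ℝ} {φ : X → ℝ} (h : CpsiWith b ψ c φ) (hψc : Continuous ψ)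
    (hψ : ∀ x, 0 < ψ x) (hb : Admissible b ψ) (hc : 0 < c) : ∃ q, IsMild b φ q := by
  obtain ⟨g, rfl⟩ := h.exists_test hψc hψ hb hc
  exact ⟨_, isMild_flow hψc hψ hb g⟩

/-- The laws of the branching process satisfy the Fokker-Planck equation. -/
lemma isFPSolution_evol (hψc : Continuous ψ) (hψ : ∀ x, 0 < ψ x) (hb : Admissible b ψ)
    (μ₀ : ProbabilityMeasure (Tempered ψ)) : IsFPSolution b ψ μ₀ (evol hψc hψ hb μ₀) where
  initial := evol_zero hψc hψ hb μ₀
  measurable F hF _ := measurable_integral_evol hψc hψ hb μ₀ hF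
  equation F LF hF := by
    refine equation_of_genPairs hψc hψ hb (continuous_evol hψc hψ hb μ₀) ?_ (F, LF) hF
    rintro ⟨F, G⟩ ⟨c, φ, hc, h, hF, hG⟩ t
    obtain ⟨q, hq⟩ := h.exists_isMild hψc hψ hb hc
    obtain ⟨K, hK, H⟩ := exists_abs_Fphi_sub_le (b := b) hψc hψ hb hc
    have hcont := continuous_integral_toNNReal (continuous_evol hψc hψ hb μ₀)
    have key := intervalIntegral.integral_eq_sub_of_hasDeriv_right (a := 0) (b := (t : ℝ))
      (hcont F).continuousOn (f' := fun s : ℝ =>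
        ∫ γ, G γ ∂(evol hψc hψ hb μ₀ s.toNNReal : Measure (Tempered ψ))) ?_
      ((hcont G).intervalIntegrable _ _)
    · rw [key, Real.toNNReal_coe, Real.toNNReal_zero, evol_zero]
      ring
    · intro s hs
      rw [min_eq_left t.coe_nonneg] at hs
      refine hasDerivWithinAt_Ioi_of_abs_sub_le (K := K) fun u h0 h1 => ?_
      simp_rw [hF, hG]
      -- by duality, the increment of time is moved from the law to the function
      have e : ∫ γ, Fphi ψ φ γ ∂(evol hψc hψ hb μ₀ (s + u).toNNReal : Measure (Tempered ψ)) =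
          ∫ γ, Fphi ψ (q u) γ ∂(evol hψc hψ hb μ₀ s.toNNReal : Measure (Tempered ψ)) := by
        rw [integral_Fphi_evol hψc hψ hb μ₀ hc h hq,
          integral_Fphi_evol hψc hψ hb μ₀ (by positivity) (h.evolve hψc hψ hb hc hq h0)
            (hq.shift hb h0), Real.coe_toNNReal _ hs.1.le,
          Real.coe_toNNReal _ (by linarith [hs.1])]
      have hqu := h.evolve hψc hψ hb hc hq h0
      rw [e]
      exact h.abs_integral_sub_le hψc hψ hb hc _ hqu (mul_pos (Real.exp_pos _) hc)
        fun γ => H φ q h hq u h0 h1 γ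

/-! ### Closability -/

/-- The operator is closable: the equation of the branching process started from a Dirac measure
at `γ`, differentiated at time `0`, gives back `LF(γ)` from `F`. -/
lemma eq_of_mem_graphL (hψc : Continuous ψ) (hψ : ∀ x, 0 < ψ x) (hb : Admissible b ψ)
    {F G G' : Tempered ψ →ᵇ ℝ} (h : (F, G) ∈ graphL b ψ) (h' : (F, G') ∈ graphL b ψ) :
    G = G' := by
  ext γ
  let μ₀ : ProbabilityMeasure (Tempered ψ) := diracProba γ
  have hsol := isFPSolution_evol hψc hψ hb μ₀
  have hcont := continuous_integral_toNNReal (continuous_evol hψc hψ hb μ₀)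
  have hd : ∀ G : Tempered ψ →ᵇ ℝ, HasDerivWithinAt (fun t : ℝ => ∫ s in (0 : ℝ)..t,
      ∫ γ, G γ ∂(evol hψc hψ hb μ₀ s.toNNReal : Measure (Tempered ψ))) (G γ) (Set.Ioi 0) 0 := by
    intro G
    have h1 := intervalIntegral.integral_hasDerivAt_right
      ((hcont G).intervalIntegrable 0 0) ((hcont G).stronglyMeasurableAtFilter _ _)
      (hcont G).continuousAt
    have e : ∫ γ, G γ ∂(evol hψc hψ hb μ₀ (0 : ℝ).toNNReal : Measure (Tempered ψ)) = G γ := by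
      rw [Real.toNNReal_zero, evol_zero]
      exact integral_dirac' (fun γ => G γ) γ G.continuous.stronglyMeasurable
    rw [e] at h1
    exact h1.hasDerivWithinAt
  have heq : ∀ t : ℝ, 0 ≤ t →
      ∫ s in (0 : ℝ)..t, ∫ γ, G γ ∂(evol hψc hψ hb μ₀ s.toNNReal : Measure (Tempered ψ)) =
      ∫ s in (0 : ℝ)..t, ∫ γ, G' γ ∂(evol hψc hψ hb μ₀ s.toNNReal : Measure (Tempered ψ)) := by
    intro t ht
    have h1 := hsol.equation F G h ⟨t, ht⟩
    have h2 := hsol.equation F G' h' ⟨t, ht⟩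
    rw [h1] at h2
    exact add_left_cancel h2
  exact (uniqueDiffWithinAt_Ioi 0).eq_deriv _ (hd G)
    ((hd G').congr (fun t ht => heq t (Set.mem_Ioi.1 ht).le) (heq 0 le_rfl))

end FokkerPlanck

/-! ### Uniqueness of the solution -/

section Uniqueness

variable {X : Type*} [TopologicalSpace X] [PolishSpace X] [LocallyCompactSpace X]
  [MeasurableSpace X] [BorelSpace X] {ψ : X → ℝ} {b : Kernel X (Configuration X)}
  [IsMarkovKernel b] {μ₀ : ProbabilityMeasure (Tempered ψ)}
  {μ : ℝ≥0 → ProbabilityMeasure (Tempered ψ)}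

lemma IsFPSolution.intervalIntegrable (hsol : IsFPSolution b ψ μ₀ μ) {G : Tempered ψ → ℝ}
    (hG : Measurable G) {B : ℝ} (hB : ∀ γ, |G γ| ≤ B) (u v : ℝ) :
    IntervalIntegrable (fun s : ℝ => ∫ γ, G γ ∂(μ s.toNNReal : Measure (Tempered ψ)))
      volume u v := by
  have hm : Measurable fun s : ℝ => ∫ γ, G γ ∂(μ s.toNNReal : Measure (Tempered ψ)) := by
    have h3 := (hsol.measurable G hG ⟨B, hB⟩).comp measurable_real_toNNReal
    exact h3
  refine (intervalIntegrable_const (c := B)).mono_fun' hm.aestronglyMeasurable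
    (ae_of_all _ fun s => ?_)
  exact abs_integral_le_of_abs_le _ hB

section

variable {c : ℝ} {φ : X → ℝ} (hsol : IsFPSolution b ψ μ₀ μ) (hψc : Continuous ψ)
  (hψ : ∀ x, 0 < ψ x) (hb : Admissible b ψ)

include hsol hψc hψ hb

lemma IsFPSolution.intervalIntegrable_genFphi (h : CpsiWith b ψ c φ) (hc : 0 < c) (u v : ℝ) :
    IntervalIntegrable (fun s : ℝ => ∫ γ, genFphi b ψ φ γ ∂(μ s.toNNReal : Measure (Tempered ψ)))
      volume u v :=
  hsol.intervalIntegrable (h.continuous_genFphi hψc hψ hb hc).measurable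
    (h.abs_genFphi_le hψ hb hc) u v

lemma IsFPSolution.integral_Fphi_sub (h : CpsiWith b ψ c φ) (hc : 0 < c) {a a' : ℝ} (ha : 0 ≤ a)
    (haa : a ≤ a') :
    ∫ γ, Fphi ψ φ γ ∂(μ a'.toNNReal : Measure (Tempered ψ)) -
      ∫ γ, Fphi ψ φ γ ∂(μ a.toNNReal : Measure (Tempered ψ)) =
    ∫ s in a..a', ∫ γ, genFphi b ψ φ γ ∂(μ s.toNNReal : Measure (Tempered ψ)) := by
  obtain ⟨F, G, hm, hF, hG⟩ := h.exists_mem_genPairs hψc hψ hb hc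
  have heq := hsol.equation F G (subset_closure (genPairs_subset_preGraph hψ hb hm))
  have h1 := heq a.toNNReal
  have h2 := heq a'.toNNReal
  simp_rw [hF, hG] at h1 h2
  rw [Real.coe_toNNReal _ ha] at h1
  rw [Real.coe_toNNReal _ (ha.trans haa)] at h2
  have hi := hsol.intervalIntegrable_genFphi hψc hψ hb h hc
  rw [h1, h2, add_sub_add_left_eq_sub, intervalIntegral.integral_interval_sub_left (hi _ _)
    (hi _ _)]

lemma IsFPSolution.abs_integral_Fphi_sub_le (h : CpsiWith b ψ c φ) (hc : 0 < c) {a a' : ℝ}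
    (ha : 0 ≤ a) (haa : a ≤ a') :
    |∫ γ, Fphi ψ φ γ ∂(μ a'.toNNReal : Measure (Tempered ψ)) -
      ∫ γ, Fphi ψ φ γ ∂(μ a.toNNReal : Measure (Tempered ψ))| ≤
    1 / deathBound hb * (1 / c) * (a' - a) := by
  rw [hsol.integral_Fphi_sub hψc hψ hb h hc ha haa, ← Real.norm_eq_abs]
  refine (intervalIntegral.norm_integral_le_of_norm_le_const fun s _ => ?_).trans
    (le_of_eq (by rw [abs_of_nonneg (sub_nonneg.2 haa)]))
  exact abs_integral_le_of_abs_le _ (h.abs_genFphi_le hψ hb hc)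

/-- Every solution is dual to the evolution equation. The function `s ↦ μ_s(F^{q_{t-s}})` is shown
to be constant. No continuity of `s ↦ μ_s(LF^φ)` is known a priori; it is recovered, with Hölder
exponent `1/2`, by approximating `LF^φ` with the difference quotients `(F^{q_k} - F^φ) / k`. -/
lemma IsFPSolution.integral_Fphi_eq (h : CpsiWith b ψ c φ) (hc : 0 < c) {q : ℝ → X → ℝ}
    (hq : IsMild b φ q) (t : ℝ≥0) :
    ∫ γ, Fphi ψ φ γ ∂(μ t : Measure (Tempered ψ)) =
      ∫ γ, Fphi ψ (q t) γ ∂(μ₀ : Measure (Tempered ψ)) := by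
  set c' := Real.exp (-(t + 1)) * c with hc'
  have hc0 : 0 < c' := by positivity
  have hC : ∀ r : ℝ, 0 ≤ r → r ≤ t + 1 → CpsiWith b ψ c' (q r) := fun r h0 h1 =>
    (h.evolve hψc hψ hb hc hq h0).mono hψ (by rw [hc']; gcongr)
  obtain ⟨K, hK, H⟩ := exists_abs_Fphi_sub_le (b := b) hψc hψ hb hc0
  have H' : ∀ r u : ℝ, 0 ≤ r → r ≤ t → 0 ≤ u → u ≤ 1 → ∀ γ : Tempered ψ,
      |Fphi ψ (q (r + u)) γ - Fphi ψ (q r) γ - u * genFphi b ψ (q r) γ| ≤ K * u ^ 2 :=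
    fun r u h0 h1 h2 h3 γ => by
      have := H (q r) _ (hC r h0 (by linarith)) (hq.shift hb h0) u h2 h3 γ
      rwa [add_comm u r] at this
  set B := 1 / deathBound hb * (1 / c') with hB
  have hB0 : 0 ≤ B := by have := deathBound_pos hb; positivity
  let m : ℝ → (Tempered ψ → ℝ) → ℝ := fun s F => ∫ γ, F γ ∂(μ s.toNNReal : Measure (Tempered ψ))
  -- the Hölder continuity of `s ↦ μ_s(LF)`
  have holder : ∀ r s a u : ℝ, 0 ≤ r → r ≤ t → 0 ≤ s → s ≤ a → a ≤ s + u → 0 < u → u ≤ 1 →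
      |m a (genFphi b ψ (q r)) - m s (genFphi b ψ (q r))| ≤ (2 * B + 2 * K) * √u := by
    intro r s a u hr hrt hs hsa hau hu hu1
    set k := √u with hk
    have hk0 : 0 < k := Real.sqrt_pos.2 hu
    have hk1 : k ≤ 1 := Real.sqrt_le_one.2 hu1
    have hk2 : k ^ 2 = u := Real.sq_sqrt hu.le
    have c1 := hC r hr (by linarith)
    have c2 := hC (r + k) (by positivity) (by linarith)
    have e1 := abs_le.1 (c1.abs_integral_sub_le hψc hψ hb hc0 (μ a.toNNReal) c2 hc0
      (H' r k hr hrt hk0.le hk1))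
    have e2 := abs_le.1 (c1.abs_integral_sub_le hψc hψ hb hc0 (μ s.toNNReal) c2 hc0
      (H' r k hr hrt hk0.le hk1))
    have e3 := abs_le.1 (hsol.abs_integral_Fphi_sub_le hψc hψ hb c1 hc0 hs hsa)
    have e4 := abs_le.1 (hsol.abs_integral_Fphi_sub_le hψc hψ hb c2 hc0 hs hsa)
    rw [← hB] at e3 e4
    rw [hk2] at e1 e2
    have e5 : B * (a - s) ≤ B * u := by gcongr; linarith
    have e6 : |k * (m a (genFphi b ψ (q r)) - m s (genFphi b ψ (q r)))| ≤
        (2 * B + 2 * K) * u := by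
      rw [abs_le]
      simp only [m]
      constructor <;> linarith [e1.1, e1.2, e2.1, e2.2, e3.1, e3.2, e4.1, e4.2]
    rw [abs_mul, abs_of_pos hk0] at e6
    have e7 : k * |m a (genFphi b ψ (q r)) - m s (genFphi b ψ (q r))| ≤
        k * ((2 * B + 2 * K) * k) := e6.trans (le_of_eq (by rw [← hk2]; ring))
    exact le_of_mul_le_mul_left e7 hk0
  have key := eq_of_abs_sub_le_mul_sqrt (g := fun s => m s (Fphi ψ (q (t - s)))) (t := t)
    (K := 2 * B + 3 * K) t.coe_nonneg fun s u hs hu hu1 hsu => ?_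
  · simp only [m] at key
    rw [Real.toNNReal_coe, Real.toNNReal_zero, hsol.initial, sub_self, sub_zero] at key
    rw [← key]
    congr 2
    funext γ
    congr 1
    exact (funext hq.zero).symm
  · rcases hu.eq_or_lt with rfl | hu0
    · simp
    set r := (t : ℝ) - (s + u) with hr
    have hr0 : 0 ≤ r := by linarith
    have hrt : r ≤ t := by linarith
    have er : (t : ℝ) - s = r + u := by rw [hr]; ring
    rw [er]
    have c1 := hC r hr0 (by linarith)
    have c2 := hC (r + u) (by linarith) (by linarith)
    have e1 := hsol.integral_Fphi_sub hψc hψ hb c1 hc0 hs (by linarith : s ≤ s + u)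
    have e2 := c1.abs_integral_sub_le hψc hψ hb hc0 (μ s.toNNReal) c2 hc0
      (H' r u hr0 hrt hu hu1)
    have hi := hsol.intervalIntegrable_genFphi hψc hψ hb c1 hc0
    have e3 : |(∫ a in s..(s + u), m a (genFphi b ψ (q r))) - u * m s (genFphi b ψ (q r))| ≤
        (2 * B + 2 * K) * √u * u := by
      have e4 : u * m s (genFphi b ψ (q r)) = ∫ _ in s..(s + u), m s (genFphi b ψ (q r)) := by
        rw [intervalIntegral.integral_const, smul_eq_mul]; ring
      rw [e4, ← intervalIntegral.integral_sub (hi _ _) intervalIntegrable_const,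
        ← Real.norm_eq_abs]
      refine (intervalIntegral.norm_integral_le_of_norm_le_const fun a ha => ?_).trans
        (le_of_eq (by rw [add_sub_cancel_left, abs_of_nonneg hu]))
      rw [Set.uIoc_of_le (by linarith)] at ha
      exact holder r s a u hr0 hrt hs ha.1.le ha.2 hu0 hu1
    have e5 : K * u ^ 2 ≤ K * (√u * u) := by
      have : u ≤ √u := by
        rw [Real.le_sqrt hu hu]; nlinarith
      rw [sq]
      gcongr
    have e6 : m (s + u) (Fphi ψ (q r)) - m s (Fphi ψ (q (r + u))) =
        ((∫ a in s..(s + u), m a (genFphi b ψ (q r))) - u * m s (genFphi b ψ (q r))) -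
          (m s (Fphi ψ (q (r + u))) - m s (Fphi ψ (q r)) - u * m s (genFphi b ψ (q r))) := by
      rw [← e1]
      ring
    rw [e6]
    refine (abs_sub _ _).trans ((add_le_add e3 (e2.trans e5)).trans (le_of_eq ?_))
    ring

end

/-! ### The functions `F^φ` determine a law on `Γ^ψ` -/

/-- If `g` is bounded below, then `e^{-sgψ}` is in `C_ψ(X)` for small `s`. Since Laplace transforms
are analytic, this is sufficient to identify the law of `∑_{x ∈ γ} g(x) ψ(x)`. -/
lemma integral_exp_eq_of_integral_Fphi_eq (hψc : Continuous ψ) (hψ : ∀ x, 0 < ψ x)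
    (hC : (Cpsi b ψ).Nonempty) {ν ν' : ProbabilityMeasure (Tempered ψ)}
    (h : ∀ (c : ℝ) (φ : X → ℝ), 0 < c → CpsiWith b ψ c φ →
      ∫ γ, Fphi ψ φ γ ∂(ν : Measure (Tempered ψ)) = ∫ γ, Fphi ψ φ γ ∂(ν' : Measure (Tempered ψ)))
    (g : Test X) {ε : ℝ} (hε : 0 < ε) (hg : ∀ x, ε ≤ g.1 x) :
    ∫ γ, Real.exp (-wsum g.1 γ) ∂(ν : Measure (Tempered ψ)) =
      ∫ γ, Real.exp (-wsum g.1 γ) ∂(ν' : Measure (Tempered ψ)) := by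
  obtain ⟨_, c₀, hc₀, hδ⟩ := hC
  have hδ' : ∀ x, deathProb b x ≤ 1 - c₀ * ψ x := fun x => by linarith [(hδ x).1, (hδ x).2]
  have hIio : ∀ ν : ProbabilityMeasure (Tempered ψ),
      Set.Iio 0 ⊆ interior (integrableExpSet (wsum g.1) (ν : Measure (Tempered ψ))) := by
    intro ν
    refine interior_maximal (fun s hs => ?_) isOpen_Iio
    have hc : Continuous fun γ : Tempered ψ => Real.exp (s * wsum g.1 γ) :=
      ((continuous_wsum g.1).const_mul s).rexp
    refine Integrable.of_bound hc.measurable.aestronglyMeasurable 1 (ae_of_all _ fun γ => ?_)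
    rw [Real.norm_of_nonneg (Real.exp_pos _).le, Real.exp_le_one_iff]
    exact mul_nonpos_of_nonpos_of_nonneg (le_of_lt hs) (wsum_nonneg hψ g.nonneg γ)
  have hA : ∀ ν : ProbabilityMeasure (Tempered ψ),
      AnalyticOnNhd ℝ (mgf (wsum g.1) (ν : Measure (Tempered ψ))) (Set.Iio 0) := fun ν =>
    analyticOnNhd_mgf.mono (hIio ν)
  set s₀ := c₀ / (‖g.1‖ + 1) with hs₀
  have hs₀' : 0 < s₀ := by positivity
  -- for small parameters, the transforms agree
  have hsmall : ∀ s, 0 < s → s < s₀ → mgf (wsum g.1) (ν : Measure (Tempered ψ)) (-s) =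
      mgf (wsum g.1) (ν' : Measure (Tempered ψ)) (-s) := by
    intro s hs hs'
    let f : Test X := ⟨s • g.1, fun x => mul_nonneg hs.le (g.nonneg x)⟩
    have hf : ∀ γ : Tempered ψ, Fphi ψ (expTest ψ f) γ = Real.exp (-s * wsum g.1 γ) := fun γ => by
      rw [Fphi_expTest hψ]
      change Real.exp (-wsum (s • g.1) γ) = _
      rw [wsum_smul, neg_mul]
    have hfx : ∀ x, f.1 x = s * g.1 x := fun x => rfl
    have hgn : ∀ x, g.1 x ≤ ‖g.1‖ := fun x => (le_abs_self _).trans (g.1.norm_coe_le_norm x)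
    have hsg : s * ‖g.1‖ ≤ c₀ := by
      have h1 : s * (‖g.1‖ + 1) < c₀ := (lt_div_iff₀ (by positivity)).1 hs'
      nlinarith
    have hψ1 : ∀ x, c₀ * ψ x ≤ 1 := fun x => by
      have : 0 ≤ deathProb b x := measureReal_nonneg
      linarith [hδ' x]
    have hmem : CpsiWith b ψ (s * ε * Real.exp (-1)) (expTest ψ f) :=
      { continuous := continuous_expTest hψc f
        le := fun x => by
          have hu : f.1 x * ψ x ≤ 1 := by
            rw [hfx]
            calc s * g.1 x * ψ x ≤ s * ‖g.1‖ * ψ x := by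
                  have := (hψ x).le
                  gcongr
                  exact hgn x
              _ ≤ c₀ * ψ x := by have := (hψ x).le; gcongr
              _ ≤ 1 := hψ1 x
          have hl : s * ε * ψ x ≤ f.1 x * ψ x := by
            rw [hfx]; have := (hψ x).le; gcongr; exact hg x
          have h2 := Real.add_one_le_exp (f.1 x * ψ x)
          have h3 : Real.exp (f.1 x * ψ x) * Real.exp (-(f.1 x * ψ x)) = 1 := by
            rw [← Real.exp_add]; simp
          have h4 : Real.exp (-1) ≤ Real.exp (-(f.1 x * ψ x)) := Real.exp_le_exp.2 (by linarith)
          have h5 : 0 ≤ s * ε * ψ x := by have := hψ x; positivity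
          have h6 : s * ε * ψ x * Real.exp (-1) ≤
              f.1 x * ψ x * Real.exp (-(f.1 x * ψ x)) := by
            gcongr
            exact h5.trans hl
          unfold expTest
          nlinarith [Real.exp_pos (-(f.1 x * ψ x))]
        deathProb_le := fun x => by
          have h1 := one_sub_expTest_le (ψ := ψ) f x
          have h2 : f.1 x * ψ x ≤ c₀ * ψ x := by
            rw [hfx]
            have := (hψ x).le
            gcongr
            exact (mul_le_mul_of_nonneg_left (hgn x) hs.le).trans hsg
          linarith [hδ' x] }
    have := h _ _ (by positivity) hmem
    simp_rw [hf] at this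
    exact this
  -- the identity theorem on the half-line where the transforms are analytic
  have heq := (hA ν).eqOn_of_preconnected_of_eventuallyEq (hA ν') (isPreconnected_Iio)
    (z₀ := -(s₀ / 2)) (Set.mem_Iio.2 (by linarith)) (by
      filter_upwards [Ioo_mem_nhds (by linarith : -s₀ < -(s₀ / 2))
        (by linarith : -(s₀ / 2) < (0 : ℝ))] with s hs
      have := hsmall (-s) (by linarith [hs.2]) (by linarith [hs.1])
      rwa [neg_neg] at this)
  have := heq (Set.mem_Iio.2 (by norm_num : (-1 : ℝ) < 0))
  simpa [mgf] using this

/-- The functions `F^φ`, `φ ∈ C_ψ(X)`, separate the probability measures on `Γ^ψ`: an arbitrary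
`g ≥ 0` is the limit of functions bounded below. -/
lemma eq_of_integral_Fphi_eq (hψc : Continuous ψ) (hψ : ∀ x, 0 < ψ x)
    (hC : (Cpsi b ψ).Nonempty) {ν ν' : ProbabilityMeasure (Tempered ψ)}
    (h : ∀ (c : ℝ) (φ : X → ℝ), 0 < c → CpsiWith b ψ c φ →
      ∫ γ, Fphi ψ φ γ ∂(ν : Measure (Tempered ψ)) =
        ∫ γ, Fphi ψ φ γ ∂(ν' : Measure (Tempered ψ))) : ν = ν' := by
  suffices hm : (ν : Measure (Tempered ψ)) = ν' from Subtype.ext hm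
  refine eq_of_lap_eq hψ fun g => ?_
  have hfin : ∀ ν : ProbabilityMeasure (Tempered ψ), lap (ν : Measure (Tempered ψ)) g ≠ ∞ :=
    fun ν => ne_top_of_le_ne_top ENNReal.one_ne_top (by
      calc lap _ g ≤ ∫⁻ _, 1 ∂(ν : Measure (Tempered ψ)) :=
            lintegral_mono fun γ => expW_le_one hψ g γ
        _ = 1 := by simp)
  rw [← ENNReal.toReal_eq_toReal_iff' (hfin ν) (hfin ν'), ← integral_exp_wsum,
    ← integral_exp_wsum]
  -- approximate `g` by `g + 1 / (n + 1)`
  let f : ℕ → Test X := fun n => ⟨g.1 + (1 / ((n : ℝ) + 1)) • (1 : X →ᵇ ℝ), fun x =>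
    add_nonneg (g.nonneg x) (by
      change 0 ≤ 1 / ((n : ℝ) + 1) * 1
      positivity)⟩
  have hf : ∀ n (γ : Tempered ψ), wsum (f n).1 γ = wsum g.1 γ + 1 / ((n : ℝ) + 1) * wsum 1 γ :=
    fun n γ => by
      change wsum (g.1 + (1 / ((n : ℝ) + 1)) • (1 : X →ᵇ ℝ)) γ = _
      rw [wsum_add hψ, wsum_smul]
  have hlim : ∀ ν : ProbabilityMeasure (Tempered ψ),
      Tendsto (fun n => ∫ γ, Real.exp (-wsum (f n).1 γ) ∂(ν : Measure (Tempered ψ))) atTop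
        (𝓝 (∫ γ, Real.exp (-wsum g.1 γ) ∂(ν : Measure (Tempered ψ)))) := by
    intro ν
    refine tendsto_integral_of_dominated_convergence (fun _ => 1) (fun n =>
      ((continuous_wsum (f n).1).neg.rexp).measurable.aestronglyMeasurable) (integrable_const _)
      (fun n => ae_of_all _ fun γ => ?_) (ae_of_all _ fun γ => ?_)
    · rw [Real.norm_of_nonneg (Real.exp_pos _).le, Real.exp_le_one_iff]
      exact neg_nonpos.2 (wsum_nonneg hψ (f n).nonneg γ)
    · have h1 : Tendsto (fun n : ℕ => wsum g.1 γ + 1 / ((n : ℝ) + 1) * wsum 1 γ) atTop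
          (𝓝 (wsum g.1 γ + 0 * wsum 1 γ)) :=
        (tendsto_one_div_add_atTop_nhds_zero_nat.mul_const _).const_add _
      rw [zero_mul, add_zero] at h1
      simp_rw [hf]
      exact h1.neg.rexp
  refine tendsto_nhds_unique (hlim ν) ((hlim ν').congr fun n => ?_)
  refine (integral_exp_eq_of_integral_Fphi_eq hψc hψ hC h (f n)
    (ε := 1 / ((n : ℝ) + 1)) (by positivity) fun x => ?_).symm
  change _ ≤ g.1 x + 1 / ((n : ℝ) + 1) * 1
  linarith [g.nonneg x]

/-- Every solution has the same integrals of the functions `F^φ` as the branching process. -/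
lemma IsFPSolution.eq_evol (hsol : IsFPSolution b ψ μ₀ μ) (hψc : Continuous ψ)
    (hψ : ∀ x, 0 < ψ x) (hb : Admissible b ψ) (hC : (Cpsi b ψ).Nonempty) :
    μ = evol hψc hψ hb μ₀ := by
  funext t
  refine eq_of_integral_Fphi_eq hψc hψ hC fun c φ hc h => ?_
  obtain ⟨q, hq⟩ := h.exists_isMild hψc hψ hb hc
  rw [hsol.integral_Fphi_eq hψc hψ hb h hc hq, integral_Fphi_evol hψc hψ hb μ₀ hc h hq]

end Uniqueness

end Branching

end

theorem mainTheorem1 {X : Type*} [TopologicalSpace X] [PolishSpace X] [LocallyCompactSpace X]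
    [MeasurableSpace X] [BorelSpace X]
    (ψ : X → ℝ) (hψ_cont : Continuous ψ) (hψ_pos : ∀ x, 0 < ψ x)
    (hψ_zero : Tendsto ψ (cocompact X) (𝓝 0))
    (b : Kernel X (Branching.Configuration X)) [IsMarkovKernel b]
    (hb : Branching.Admissible b ψ) (hC : (Branching.Cpsi b ψ).Nonempty) :
    -- the operator `L` is well defined on `E⁰`, with values in `C_b`, and it is closable
    ((∀ φ ∈ Branching.Cpsi b ψ, ∃ F ∈ Branching.E0 b ψ, ∀ γ, F γ = Branching.Fphi ψ φ γ) ∧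
      (∀ F ∈ Branching.E0 b ψ, ∃ G, (F, G) ∈ Branching.preGraph b ψ) ∧
      (∀ F G G', (F, G) ∈ Branching.graphL b ψ → (F, G') ∈ Branching.graphL b ψ → G = G')) ∧
    -- existence, uniqueness and properties of the solution
    (∀ μ₀ : ProbabilityMeasure (Branching.Tempered ψ),
      ∃ μ : ℝ≥0 → ProbabilityMeasure (Branching.Tempered ψ),
        Branching.IsFPSolution b ψ μ₀ μ ∧
        (∀ μ', Branching.IsFPSolution b ψ μ₀ μ' → μ' = μ) ∧
        Continuous μ ∧
        (Branching.supMeanOffspring b < 1 →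
          Tendsto μ atTop (𝓝 (diracProba (0 : Branching.Tempered ψ))))) := by
  refine ⟨⟨fun φ hφ => Branching.exists_mem_E0 hψ_cont hψ_pos hb hφ, fun F hF => ?_,
    fun F G G' h h' => Branching.eq_of_mem_graphL hψ_cont hψ_pos hb h h'⟩, fun μ₀ => ?_⟩
  · obtain ⟨-, -, G, -, hG⟩ := Branching.exists_mem_span_genPairs hψ_cont hψ_pos hb hF
    exact ⟨G, hF, hG⟩
  · exact ⟨Branching.evol hψ_cont hψ_pos hb μ₀, Branching.isFPSolution_evol hψ_cont hψ_pos hb μ₀,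
      fun μ' h => h.eq_evol hψ_cont hψ_pos hb hC, Branching.continuous_evol hψ_cont hψ_pos hb μ₀,
      Branching.tendsto_evol hψ_cont hψ_pos hb μ₀⟩
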